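/- Use units with $G=c=1$. An initial data set on $\mathbb{R}^3$ consists of smooth fields: a Riemannian metric $h_{ij}$, a symmetric tensor $K_{ij}$, an energy density $\mu$, a momentum density $j^i$, electric and magnetic fields $E^i,B^i$ and a charge density $\rho$, satisfying the constraint equations $$D_jK^{ij}-D^iK=-8\pi j^i,\qquad R-K_{ij}K^{ij}+K^2=16\pi\mu,\qquad D_iE^i=4\pi\rho,\qquad D_iB^i=0,$$ where $D$ and $R$ are the Levi-Civita connection and the scalar curvature of $h$, and $K=h^{ij}K_{ij}$. It is spherically symmetric if all fields are invariant under the linear action of $SO(3)$. It is asymptotically flat if, in the Cartesian coordinates and as $|x|\to\infty$, $\gamma_{ij}=h_{ij}-\delta_{ij}=O(|x|^{-1})$, $\partial\gamma=O(|x|^{-2})$, $\partial\partial\gamma=O(|x|^{-3})$, $K_{ij}=O(|x|^{-2})$, $\partial K_{ij}=O(|x|^{-3})$; its total mass $M$ is then the ADM mass. The area radius $r$ of a sphere centred at the origin is defined by: its $h$-area is $4\pi r^2$. Its null expansions are $\theta^\pm=H\pm(h^{ij}-n^in^j)K_{ij}$, with $n$ the outward unit normal and $H=D_in^i$ (that is,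 $\theta^\pm=\frac2r(r'\pm rK_r)$ in geodesic coordinates, where the prime is the derivative with respect to proper radial distance and $K_r$ is the tangential eigenvalue of $K_{ij}$). A region is untrapped if $\theta^+\theta^->0$ on it and trapped if $\theta^+\theta^-<0$ on it. A horizon is a centred sphere with $\theta^+\theta^-=0$ outside of which no centred sphere is trapped; so the outer boundary of the set of trapped spheres is a horizon, and degenerate horizons are included. Theorem. Consider spherically symmetric initial data on $\mathbb{R}^3$ and a closed ball $\mathcal B$ centred at the origin, whose boundary has area radius $\mathcal R>0$, such that outside $\mathcal B$ the data are electrovacuum ($\mu=\frac1{8\pi}(|E|^2+|B|^2)$, $j=0$, $\rho=0$), in $\mathcal B$ the dominant energy condition $\mu\ge|j|$ holds, and the charge $Q=\int_{\mathcal B}\rho\,dv_h$ is non-zero. (i) If the data are asymptotically flat and the exterior of $\mathcal B$ is untrapped, then $2\mathcal R>|Q|$. (ii) If the data are asymptotically flat and there is a horizon outside the interior of $\mathcal B$, then its area radius $\mathcal R_0$ satisfies $\mathcal R_0\ge|Q|$. Equality is achieved for extreme Reissner–Nordström exteriors: if $M=|Q|$, then $\mathcal R_0=|Q|$; and for every $Q\ne0$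 there are such data with charge $Q$, total mass $M=|Q|$, and a horizon strictly outside $\mathcal B$, of area radius $|Q|$, whose exterior is untrapped. Moreover: (a) Inequality (i) is sharp: there is a sequence of data that satisfy all the hypotheses of (i), with $|Q_n|/(2\mathcal R_n)\to1$, $\mathcal R_n\to0$, $Q_n\to0$, $M_n\to0$. They can be taken to be (smooth) charged shells whose relative thickness tends to zero: $K_{ij}=0$, and $\mu=\rho=0$ in a concentric ball of area radius $\mathcal R_n'<\mathcal R_n$ with $\mathcal R_n'/\mathcal R_n\to1$. (b) Asymptotic flatness is necessary: there are data that are not asymptotically flat but satisfy all the other hypotheses of (i), with $2\mathcal R<|Q|$. (c) There are asymptotically flat data as in (ii), with a horizon strictly outside $\mathcal B$ that is the outer boundary of a trapped region outside $\mathcal B$ and has an untrapped exterior, with $2\mathcal R<|Q|$. -/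

import Mathlib

open scoped ContDiff Matrix Topology

noncomputable section

/-- Euclidean three-space; its coordinates are the Cartesian coordinates `x 0, x 1, x 2`. -/
abbrev E3 : Type := EuclideanSpace ℝ (Fin 3)

/-- The partial derivative of a scalar function along the `k`-th coordinate. -/
def pd (k : Fin 3) (f : E3 → ℝ) (x : E3) : ℝ :=
  fderiv ℝ f x (EuclideanSpace.single k 1)

/-- Christoffel symbols `Γ^i_{jk}` of a metric given by its components. -/
def christoffel (h : E3 → Matrix (Fin 3) (Fin 3) ℝ) (i j k : Fin 3) (x : E3) : ℝ :=
  (1 / 2 : ℝ) * ∑ l, (h x)⁻¹ i l *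
    (pd j (fun y => h y l k) x + pd k (fun y => h y l j) x - pd l (fun y => h y j k) x)

/-- Ricci curvature
`R_{jk} = ∂_i Γ^i_{jk} - ∂_j Γ^i_{ik} + Γ^i_{il} Γ^l_{jk} - Γ^i_{jl} Γ^l_{ik}`. -/
def ricci (h : E3 → Matrix (Fin 3) (Fin 3) ℝ) (j k : Fin 3) (x : E3) : ℝ :=
  (∑ i, (pd i (christoffel h i j k) x - pd j (christoffel h i i k) x)) +
    ∑ i, ∑ l, (christoffel h i i l x * christoffel h l j k x
      - christoffel h i j l x * christoffel h l i k x)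

/-- Scalar curvature `R = h^{jk} R_{jk}`. -/
def scalarCurv (h : E3 → Matrix (Fin 3) (Fin 3) ℝ) (x : E3) : ℝ :=
  ∑ j, ∑ k, (h x)⁻¹ j k * ricci h j k x

/-- Covariant derivative `D_k T_{ij}` of a covariant two-tensor. -/
def covDeriv (h T : E3 → Matrix (Fin 3) (Fin 3) ℝ) (k i j : Fin 3) (x : E3) : ℝ :=
  pd k (fun y => T y i j) x -
    ∑ l, (christoffel h l k i x * T x l j + christoffel h l k j x * T x i l)

/-- Divergence `D_i V^i` of a vector field. -/
def divergence (h : E3 → Matrix (Fin 3) (Fin 3) ℝ) (V : E3 → Fin 3 → ℝ) (x : E3) : ℝ :=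
  ∑ i, (pd i (fun y => V y i) x + ∑ k, christoffel h i i k x * V x k)

/-- Trace `h^{ij} T_{ij}`. -/
def traceWrt (h T : E3 → Matrix (Fin 3) (Fin 3) ℝ) (x : E3) : ℝ :=
  ∑ i, ∑ j, (h x)⁻¹ i j * T x i j

/-- `|T|² = h^{ia} h^{jb} T_{ij} T_{ab}`. -/
def tensorNormSq (h T : E3 → Matrix (Fin 3) (Fin 3) ℝ) (x : E3) : ℝ :=
  ∑ i, ∑ j, ∑ a, ∑ b, (h x)⁻¹ i a * (h x)⁻¹ j b * T x i j * T x a b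

/-- `|V|² = h_{ij} V^i V^j`. -/
def vecNormSq (h : E3 → Matrix (Fin 3) (Fin 3) ℝ) (V : E3 → Fin 3 → ℝ) (x : E3) : ℝ :=
  ∑ i, ∑ j, h x i j * V x i * V x j

/-- A smooth initial data set for the Einstein-Maxwell equations with sources on `ℝ³`
(units `G = c = 1`): Riemannian metric `h_{ij}`, second fundamental form `K_{ij}`, energy density
`μ`, momentum density `j^i`, electric and magnetic fields `E^i`, `B^i`, charge density `ρ`,
subject to the Einstein and Maxwell constraint equations. -/
structure InitialData where
  h : E3 → Matrix (Fin 3) (Fin 3) ℝ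
  K : E3 → Matrix (Fin 3) (Fin 3) ℝ
  μ : E3 → ℝ
  j : E3 → Fin 3 → ℝ
  E : E3 → Fin 3 → ℝ
  B : E3 → Fin 3 → ℝ
  ρ : E3 → ℝ
  smooth_h : ∀ a b, ContDiff ℝ ∞ (fun x => h x a b)
  smooth_K : ∀ a b, ContDiff ℝ ∞ (fun x => K x a b)
  smooth_μ : ContDiff ℝ ∞ μ
  smooth_j : ∀ a, ContDiff ℝ ∞ (fun x => j x a)
  smooth_E : ∀ a, ContDiff ℝ ∞ (fun x => E x a)
  smooth_B : ∀ a, ContDiff ℝ ∞ (fun x => B x a)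
  smooth_ρ : ContDiff ℝ ∞ ρ
  posDef_h : ∀ x, (h x).PosDef
  symm_K : ∀ x, (K x).IsSymm
  /-- Momentum constraint `D_b K^{ab} - D^a K = -8π j^a`. -/
  momentum : ∀ x a,
    (∑ b, ∑ c, ∑ d, (h x)⁻¹ a c * (h x)⁻¹ b d * covDeriv h K b c d x)
      - ∑ c, (h x)⁻¹ a c * pd c (traceWrt h K) x = -8 * Real.pi * j x a
  /-- Hamiltonian constraint `R - |K|² + (tr K)² = 16π μ`. -/
  hamiltonian : ∀ x,
    scalarCurv h x - tensorNormSq h K x + traceWrt h K x ^ 2 = 16 * Real.pi * μ x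
  gauss_E : ∀ x, divergence h E x = 4 * Real.pi * ρ x
  gauss_B : ∀ x, divergence h B x = 0

namespace InitialData

/-- The action of a matrix on points. -/
def act (A : Matrix (Fin 3) (Fin 3) ℝ) (x : E3) : E3 := WithLp.toLp 2 (A *ᵥ x.ofLp)

/-- Invariance of all fields under the rotation group `SO(3)` acting linearly on `ℝ³`. -/
structure SphericallySymmetric (D : InitialData) : Prop where
  h_inv : ∀ A ∈ Matrix.specialOrthogonalGroup (Fin 3) ℝ, ∀ x, D.h (act A x) = A * D.h x * Aᵀ
  K_inv : ∀ A ∈ Matrix.specialOrthogonalGroup (Fin 3) ℝ, ∀ x, D.K (act A x) = A * D.K x * Aᵀ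
  μ_inv : ∀ A ∈ Matrix.specialOrthogonalGroup (Fin 3) ℝ, ∀ x, D.μ (act A x) = D.μ x
  j_inv : ∀ A ∈ Matrix.specialOrthogonalGroup (Fin 3) ℝ, ∀ x, D.j (act A x) = A *ᵥ D.j x
  E_inv : ∀ A ∈ Matrix.specialOrthogonalGroup (Fin 3) ℝ, ∀ x, D.E (act A x) = A *ᵥ D.E x
  B_inv : ∀ A ∈ Matrix.specialOrthogonalGroup (Fin 3) ℝ, ∀ x, D.B (act A x) = A *ᵥ D.B x
  ρ_inv : ∀ A ∈ Matrix.specialOrthogonalGroup (Fin 3) ℝ, ∀ x, D.ρ (act A x) = D.ρ x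

/-- Asymptotic flatness in Cartesian coordinates: `γ = h - δ` is `O(|x|⁻¹)`, `∂γ = O(|x|⁻²)`,
`∂∂γ = O(|x|⁻³)`, `K = O(|x|⁻²)`, `∂K = O(|x|⁻³)` as `|x| → ∞`. -/
structure AsymptoticallyFlat (D : InitialData) : Prop where
  metric : ∀ a b, (fun x => D.h x a b - (1 : Matrix (Fin 3) (Fin 3) ℝ) a b)
    =O[Bornology.cobounded E3] (fun x => ‖x‖⁻¹)
  metric_deriv : ∀ a b k, (fun x => pd k (fun y => D.h y a b) x)
    =O[Bornology.cobounded E3] (fun x => (‖x‖ ^ 2)⁻¹)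
  metric_deriv2 : ∀ a b k l, (fun x => pd l (pd k (fun y => D.h y a b)) x)
    =O[Bornology.cobounded E3] (fun x => (‖x‖ ^ 3)⁻¹)
  extrinsic : ∀ a b, (fun x => D.K x a b)
    =O[Bornology.cobounded E3] (fun x => (‖x‖ ^ 2)⁻¹)
  extrinsic_deriv : ∀ a b k, (fun x => pd k (fun y => D.K y a b) x)
    =O[Bornology.cobounded E3] (fun x => (‖x‖ ^ 3)⁻¹)

/-- The non-electromagnetic energy density `μ_M = μ - (|E|² + |B|²) / 8π`. -/
def matterDensity (D : InitialData) (x : E3) : ℝ :=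
  D.μ x - 1 / (8 * Real.pi) * (vecNormSq D.h D.E x + vecNormSq D.h D.B x)

/-- The dominant energy condition `μ ≥ |j|` on a region. -/
def DominantEnergy (D : InitialData) (U : Set E3) : Prop :=
  ∀ x ∈ U, Real.sqrt (vecNormSq D.h D.j x) ≤ D.μ x

/-- Electrovacuum on a region: no matter, no momentum density and no charges there. (In spherical
symmetry the electromagnetic momentum density vanishes, both fields being radial.) -/
def Electrovacuum (D : InitialData) (U : Set E3) : Prop :=
  ∀ x ∈ U, D.matterDensity x = 0 ∧ D.j x = 0 ∧ D.ρ x = 0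

/-- Outward `h`-unit normal `n^i` of the sphere centred at the origin through `x ≠ 0`. -/
def outwardNormal (D : InitialData) (x : E3) (i : Fin 3) : ℝ :=
  (∑ a, (D.h x)⁻¹ i a * x a) / Real.sqrt (∑ a, ∑ b, (D.h x)⁻¹ a b * x a * x b)

/-- Mean curvature `D_i n^i` of the sphere centred at the origin through `x ≠ 0`. -/
def meanCurv (D : InitialData) (x : E3) : ℝ := divergence D.h D.outwardNormal x

/-- Trace `(h^{ij} - n^i n^j) K_{ij}` of `K` tangentially to the sphere through `x`. -/
def tangentialTrace (D : InitialData) (x : E3) : ℝ :=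
  ∑ i, ∑ k, ((D.h x)⁻¹ i k - D.outwardNormal x i * D.outwardNormal x k) * D.K x i k

/-- Outgoing future null expansion `θ⁺` of the centred sphere through `x`. -/
def thetaPlus (D : InitialData) (x : E3) : ℝ := D.meanCurv x + D.tangentialTrace x

/-- Outgoing past null expansion `θ⁻` of the centred sphere through `x`. -/
def thetaMinus (D : InitialData) (x : E3) : ℝ := D.meanCurv x - D.tangentialTrace x

/-- A region is untrapped if `θ⁺ θ⁻ > 0` on it. -/
def Untrapped (D : InitialData) (U : Set E3) : Prop :=
  ∀ x ∈ U, 0 < D.thetaPlus x * D.thetaMinus x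

/-- A region is trapped if `θ⁺ θ⁻ < 0` on it. -/
def Trapped (D : InitialData) (U : Set E3) : Prop :=
  ∀ x ∈ U, D.thetaPlus x * D.thetaMinus x < 0

/-- The sphere `|x| = s` is a horizon: `θ⁺ θ⁻ = 0` on it, and no sphere outside it is trapped.
The outer boundary of the set of trapped spheres is of this kind, and so is the outermost sphere
with `θ⁺ θ⁻ = 0`; the degenerate case where the inside is not trapped is included. -/
def IsHorizon (D : InitialData) (s : ℝ) : Prop :=
  (∀ x : E3, ‖x‖ = s → D.thetaPlus x * D.thetaMinus x = 0) ∧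
    ∀ x : E3, s < ‖x‖ → 0 ≤ D.thetaPlus x * D.thetaMinus x

/-- Area of the sphere `|x| = s` in the metric `h`. The induced area element is
`√(det h · h^{ij} w_i w_j)` times the Euclidean one, `w` the Euclidean unit normal. -/
def sphereArea (D : InitialData) (s : ℝ) : ℝ :=
  ∫ w : Metric.sphere (0 : E3) 1,
    s ^ 2 * Real.sqrt ((D.h (s • (w : E3))).det *
      ∑ a, ∑ b, (D.h (s • (w : E3)))⁻¹ a b * (w : E3) a * (w : E3) b)
    ∂(MeasureTheory.volume : MeasureTheory.Measure E3).toSphere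

/-- Area radius of the sphere `|x| = s`: its area is `4π` times the square of it. -/
def areaRadius (D : InitialData) (s : ℝ) : ℝ := Real.sqrt (D.sphereArea s / (4 * Real.pi))

/-- Electric charge contained in the ball `|x| ≤ s`. -/
def charge (D : InitialData) (s : ℝ) : ℝ :=
  ∫ x in Metric.closedBall (0 : E3) s, D.ρ x * Real.sqrt (D.h x).det

/-- `m` is the total (ADM) mass
`(1/16π) lim_{s → ∞} ∫_{|x| = s} (∂_b h_{ab} - ∂_a h_{bb}) w^a dA`. -/
def HasMass (D : InitialData) (m : ℝ) : Prop :=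
  Filter.Tendsto (fun s : ℝ => 1 / (16 * Real.pi) *
    ∫ w : Metric.sphere (0 : E3) 1,
      s ^ 2 * ∑ a, ∑ b, (pd b (fun y => D.h y a b) (s • (w : E3))
        - pd a (fun y => D.h y b b) (s • (w : E3))) * (w : E3) a
      ∂(MeasureTheory.volume : MeasureTheory.Measure E3).toSphere)
    Filter.atTop (𝓝 m)

/-- Spherically symmetric data containing the ball `|x| ≤ s` as a charged body: dominant energy
condition in the ball, electrovacuum outside it, and total charge of the ball non-zero. -/
structure ChargedBody (D : InitialData) (s : ℝ) : Prop where
  pos : 0 < s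
  spherical : D.SphericallySymmetric
  dominant : D.DominantEnergy (Metric.closedBall 0 s)
  electrovacuum : D.Electrovacuum (Metric.closedBall 0 s)ᶜ
  charge_ne_zero : D.charge s ≠ 0

end InitialData

end

/-! In spherical symmetry everything reduces to functions of the distance t along one axis. Let r be
the area radius, K_r the tangential eigenvalue of K, and a prime the derivative in proper distance.
The Misner–Sharp mass m, given by 2m = r (1 - r'² + r² K_r²), satisfies θ⁺θ⁻ = (4 / r²)(1 - 2m / r).
The Hamiltonian and momentum constraints together say (2m)' = 8π r² (μ r' + r K_r j), with j the
normal component of the momentum density (`SphericallySymmetric.hasDerivAt_misnerSharp`). Outside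
the body Gauss's law gives 8πμ = Q² / r⁴, so 2m = 2M - Q² / r with a constant M, which asymptotic
flatness identifies with the ADM mass. Hence θ⁺θ⁻ = (4 / r⁴)(r² - 2Mr + Q²) there, whatever the
slice (`ChargedBody.theta_mul_theta_exterior`). Asymptotic flatness also makes r tend to infinity,
so every value above the radius of a given sphere is attained farther out
(`ChargedBody.exists_radius_eq`).

Part (i) combines two bounds on M. First, m ≥ 0 at the boundary (`ChargedBody.misnerSharp_nonneg`):
where m < 0, r'² exceeds r² K_r², and once r' > 0 the dominant energy condition makes m
non-decreasing; since m vanishes at the origin, it cannot have become negative. The sign of r' comes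
from outside: in an untrapped exterior r' has no zero, and r' < 0 would contradict r → ∞
(`ChargedBody.axD_nonneg`). Thus 2M ≥ Q² / R, with R the radius of the body. Secondly, if 2R ≤ |Q|,
some exterior sphere has r = |Q|, and its being untrapped means M < |Q|. But 2M ≥ Q² / R ≥ 2|Q|, a
contradiction.

Part (ii) is about the roots of r² - 2Mr + Q², whose product is Q². A horizon sits at a root; if
this root were less than |Q|, the other would be larger than |Q|, and the spheres with r between the
two, which occur farther out, would be trapped. If M = |Q|, the only root is |Q|.

All examples come from one family (`ShellParams`). As functions of r one prescribes 2m = c (2M - Q²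
/ r) and the enclosed charge c Q, with c a smooth step from 0 to 1 across the shell, and K_r = k.
The metric follows from r'² = 1 - 2m / r + r² k², the radial eigenvalue of K from the momentum
constraint with j = 0, and μ, ρ are defined by the remaining constraints. Then μ ≥ 0 because m
increases with r, and the slice is regular as long as 1 - 2m / r + r² k² > 0; a non-zero k carries
it through horizons and trapped regions. The examples differ in the roots of r² - 2Mr + Q²: none for
(a), a double root for the extreme data, and the roots 1/2 and 2 for (b) and (c). In (b) the whole
slice stays below the inner root, in (c) it passes beyond the outer one. -/

open scoped ContDiff Matrix Topology

noncomputable section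

/-! ### Partial derivatives of radial expressions -/

/-- The square of the Euclidean norm, as a polynomial in the coordinates. -/
def rsq (x : E3) : ℝ := x 0 ^ 2 + x 1 ^ 2 + x 2 ^ 2

/-- The Kronecker symbol on three indices. -/
abbrev kd (i j : Fin 3) : ℝ := if i = j then 1 else 0

theorem rsq_eq_norm_sq (x : E3) : rsq x = ‖x‖ ^ 2 := by
  rw [EuclideanSpace.norm_sq_eq]
  simp [rsq, Fin.sum_univ_three]

theorem rsq_nonneg (x : E3) : 0 ≤ rsq x := by
  rw [rsq_eq_norm_sq]; positivity

theorem contDiff_coord (i : Fin 3) : ContDiff ℝ ∞ (fun x : E3 => x i) := by fun_prop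

theorem contDiff_rsq : ContDiff ℝ ∞ rsq := by
  unfold rsq; fun_prop

@[fun_prop]
theorem differentiableAt_rsq (x : E3) : DifferentiableAt ℝ rsq x := by
  unfold rsq; fun_prop

theorem continuous_rsq : Continuous rsq := contDiff_rsq.continuous

theorem pd_congr {f g : E3 → ℝ} {x : E3} (k : Fin 3) (h : f =ᶠ[𝓝 x] g) : pd k f x = pd k g x := by
  simp only [pd, h.fderiv_eq]

theorem pd_add {f g : E3 → ℝ} {x : E3} (k : Fin 3) (hf : DifferentiableAt ℝ f x)
    (hg : DifferentiableAt ℝ g x) : pd k (fun y => f y + g y) x = pd k f x + pd k g x := by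
  simp [pd, fderiv_fun_add hf hg]

theorem pd_mul {f g : E3 → ℝ} {x : E3} (k : Fin 3) (hf : DifferentiableAt ℝ f x)
    (hg : DifferentiableAt ℝ g x) :
    pd k (fun y => f y * g y) x = pd k f x * g x + f x * pd k g x := by
  simp [pd, fderiv_fun_mul hf hg]; ring

theorem pd_const (k : Fin 3) (c : ℝ) (x : E3) : pd k (fun _ => c) x = 0 := by
  simp [pd]

theorem pd_coord (k i : Fin 3) (x : E3) : pd k (fun y => y i) x = kd i k := by
  have h : HasFDerivAt (fun y : E3 => y i) (EuclideanSpace.proj i : E3 →L[ℝ] ℝ) x :=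
    (EuclideanSpace.proj i : E3 →L[ℝ] ℝ).hasFDerivAt
  simp [pd, h.fderiv, kd]

theorem pd_rsq (k : Fin 3) (x : E3) : pd k rsq x = 2 * x k := by
  have h : rsq = fun y : E3 => y 0 * y 0 + y 1 * y 1 + y 2 * y 2 := by
    funext y; simp [rsq]; ring
  rw [h, pd_add k (by fun_prop) (by fun_prop), pd_add k (by fun_prop) (by fun_prop),
    pd_mul k (by fun_prop) (by fun_prop), pd_mul k (by fun_prop) (by fun_prop),
    pd_mul k (by fun_prop) (by fun_prop)]
  simp only [pd_coord]
  fin_cases k <;> simp [kd] <;> ring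

theorem differentiableAt_comp_rsq {A : ℝ → ℝ} {x : E3} (hA : DifferentiableAt ℝ A (rsq x)) :
    DifferentiableAt ℝ (fun y => A (rsq y)) x :=
  DifferentiableAt.comp x hA (differentiableAt_rsq x)

theorem pd_comp_rsq {A : ℝ → ℝ} {x : E3} (k : Fin 3) (hA : DifferentiableAt ℝ A (rsq x)) :
    pd k (fun y => A (rsq y)) x = 2 * x k * deriv A (rsq x) := by
  have h := (hA.hasDerivAt.comp_hasFDerivAt x (differentiableAt_rsq x).hasFDerivAt)
  have h2 : fderiv ℝ (fun y => A (rsq y)) x = deriv A (rsq x) • fderiv ℝ rsq x := h.fderiv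
  have h3 := pd_rsq k x
  simp only [pd] at h3 ⊢
  rw [h2]
  simp [h3]; ring

theorem pd_radial_vector {e : ℝ → ℝ} {x : E3} (he : DifferentiableAt ℝ e (rsq x)) (k a : Fin 3) :
    pd k (fun y => e (rsq y) * y a) x = 2 * deriv e (rsq x) * x k * x a + e (rsq x) * kd a k := by
  rw [pd_mul k (differentiableAt_comp_rsq he) (by fun_prop), pd_comp_rsq k he, pd_coord]
  ring

theorem pd_radial_tensor {A B : ℝ → ℝ} {x : E3} (hA : DifferentiableAt ℝ A (rsq x))
    (hB : DifferentiableAt ℝ B (rsq x)) (c : ℝ) (k a b : Fin 3) :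
    pd k (fun y => A (rsq y) * c + B (rsq y) * (y a * y b)) x =
      2 * deriv A (rsq x) * x k * c + 2 * deriv B (rsq x) * x k * (x a * x b)
        + B (rsq x) * (kd a k * x b + kd b k * x a) := by
  have hA' := differentiableAt_comp_rsq hA
  have hB' := differentiableAt_comp_rsq hB
  rw [pd_add k (by fun_prop) (by fun_prop), pd_mul k (by fun_prop) (by fun_prop),
    pd_mul k (by fun_prop) (by fun_prop), pd_mul k (by fun_prop) (by fun_prop),
    pd_comp_rsq k hA, pd_comp_rsq k hB, pd_const, pd_coord, pd_coord]
  ring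

theorem pd_radial_three {p q t : ℝ → ℝ} {x : E3} (hp : DifferentiableAt ℝ p (rsq x))
    (hq : DifferentiableAt ℝ q (rsq x)) (ht : DifferentiableAt ℝ t (rsq x)) (c₁ c₂ c₃ : ℝ)
    (l i j k : Fin 3) :
    pd l (fun y => p (rsq y) * (y j * c₁ + y k * c₂) + q (rsq y) * (c₃ * y i)
        + t (rsq y) * (y i * y j * y k)) x =
      2 * deriv p (rsq x) * x l * (x j * c₁ + x k * c₂) + p (rsq x) * (kd j l * c₁ + kd k l * c₂)
      + 2 * deriv q (rsq x) * x l * (c₃ * x i) + q (rsq x) * (c₃ * kd i l)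
      + 2 * deriv t (rsq x) * x l * (x i * x j * x k)
      + t (rsq x) * (kd i l * x j * x k + x i * kd j l * x k + x i * x j * kd k l) := by
  have hp' := differentiableAt_comp_rsq hp
  have hq' := differentiableAt_comp_rsq hq
  have ht' := differentiableAt_comp_rsq ht
  rw [pd_add l (by fun_prop) (by fun_prop), pd_add l (by fun_prop) (by fun_prop),
    pd_mul l hp' (by fun_prop), pd_mul l hq' (by fun_prop), pd_mul l ht' (by fun_prop),
    pd_add l (by fun_prop) (by fun_prop), pd_mul l (by fun_prop) (by fun_prop),
    pd_mul l (by fun_prop) (by fun_prop), pd_mul l (by fun_prop) (by fun_prop),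
    pd_mul l (by fun_prop) (by fun_prop), pd_mul l (by fun_prop) (by fun_prop),
    pd_comp_rsq l hp, pd_comp_rsq l hq, pd_comp_rsq l ht]
  simp only [pd_const, pd_coord]
  ring

/-! ### Radial metrics -/

/-- On the points with `rsq x ∈ U` the metric is `A δ + B x xᵀ`, with smooth functions `A`, `B` of
`rsq x` and positive eigenvalues `A` and `A + rsq x * B`. -/
structure RadialMetric (h : E3 → Matrix (Fin 3) (Fin 3) ℝ) (U : Set ℝ) (A B : ℝ → ℝ) : Prop where
  isOpen : IsOpen U
  smooth_A : ContDiffOn ℝ ∞ A U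
  smooth_B : ContDiffOn ℝ ∞ B U
  pos_A : ∀ u ∈ U, 0 < A u
  pos_C : ∀ u ∈ U, 0 < A u + u * B u
  eq : ∀ x, rsq x ∈ U → ∀ i j, h x i j = A (rsq x) * kd i j + B (rsq x) * (x i * x j)

/-- The radial eigenvalue of the metric `A δ + B x xᵀ`. -/
def radC (A B : ℝ → ℝ) (u : ℝ) : ℝ := A u + u * B u

/-- Coefficient of `x_j δ_ik + x_k δ_ij` in the Christoffel symbols of `A δ + B x xᵀ`. -/
def chrP (A : ℝ → ℝ) (u : ℝ) : ℝ := deriv A u / A u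

/-- Coefficient of `x_i δ_jk` in the Christoffel symbols of `A δ + B x xᵀ`. -/
def chrQ (A B : ℝ → ℝ) (u : ℝ) : ℝ := (B u - deriv A u) / radC A B u

/-- Coefficient of `x_i x_j x_k` in the Christoffel symbols of `A δ + B x xᵀ`. -/
def chrT (A B : ℝ → ℝ) (u : ℝ) : ℝ :=
  deriv B u / radC A B u - 2 * deriv A u * B u / (A u * radC A B u)

theorem contDiffOn_deriv {f : ℝ → ℝ} {U : Set ℝ} (hU : IsOpen U) (hf : ContDiffOn ℝ ∞ f U) :
    ContDiffOn ℝ ∞ (deriv f) U :=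
  hf.deriv_of_isOpen hU (by simp)

theorem differentiableAt_of_contDiffOn {f : ℝ → ℝ} {U : Set ℝ} (hU : IsOpen U)
    (hf : ContDiffOn ℝ ∞ f U) {u : ℝ} (hu : u ∈ U) : DifferentiableAt ℝ f u :=
  (hf.differentiableOn (by simp)).differentiableAt (hU.mem_nhds hu)

theorem eventually_rsq_mem {U : Set ℝ} (hU : IsOpen U) {x : E3} (hx : rsq x ∈ U) :
    ∀ᶠ y in 𝓝 x, rsq y ∈ U :=
  continuous_rsq.continuousAt.eventually_mem (hU.mem_nhds hx)

namespace RadialMetric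

variable {h : E3 → Matrix (Fin 3) (Fin 3) ℝ} {U : Set ℝ} {A B : ℝ → ℝ}

theorem contDiffOn_radC (H : RadialMetric h U A B) : ContDiffOn ℝ ∞ (radC A B) U :=
  H.smooth_A.add (contDiffOn_id.mul H.smooth_B)

theorem radC_pos (H : RadialMetric h U A B) {u : ℝ} (hu : u ∈ U) : 0 < radC A B u := H.pos_C u hu

theorem contDiffOn_chrP (H : RadialMetric h U A B) : ContDiffOn ℝ ∞ (chrP A) U :=
  (contDiffOn_deriv H.isOpen H.smooth_A).div H.smooth_A fun u hu => (H.pos_A u hu).ne'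

theorem contDiffOn_chrQ (H : RadialMetric h U A B) : ContDiffOn ℝ ∞ (chrQ A B) U :=
  (H.smooth_B.sub (contDiffOn_deriv H.isOpen H.smooth_A)).div H.contDiffOn_radC
    fun _ hu => (H.radC_pos hu).ne'

theorem contDiffOn_chrT (H : RadialMetric h U A B) : ContDiffOn ℝ ∞ (chrT A B) U :=
  ((contDiffOn_deriv H.isOpen H.smooth_B).div H.contDiffOn_radC
    fun _ hu => (H.radC_pos hu).ne').sub
  (((contDiffOn_const.mul (contDiffOn_deriv H.isOpen H.smooth_A)).mul H.smooth_B).div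
    (H.smooth_A.mul H.contDiffOn_radC)
    fun u hu => (mul_pos (H.pos_A u hu) (H.radC_pos hu)).ne')

theorem inv_apply (H : RadialMetric h U A B) {x : E3} (hx : rsq x ∈ U) (i j : Fin 3) :
    (h x)⁻¹ i j = 1 / A (rsq x) * (kd i j - B (rsq x) / radC A B (rsq x) * (x i * x j)) := by
  have hA := (H.pos_A _ hx).ne'
  have hC := (H.radC_pos hx).ne'
  have hCe : radC A B (rsq x) = A (rsq x) + (x 0 ^ 2 + x 1 ^ 2 + x 2 ^ 2) * B (rsq x) := rfl
  have key : (h x) * Matrix.of (fun i j => 1 / A (rsq x) * (kd i j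
      - B (rsq x) / radC A B (rsq x) * (x i * x j))) = 1 := by
    ext a b
    simp only [Matrix.mul_apply, Fin.sum_univ_three, H.eq x hx, Matrix.of_apply]
    generalize A (rsq x) = α at *
    generalize B (rsq x) = β at *
    generalize radC A B (rsq x) = γ at *
    -- With the profile values turned into atoms, each component is a rational identity in them and
    -- the coordinates. The relation C = A + |x|² B is restored only after denominators are cleared.
    fin_cases a <;> fin_cases b <;> simp [kd] <;> field_simp <;> rw [hCe] <;> ring
  rw [Matrix.inv_eq_right_inv key, Matrix.of_apply]

theorem pd_metric (H : RadialMetric h U A B) {x : E3} (hx : rsq x ∈ U) (k a b : Fin 3) :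
    pd k (fun y => h y a b) x =
      2 * deriv A (rsq x) * x k * kd a b + 2 * deriv B (rsq x) * x k * (x a * x b)
        + B (rsq x) * (kd a k * x b + kd b k * x a) := by
  rw [← pd_radial_tensor (differentiableAt_of_contDiffOn H.isOpen H.smooth_A hx)
    (differentiableAt_of_contDiffOn H.isOpen H.smooth_B hx)]
  apply pd_congr
  filter_upwards [eventually_rsq_mem H.isOpen hx] with y hy
  exact H.eq y hy a b

theorem christoffel_eq (H : RadialMetric h U A B) {x : E3} (hx : rsq x ∈ U) (i j k : Fin 3) :
    christoffel h i j k x = chrP A (rsq x) * (x j * kd i k + x k * kd i j)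
      + chrQ A B (rsq x) * (kd j k * x i) + chrT A B (rsq x) * (x i * x j * x k) := by
  have hA := (H.pos_A _ hx).ne'
  have hC := (H.radC_pos hx).ne'
  have hCe : radC A B (rsq x) = A (rsq x) + (x 0 ^ 2 + x 1 ^ 2 + x 2 ^ 2) * B (rsq x) := rfl
  simp only [christoffel, Fin.sum_univ_three, H.inv_apply hx, H.pd_metric hx, chrP, chrQ, chrT]
  generalize A (rsq x) = α at *
  generalize B (rsq x) = β at *
  generalize radC A B (rsq x) = γ at *
  generalize deriv A (rsq x) = α' at *
  generalize deriv B (rsq x) = β' at *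
  fin_cases i <;> fin_cases j <;> fin_cases k <;> simp [kd] <;> field_simp <;> rw [hCe] <;> ring

end RadialMetric

namespace RadialMetric

variable {h : E3 → Matrix (Fin 3) (Fin 3) ℝ} {U : Set ℝ} {A B : ℝ → ℝ}

/-! ### Curvature -/

theorem pd_christoffel (H : RadialMetric h U A B) {x : E3} (hx : rsq x ∈ U) (l i j k : Fin 3) :
    pd l (christoffel h i j k) x =
      2 * deriv (chrP A) (rsq x) * x l * (x j * kd i k + x k * kd i j)
      + chrP A (rsq x) * (kd j l * kd i k + kd k l * kd i j)
      + 2 * deriv (chrQ A B) (rsq x) * x l * (kd j k * x i)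
      + chrQ A B (rsq x) * (kd j k * kd i l)
      + 2 * deriv (chrT A B) (rsq x) * x l * (x i * x j * x k)
      + chrT A B (rsq x) * (kd i l * x j * x k + x i * kd j l * x k + x i * x j * kd k l) := by
  rw [← pd_radial_three (differentiableAt_of_contDiffOn H.isOpen H.contDiffOn_chrP hx)
    (differentiableAt_of_contDiffOn H.isOpen H.contDiffOn_chrQ hx)
    (differentiableAt_of_contDiffOn H.isOpen H.contDiffOn_chrT hx)]
  apply pd_congr
  filter_upwards [eventually_rsq_mem H.isOpen hx] with y hy
  exact H.christoffel_eq hy i j k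

end RadialMetric

/-- Coefficient of `δ_jk` in the Ricci tensor of `A δ + B x xᵀ`. -/
def ricX (A B : ℝ → ℝ) (u : ℝ) : ℝ :=
  -2 * chrP A u + 2 * chrQ A B u + 2 * u * deriv (chrQ A B) u - u * chrT A B u
    + u * chrQ A B u * (2 * chrP A u + chrQ A B u + u * chrT A B u)

/-- Coefficient of `x_j x_k` in the Ricci tensor of `A δ + B x xᵀ`. -/
def ricY (A B : ℝ → ℝ) (u : ℝ) : ℝ :=
  -4 * deriv (chrP A) u - 2 * deriv (chrQ A B) u + 3 * chrT A B u
    + (4 * chrP A u + chrQ A B u + u * chrT A B u) * (2 * chrP A u + u * chrT A B u)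
    - (6 * chrP A u ^ 2 + 2 * chrP A u * chrQ A B u + 4 * u * chrP A u * chrT A B u
      + chrQ A B u ^ 2 + 2 * u * chrQ A B u * chrT A B u + u ^ 2 * chrT A B u ^ 2)

namespace RadialMetric

variable {h : E3 → Matrix (Fin 3) (Fin 3) ℝ} {U : Set ℝ} {A B : ℝ → ℝ}

theorem ricci_eq (H : RadialMetric h U A B) {x : E3} (hx : rsq x ∈ U) (j k : Fin 3) :
    ricci h j k x = ricX A B (rsq x) * kd j k + ricY A B (rsq x) * (x j * x k) := by
  simp only [ricci, Fin.sum_univ_three, H.pd_christoffel hx, H.christoffel_eq hx, ricX, ricY]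
  generalize chrP A (rsq x) = p
  generalize chrQ A B (rsq x) = q
  generalize chrT A B (rsq x) = t
  generalize deriv (chrP A) (rsq x) = p'
  generalize deriv (chrQ A B) (rsq x) = q'
  generalize deriv (chrT A B) (rsq x) = t'
  fin_cases j <;> fin_cases k <;> simp [kd, rsq] <;> ring

/-- The trace of a tensor of the form `X δ + Y x xᵀ` with respect to `A δ + B x xᵀ`. -/
theorem contract (H : RadialMetric h U A B) {x : E3} (hx : rsq x ∈ U) (X Y : ℝ) :
    ∑ j, ∑ k, (h x)⁻¹ j k * (X * kd j k + Y * (x j * x k)) =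
      2 * X / A (rsq x) + (X + rsq x * Y) / radC A B (rsq x) := by
  have hA := (H.pos_A _ hx).ne'
  have hC := (H.radC_pos hx).ne'
  have hCe : radC A B (rsq x) = A (rsq x) + (x 0 ^ 2 + x 1 ^ 2 + x 2 ^ 2) * B (rsq x) := rfl
  simp only [Fin.sum_univ_three, H.inv_apply hx]
  generalize A (rsq x) = α at *
  generalize B (rsq x) = β at *
  generalize radC A B (rsq x) = γ at *
  simp [kd]
  field_simp
  rw [hCe]
  simp only [rsq]
  ring

theorem scalarCurv_eq_ric (H : RadialMetric h U A B) {x : E3} (hx : rsq x ∈ U) :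
    scalarCurv h x = 2 * ricX A B (rsq x) / A (rsq x)
      + (ricX A B (rsq x) + rsq x * ricY A B (rsq x)) / radC A B (rsq x) := by
  simp only [scalarCurv, H.ricci_eq hx]
  exact H.contract hx _ _

theorem hasDerivAt_radC (H : RadialMetric h U A B) {u : ℝ} (hu : u ∈ U) :
    HasDerivAt (radC A B) (deriv A u + B u + u * deriv B u) u := by
  have hA := (differentiableAt_of_contDiffOn H.isOpen H.smooth_A hu).hasDerivAt
  have hB := (differentiableAt_of_contDiffOn H.isOpen H.smooth_B hu).hasDerivAt
  have h1 : HasDerivAt (radC A B) (deriv A u + (1 * B u + u * deriv B u)) u :=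
    hA.add ((hasDerivAt_id u).mul hB)
  convert h1 using 1
  ring

/-- The scalar curvature of `A δ + B x xᵀ`, in terms of `A`, of the derivative `D = A + u A'` of
the squared area radius `u A` and of the radial eigenvalue `C`. -/
theorem scalarCurv_eq (H : RadialMetric h U A B) {x : E3} (hx : rsq x ∈ U) (h0 : rsq x ≠ 0) :
    scalarCurv h x =
      -8 * (2 * deriv A (rsq x) + rsq x * deriv (deriv A) (rsq x))
          / (A (rsq x) * radC A B (rsq x))
      + 4 * (A (rsq x) + rsq x * deriv A (rsq x))
          * (deriv A (rsq x) * radC A B (rsq x) + A (rsq x) * deriv (radC A B) (rsq x))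
          / (A (rsq x) * radC A B (rsq x)) ^ 2
      + 2 / (rsq x * A (rsq x))
      - 2 * (A (rsq x) + rsq x * deriv A (rsq x)) ^ 2
          / (rsq x * A (rsq x) ^ 2 * radC A B (rsq x)) := by
  rw [H.scalarCurv_eq_ric hx]
  generalize rsq x = u at *
  have hA0 := (H.pos_A _ hx).ne'
  have hC0 := (H.radC_pos hx).ne'
  have hA := (differentiableAt_of_contDiffOn H.isOpen H.smooth_A hx).hasDerivAt
  have hB := (differentiableAt_of_contDiffOn H.isOpen H.smooth_B hx).hasDerivAt
  have hA' := (differentiableAt_of_contDiffOn H.isOpen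
    (contDiffOn_deriv H.isOpen H.smooth_A) hx).hasDerivAt
  have hC := H.hasDerivAt_radC hx
  have hP : deriv (chrP A) u = _ := (hA'.div hA hA0).deriv
  have hQ : deriv (chrQ A B) u = _ := ((hB.sub hA').div hC hC0).deriv
  simp only [ricX, ricY, hP, hQ, chrP, chrQ, chrT, hC.deriv]
  have hCe : radC A B u = A u + u * B u := rfl
  generalize radC A B u = γ at *
  -- B is eliminated in favour of the radial eigenvalue C, in which the formula is stated; this is
  -- where u ≠ 0 is needed.
  have hBe : B u = (γ - A u) / u := by rw [hCe]; field_simp; ring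
  simp only [Pi.sub_apply, hBe]
  generalize A u = α at *
  generalize deriv A u = α' at *
  generalize deriv B u = β' at *
  generalize deriv (deriv A) u = α'' at *
  field_simp
  ring

/-! ### The extrinsic curvature and the constraints -/

theorem traceWrt_eq (H : RadialMetric h U A B) {K : E3 → Matrix (Fin 3) (Fin 3) ℝ} {x : E3}
    (hx : rsq x ∈ U) {κ l : ℝ} (hK : ∀ i j, K x i j = κ * kd i j + l * (x i * x j)) :
    traceWrt h K x = 2 * κ / A (rsq x) + (κ + rsq x * l) / radC A B (rsq x) := by
  simp only [traceWrt, hK]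
  exact H.contract hx _ _

theorem tensorNormSq_eq (H : RadialMetric h U A B) {K : E3 → Matrix (Fin 3) (Fin 3) ℝ} {x : E3}
    (hx : rsq x ∈ U) {κ l : ℝ} (hK : ∀ i j, K x i j = κ * kd i j + l * (x i * x j)) :
    tensorNormSq h K x =
      2 * (κ / A (rsq x)) ^ 2 + ((κ + rsq x * l) / radC A B (rsq x)) ^ 2 := by
  have hA := (H.pos_A _ hx).ne'
  have hC := (H.radC_pos hx).ne'
  have hCe : radC A B (rsq x) = A (rsq x) + (x 0 ^ 2 + x 1 ^ 2 + x 2 ^ 2) * B (rsq x) := rfl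
  have key : ∀ i a, (h x)⁻¹ i a = 1 / A (rsq x) * kd i a
      + (-B (rsq x) / (A (rsq x) * radC A B (rsq x))) * (x i * x a) := by
    intro i a
    rw [H.inv_apply hx]
    field_simp
    ring
  have raise : ∀ a b, ∑ i, ∑ j, (h x)⁻¹ i a * (h x)⁻¹ j b * K x i j =
      κ / A (rsq x) ^ 2 * kd a b + (l - κ * B (rsq x) / A (rsq x) - κ * B (rsq x)
        / radC A B (rsq x) - rsq x * B (rsq x) * l / radC A B (rsq x)) /
        (A (rsq x) * radC A B (rsq x)) * (x a * x b) := by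
    intro a b
    simp only [Fin.sum_univ_three, hK, key]
    generalize A (rsq x) = α at *
    generalize B (rsq x) = β at *
    generalize radC A B (rsq x) = γ at *
    fin_cases a <;> fin_cases b <;> simp [kd, rsq] <;> field_simp <;> rw [hCe] <;> ring
  have swap : tensorNormSq h K x =
      ∑ a, ∑ b, (∑ i, ∑ j, (h x)⁻¹ i a * (h x)⁻¹ j b * K x i j) * K x a b := by
    simp only [tensorNormSq, Fin.sum_univ_three]
    ring
  rw [swap]
  simp only [raise]
  simp only [Fin.sum_univ_three, hK]
  generalize A (rsq x) = α at *
  generalize B (rsq x) = β at *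
  generalize radC A B (rsq x) = γ at *
  simp [kd, rsq]
  field_simp
  rw [hCe]
  ring

end RadialMetric

/-- On the points with `rsq x ∈ U` the tensor is `κ δ + λ x xᵀ` with smooth functions of `rsq x`. -/
structure RadialTensor (K : E3 → Matrix (Fin 3) (Fin 3) ℝ) (U : Set ℝ) (κ l : ℝ → ℝ) : Prop where
  smooth_κ : ContDiffOn ℝ ∞ κ U
  smooth_l : ContDiffOn ℝ ∞ l U
  eq : ∀ x, rsq x ∈ U → ∀ i j, K x i j = κ (rsq x) * kd i j + l (rsq x) * (x i * x j)

/-- On the points with `rsq x ∈ U` the vector field is `e x` with a smooth function of `rsq x`. -/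
structure RadialVector (V : E3 → Fin 3 → ℝ) (U : Set ℝ) (e : ℝ → ℝ) : Prop where
  smooth : ContDiffOn ℝ ∞ e U
  eq : ∀ x, rsq x ∈ U → ∀ i, V x i = e (rsq x) * x i

namespace RadialMetric

variable {h K : E3 → Matrix (Fin 3) (Fin 3) ℝ} {V : E3 → Fin 3 → ℝ} {U : Set ℝ}
  {A B κ l e : ℝ → ℝ}

theorem pd_tensor (H : RadialMetric h U A B) (T : RadialTensor K U κ l) {x : E3}
    (hx : rsq x ∈ U) (k a b : Fin 3) :
    pd k (fun y => K y a b) x =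
      2 * deriv κ (rsq x) * x k * kd a b + 2 * deriv l (rsq x) * x k * (x a * x b)
        + l (rsq x) * (kd a k * x b + kd b k * x a) := by
  rw [← pd_radial_tensor (differentiableAt_of_contDiffOn H.isOpen T.smooth_κ hx)
    (differentiableAt_of_contDiffOn H.isOpen T.smooth_l hx)]
  apply pd_congr
  filter_upwards [eventually_rsq_mem H.isOpen hx] with y hy
  exact T.eq y hy a b

theorem covDeriv_eq (H : RadialMetric h U A B) (T : RadialTensor K U κ l) {x : E3}
    (hx : rsq x ∈ U) (b c d : Fin 3) :
    covDeriv h K b c d x =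
      (2 * deriv κ (rsq x) - 2 * chrP A (rsq x) * κ (rsq x)) * (x b * kd c d)
      + (l (rsq x) - chrP A (rsq x) * κ (rsq x)
          - chrQ A B (rsq x) * (κ (rsq x) + rsq x * l (rsq x)))
          * (kd b c * x d + kd b d * x c)
      + (2 * deriv l (rsq x) - 4 * chrP A (rsq x) * l (rsq x)
          - 2 * chrT A B (rsq x) * (κ (rsq x) + rsq x * l (rsq x))) * (x b * x c * x d) := by
  simp only [covDeriv, Fin.sum_univ_three, H.pd_tensor T hx, H.christoffel_eq hx, T.eq x hx]
  generalize chrP A (rsq x) = p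
  generalize chrQ A B (rsq x) = q
  generalize chrT A B (rsq x) = t
  generalize deriv κ (rsq x) = κ'
  generalize deriv l (rsq x) = l'
  generalize κ (rsq x) = κ₀
  generalize l (rsq x) = l₀
  fin_cases b <;> fin_cases c <;> fin_cases d <;> simp [kd, rsq] <;> ring

theorem inv_mul_coord (H : RadialMetric h U A B) {x : E3} (hx : rsq x ∈ U) (a : Fin 3) :
    ∑ c, (h x)⁻¹ a c * x c = x a / radC A B (rsq x) := by
  have hA := (H.pos_A _ hx).ne'
  have hC := (H.radC_pos hx).ne'
  have hCe : radC A B (rsq x) = A (rsq x) + (x 0 ^ 2 + x 1 ^ 2 + x 2 ^ 2) * B (rsq x) := rfl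
  simp only [Fin.sum_univ_three, H.inv_apply hx]
  generalize A (rsq x) = α at *
  generalize B (rsq x) = β at *
  generalize radC A B (rsq x) = γ at *
  fin_cases a <;> simp [kd] <;> field_simp <;> rw [hCe] <;> ring

theorem contract_three (H : RadialMetric h U A B) {x : E3} (hx : rsq x ∈ U) (P S T : ℝ)
    (c : Fin 3) :
    ∑ b, ∑ d, (h x)⁻¹ b d *
        (P * (x b * kd c d) + S * (kd b c * x d + kd b d * x c) + T * (x b * x c * x d)) =
      (2 * S / A (rsq x) + (P + 2 * S + rsq x * T) / radC A B (rsq x)) * x c := by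
  have hA := (H.pos_A _ hx).ne'
  have hC := (H.radC_pos hx).ne'
  have hCe : radC A B (rsq x) = A (rsq x) + (x 0 ^ 2 + x 1 ^ 2 + x 2 ^ 2) * B (rsq x) := rfl
  simp only [Fin.sum_univ_three, H.inv_apply hx]
  have hr : rsq x = x 0 ^ 2 + x 1 ^ 2 + x 2 ^ 2 := rfl
  generalize A (rsq x) = α at *
  generalize B (rsq x) = β at *
  generalize radC A B (rsq x) = γ at *
  rw [hr]
  fin_cases c <;> simp [kd] <;> field_simp <;> rw [hCe] <;> ring

/-- The left-hand side of the momentum constraint for `K = κ δ + l x xᵀ`, in terms of the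
tangential eigenvalue `κ / A` and the radial eigenvalue `(κ + u l) / C` of `K`. -/
theorem momentum_eq (H : RadialMetric h U A B) (T : RadialTensor K U κ l) {x : E3}
    (hx : rsq x ∈ U) (a : Fin 3) :
    (∑ b, ∑ c, ∑ d, (h x)⁻¹ a c * (h x)⁻¹ b d * covDeriv h K b c d x)
      - ∑ c, (h x)⁻¹ a c * pd c (traceWrt h K) x =
    (-4 * deriv (fun u => κ u / A u) (rsq x)
      + 2 * (A (rsq x) + rsq x * deriv A (rsq x)) / (rsq x * A (rsq x))
        * ((κ (rsq x) + rsq x * l (rsq x)) / radC A B (rsq x) - κ (rsq x) / A (rsq x)))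
      * (x a / radC A B (rsq x)) := by
  have hA0 := (H.pos_A _ hx).ne'
  have hC0 := (H.radC_pos hx).ne'
  have hA := (differentiableAt_of_contDiffOn H.isOpen H.smooth_A hx).hasDerivAt
  have hκ := (differentiableAt_of_contDiffOn H.isOpen T.smooth_κ hx).hasDerivAt
  have hl := (differentiableAt_of_contDiffOn H.isOpen T.smooth_l hx).hasDerivAt
  have hC := H.hasDerivAt_radC hx
  have htr : HasDerivAt (fun u => 2 * κ u / A u + (κ u + u * l u) / radC A B u) _ (rsq x) :=
    ((hκ.const_mul 2).div hA hA0).add ((hκ.add ((hasDerivAt_id _).mul hl)).div hC hC0)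
  have hpd : ∀ c, pd c (traceWrt h K) x = _ := fun c => by
    refine Eq.trans (pd_congr c ?_) (pd_comp_rsq c htr.differentiableAt)
    filter_upwards [eventually_rsq_mem H.isOpen hx] with y hy
    exact H.traceWrt_eq hy (T.eq y hy)
  have hk : deriv (fun u => κ u / A u) (rsq x) = _ := (hκ.div hA hA0).deriv
  have swap : (∑ b, ∑ c, ∑ d, (h x)⁻¹ a c * (h x)⁻¹ b d * covDeriv h K b c d x) =
      ∑ c, (h x)⁻¹ a c * ∑ b, ∑ d, (h x)⁻¹ b d * covDeriv h K b c d x := by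
    simp only [Fin.sum_univ_three]
    ring
  rw [swap]
  simp only [H.covDeriv_eq T hx, H.contract_three hx, hpd, htr.deriv, hk]
  rw [← Finset.sum_sub_distrib]
  have pull : ∀ Z₁ Z₂ : ℝ, ∑ c, ((h x)⁻¹ a c * (Z₁ * x c) - (h x)⁻¹ a c * (2 * x c * Z₂)) =
      (Z₁ - 2 * Z₂) * ∑ c, (h x)⁻¹ a c * x c := by
    intro Z₁ Z₂
    rw [Finset.mul_sum]
    exact Finset.sum_congr rfl fun c _ => by ring
  rw [pull, H.inv_mul_coord hx]
  -- At the origin both sides carry the factor x a = 0; elsewhere B can be replaced by (C - A) / u.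
  by_cases h0 : rsq x = 0
  · have : x a = 0 := by
      have h1 : ‖x‖ = 0 := by
        rw [rsq_eq_norm_sq] at h0
        exact pow_eq_zero_iff two_ne_zero |>.1 h0
      rw [norm_eq_zero.1 h1]; rfl
    rw [this]; ring
  congr 1
  simp only [chrP, chrQ, chrT]
  clear htr hpd swap pull hk
  generalize rsq x = u at *
  have hCe : radC A B u = A u + u * B u := rfl
  generalize radC A B u = γ at *
  have hBe : B u = (γ - A u) / u := by rw [hCe]; field_simp; ring
  simp only [Pi.add_apply, Pi.mul_apply, hBe]
  generalize A u = α at *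
  generalize deriv A u = α' at *
  generalize deriv B u = β' at *
  generalize κ u = κ₀ at *
  generalize l u = l₀ at *
  generalize deriv κ u = κ' at *
  generalize deriv l u = l' at *
  field_simp
  ring

theorem divergence_eq (H : RadialMetric h U A B) (W : RadialVector V U e) {x : E3}
    (hx : rsq x ∈ U) :
    divergence h V x = 3 * e (rsq x) + 2 * rsq x * deriv e (rsq x)
      + (2 * deriv A (rsq x) / A (rsq x) + deriv (radC A B) (rsq x) / radC A B (rsq x))
        * (rsq x * e (rsq x)) := by
  have hA := (H.pos_A _ hx).ne'
  have hC := (H.radC_pos hx).ne'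
  have hpd : ∀ k a, pd k (fun y => V y a) x = _ := fun k a => by
    refine Eq.trans (pd_congr k ?_)
      (pd_radial_vector (differentiableAt_of_contDiffOn H.isOpen W.smooth hx) k a)
    filter_upwards [eventually_rsq_mem H.isOpen hx] with y hy
    exact W.eq y hy a
  have hCe : radC A B (rsq x) = A (rsq x) + (x 0 ^ 2 + x 1 ^ 2 + x 2 ^ 2) * B (rsq x) := rfl
  simp only [divergence, Fin.sum_univ_three, hpd, H.christoffel_eq hx, W.eq x hx,
    (H.hasDerivAt_radC hx).deriv, chrP, chrQ, chrT]
  have hr : rsq x = x 0 ^ 2 + x 1 ^ 2 + x 2 ^ 2 := rfl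
  generalize e (rsq x) = e₀ at *
  generalize deriv e (rsq x) = e' at *
  generalize A (rsq x) = α at *
  generalize B (rsq x) = β at *
  generalize radC A B (rsq x) = γ at *
  generalize deriv A (rsq x) = α' at *
  generalize deriv B (rsq x) = β' at *
  rw [hr]
  simp [kd]
  field_simp
  rw [hCe]
  ring

theorem vecNormSq_eq (H : RadialMetric h U A B) {x : E3} (hx : rsq x ∈ U) {c : ℝ}
    (hV : ∀ i, V x i = c * x i) :
    vecNormSq h V x = radC A B (rsq x) * rsq x * c ^ 2 := by
  simp only [vecNormSq, Fin.sum_univ_three, hV, H.eq x hx, radC]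
  generalize A (rsq x) = α at *
  generalize B (rsq x) = β at *
  simp [kd, rsq]
  ring

theorem inv_coord_coord (H : RadialMetric h U A B) {x : E3} (hx : rsq x ∈ U) :
    ∑ a, ∑ b, (h x)⁻¹ a b * x a * x b = rsq x / radC A B (rsq x) := by
  have h1 : ∀ a, ∑ b, (h x)⁻¹ a b * x a * x b = x a * (x a / radC A B (rsq x)) := by
    intro a
    rw [← H.inv_mul_coord hx a, Finset.mul_sum]
    exact Finset.sum_congr rfl fun c _ => by ring
  simp only [h1, Fin.sum_univ_three, rsq]
  ring

theorem det_eq (H : RadialMetric h U A B) {x : E3} (hx : rsq x ∈ U) :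
    (h x).det = A (rsq x) ^ 2 * radC A B (rsq x) := by
  rw [Matrix.det_fin_three]
  simp only [H.eq x hx, radC]
  generalize A (rsq x) = α at *
  generalize B (rsq x) = β at *
  simp [kd, rsq]
  ring

end RadialMetric

/-! ### Unit normal, mean curvature and null expansions of centred spheres. -/

namespace InitialData

variable {D : InitialData} {U : Set ℝ} {A B κ l e : ℝ → ℝ}

theorem outwardNormal_eq (H : RadialMetric D.h U A B) {x : E3} (hx : rsq x ∈ U) (h0 : 0 < rsq x)
    (i : Fin 3) :
    D.outwardNormal x i = (Real.sqrt (rsq x * radC A B (rsq x)))⁻¹ * x i := by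
  have hC := H.radC_pos hx
  rw [outwardNormal, H.inv_mul_coord hx, H.inv_coord_coord hx, Real.sqrt_div h0.le,
    Real.sqrt_mul h0.le]
  have h1 := Real.sqrt_pos.2 h0
  have h2 := Real.sqrt_pos.2 hC
  nth_rewrite 1 [← Real.mul_self_sqrt hC.le]
  field_simp

theorem meanCurv_eq (H : RadialMetric D.h U A B) {x : E3} (hx : rsq x ∈ U) (h0 : 0 < rsq x) :
    D.meanCurv x = 2 * (A (rsq x) + rsq x * deriv A (rsq x))
      / (A (rsq x) * Real.sqrt (rsq x * radC A B (rsq x))) := by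
  -- The unit normal x / √(u C) is smooth only away from the origin, so the domain is cut down
  -- before its divergence is taken.
  have H' : RadialMetric D.h (U ∩ Set.Ioi 0) A B :=
    { isOpen := H.isOpen.inter isOpen_Ioi
      smooth_A := H.smooth_A.mono Set.inter_subset_left
      smooth_B := H.smooth_B.mono Set.inter_subset_left
      pos_A := fun u hu => H.pos_A u hu.1
      pos_C := fun u hu => H.pos_C u hu.1
      eq := fun x hx => H.eq x hx.1 }
  have hpos : ∀ u ∈ U ∩ Set.Ioi (0 : ℝ), 0 < u * radC A B u :=
    fun u hu => mul_pos hu.2 (H.radC_pos hu.1)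
  have W : RadialVector D.outwardNormal (U ∩ Set.Ioi 0)
      (fun u => (Real.sqrt (u * radC A B u))⁻¹) :=
    { smooth := ((contDiffOn_id.mul H'.contDiffOn_radC).sqrt fun u hu => (hpos u hu).ne').inv
        fun u hu => (Real.sqrt_pos.2 (hpos u hu)).ne'
      eq := fun x hx i => outwardNormal_eq H hx.1 hx.2 i }
  have hx' : rsq x ∈ U ∩ Set.Ioi (0 : ℝ) := ⟨hx, h0⟩
  rw [meanCurv, H'.divergence_eq W hx']
  have hA0 := (H.pos_A _ hx).ne'
  have hC0 := (H.radC_pos hx).ne'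
  have hC := H.hasDerivAt_radC hx
  have hs := Real.sqrt_pos.2 (hpos _ hx')
  have hd : deriv (fun u => (Real.sqrt (u * radC A B u))⁻¹) (rsq x) = _ :=
    ((((hasDerivAt_id (rsq x)).mul hC).sqrt (hpos _ hx').ne').inv hs.ne').deriv
  rw [hd, hC.deriv]
  have hss := Real.sq_sqrt (hpos _ hx').le
  generalize rsq x = u at *
  simp only [Pi.mul_apply, id] at *
  generalize Real.sqrt (u * radC A B u) = σ at *
  generalize radC A B u = γ at *
  field_simp
  rw [hss]
  ring

theorem tangentialTrace_eq (H : RadialMetric D.h U A B) {x : E3} (hx : rsq x ∈ U)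
    (h0 : 0 < rsq x) {k l : ℝ} (hK : ∀ i j, D.K x i j = k * kd i j + l * (x i * x j)) :
    D.tangentialTrace x = 2 * (k / A (rsq x)) := by
  have hA := (H.pos_A _ hx).ne'
  have hC := (H.radC_pos hx)
  have hCe : radC A B (rsq x) = A (rsq x) + (x 0 ^ 2 + x 1 ^ 2 + x 2 ^ 2) * B (rsq x) := rfl
  have hn : ∀ i j, D.outwardNormal x i * D.outwardNormal x j =
      (rsq x * radC A B (rsq x))⁻¹ * (x i * x j) := by
    intro i j
    rw [outwardNormal_eq H hx h0, outwardNormal_eq H hx h0]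
    nth_rewrite 3 [← Real.mul_self_sqrt (mul_pos h0 hC).le]
    rw [mul_inv]
    ring
  have split : D.tangentialTrace x =
      traceWrt D.h D.K x - ∑ i, ∑ j, D.outwardNormal x i * D.outwardNormal x j * D.K x i j := by
    simp only [tangentialTrace, traceWrt, Fin.sum_univ_three]
    ring
  rw [split, H.traceWrt_eq hx hK]
  simp only [hn, hK]
  have hr : x 0 ^ 2 + x 1 ^ 2 + x 2 ^ 2 = rsq x := rfl
  have hsum : ∑ i, ∑ j, (rsq x * radC A B (rsq x))⁻¹ * (x i * x j) *
      (k * kd i j + l * (x i * x j)) =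
      (rsq x * radC A B (rsq x))⁻¹ * (k * rsq x + l * rsq x ^ 2) := by
    generalize (rsq x * radC A B (rsq x))⁻¹ = z
    rw [← hr]
    simp [Fin.sum_univ_three, kd]
    ring
  rw [hsum]
  have hC' := hC.ne'
  have h0' := h0.ne'
  field_simp
  ring

/-- The product of the null expansions of the sphere through `x`. -/
theorem theta_mul_theta (H : RadialMetric D.h U A B) {x : E3} (hx : rsq x ∈ U)
    (h0 : 0 < rsq x) {k l : ℝ} (hK : ∀ i j, D.K x i j = k * kd i j + l * (x i * x j)) :
    D.thetaPlus x * D.thetaMinus x =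
      4 / (rsq x * A (rsq x)) * ((A (rsq x) + rsq x * deriv A (rsq x)) ^ 2
        / (A (rsq x) * radC A B (rsq x)) - rsq x * A (rsq x) * (k / A (rsq x)) ^ 2) := by
  have hA := (H.pos_A _ hx).ne'
  have hC := (H.radC_pos hx)
  have hs := Real.sqrt_pos.2 (mul_pos h0 hC)
  have hss := Real.sq_sqrt (mul_pos h0 hC).le
  have hC' := hC.ne'
  have h0' := h0.ne'
  rw [thetaPlus, thetaMinus, meanCurv_eq H hx h0, tangentialTrace_eq H hx h0 hK]
  generalize Real.sqrt (rsq x * radC A B (rsq x)) = σ at *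
  field_simp
  ring_nf
  rw [hss]
  ring_nf

end InitialData

/-! ### Rotation-invariant fields -/

/-- The point at signed distance `t` from the origin on the first coordinate axis. -/
def axisPt (t : ℝ) : E3 := EuclideanSpace.single 0 t

theorem axisPt_zero_apply (t : ℝ) : axisPt t 0 = t := by simp [axisPt]
theorem axisPt_one_apply (t : ℝ) : axisPt t 1 = 0 := by simp [axisPt]
theorem axisPt_two_apply (t : ℝ) : axisPt t 2 = 0 := by simp [axisPt]

theorem rsq_axisPt (t : ℝ) : rsq (axisPt t) = t ^ 2 := by
  simp [rsq, axisPt_zero_apply, axisPt_one_apply, axisPt_two_apply]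

theorem norm_axisPt (t : ℝ) : ‖axisPt t‖ = |t| := by
  simp [axisPt]

theorem axisPt_eq_smul (t : ℝ) : axisPt t = t • (EuclideanSpace.single 0 1 : E3) := by
  ext i; fin_cases i <;> simp [axisPt]

theorem contDiff_axisPt : ContDiff ℝ ∞ axisPt := by
  rw [funext axisPt_eq_smul]
  fun_prop

theorem deriv_comp_axisPt {f : E3 → ℝ} (t : ℝ) (hf : DifferentiableAt ℝ f (axisPt t)) :
    deriv (fun s => f (axisPt s)) t = pd 0 f (axisPt t) := by
  have h1 : HasDerivAt axisPt (EuclideanSpace.single 0 1 : E3) t := by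
    rw [funext axisPt_eq_smul]
    simpa using (hasDerivAt_id t).smul_const (EuclideanSpace.single 0 1 : E3)
  exact (hf.hasFDerivAt.comp_hasDerivAt t h1).deriv

/-- The rotation in the plane of the first basis vector and w is explicit and rational in w, with
denominator 1 + w 0. Only the antipode needs a separate matrix, a half-turn. This yields
transitivity on spheres, so invariant fields are determined by their values on one axis. -/
theorem exists_rotation (w : Fin 3 → ℝ) (hw : w 0 ^ 2 + w 1 ^ 2 + w 2 ^ 2 = 1) :
    ∃ R ∈ Matrix.specialOrthogonalGroup (Fin 3) ℝ, ∀ i, R i 0 = w i := by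
  by_cases h : 1 + w 0 = 0
  · have h0 : w 0 = -1 := by linarith
    have h1 : w 1 = 0 := by rw [h0] at hw; nlinarith [sq_nonneg (w 1), sq_nonneg (w 2)]
    have h2 : w 2 = 0 := by rw [h0] at hw; nlinarith [sq_nonneg (w 1), sq_nonneg (w 2)]
    refine ⟨!![-1, 0, 0; 0, -1, 0; 0, 0, 1], ?_, ?_⟩
    · rw [Matrix.mem_specialOrthogonalGroup_iff, Matrix.mem_orthogonalGroup_iff]
      refine ⟨?_, by simp [Matrix.det_fin_three]⟩
      ext i j
      fin_cases i <;> fin_cases j <;>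
        simp [Matrix.mul_apply, Fin.sum_univ_three]
    · intro i; fin_cases i <;> simp [h0, h1, h2]
  · refine ⟨!![w 0, -w 1, -w 2; w 1, 1 - w 1 ^ 2 / (1 + w 0), -(w 1 * w 2) / (1 + w 0);
      w 2, -(w 1 * w 2) / (1 + w 0), 1 - w 2 ^ 2 / (1 + w 0)], ?_, ?_⟩
    · have h2 : w 2 ^ 2 = 1 - w 0 ^ 2 - w 1 ^ 2 := by linarith
      have h4 : w 2 ^ 4 = (1 - w 0 ^ 2 - w 1 ^ 2) ^ 2 := by rw [← h2]; ring
      have h3 : w 2 ^ 3 = (1 - w 0 ^ 2 - w 1 ^ 2) * w 2 := by rw [← h2]; ring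
      rw [Matrix.mem_specialOrthogonalGroup_iff, Matrix.mem_orthogonalGroup_iff]
      refine ⟨?_, ?_⟩
      · ext i j
        fin_cases i <;> fin_cases j <;>
          simp [Matrix.mul_apply, Fin.sum_univ_three] <;> field_simp <;>
          ring_nf <;> simp only [h2, h3, h4] <;> ring
      · simp [Matrix.det_fin_three]
        field_simp
        ring_nf
        simp only [h2]
        ring
    · intro i; fin_cases i <;> simp

/-- The half-turn about the first axis. -/
theorem halfTurn_mem :
    !![1, 0, 0; 0, -1, 0; 0, 0, -1] ∈ Matrix.specialOrthogonalGroup (Fin 3) ℝ := by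
  rw [Matrix.mem_specialOrthogonalGroup_iff, Matrix.mem_orthogonalGroup_iff]
  refine ⟨?_, by simp [Matrix.det_fin_three]⟩
  ext i j
  fin_cases i <;> fin_cases j <;> simp [Matrix.mul_apply, Fin.sum_univ_three]

/-- The quarter-turn about the first axis. -/
theorem quarterTurn_mem :
    !![1, 0, 0; 0, 0, -1; 0, 1, 0] ∈ Matrix.specialOrthogonalGroup (Fin 3) ℝ := by
  rw [Matrix.mem_specialOrthogonalGroup_iff, Matrix.mem_orthogonalGroup_iff]
  refine ⟨?_, by simp [Matrix.det_fin_three]⟩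
  ext i j
  fin_cases i <;> fin_cases j <;> simp [Matrix.mul_apply, Fin.sum_univ_three]

theorem act_apply (R : Matrix (Fin 3) (Fin 3) ℝ) (x : E3) (i : Fin 3) :
    InitialData.act R x i = R i 0 * x 0 + R i 1 * x 1 + R i 2 * x 2 := by
  simp [InitialData.act, Matrix.mulVec, dotProduct, Fin.sum_univ_three]

theorem act_halfTurn (t : ℝ) :
    InitialData.act !![1, 0, 0; 0, -1, 0; 0, 0, -1] (axisPt t) = axisPt t := by
  ext i
  rw [act_apply]
  fin_cases i <;> simp [axisPt_zero_apply, axisPt_one_apply, axisPt_two_apply]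

theorem act_quarterTurn (t : ℝ) :
    InitialData.act !![1, 0, 0; 0, 0, -1; 0, 1, 0] (axisPt t) = axisPt t := by
  ext i
  rw [act_apply]
  fin_cases i <;> simp [axisPt_zero_apply, axisPt_one_apply, axisPt_two_apply]

theorem exists_rotation_axisPt {x : E3} (hx : x ≠ 0) :
    ∃ R ∈ Matrix.specialOrthogonalGroup (Fin 3) ℝ, InitialData.act R (axisPt ‖x‖) = x ∧
      ∀ i, R i 0 = x i / ‖x‖ := by
  have hn : ‖x‖ ≠ 0 := norm_ne_zero_iff.2 hx
  obtain ⟨R, hR, h⟩ := exists_rotation (fun i => x i / ‖x‖) (by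
    have := rsq_eq_norm_sq x
    unfold rsq at this
    field_simp
    exact this)
  refine ⟨R, hR, ?_, h⟩
  ext i
  rw [act_apply, h, axisPt_zero_apply, axisPt_one_apply, axisPt_two_apply]
  field_simp
  ring

theorem invariant_scalar_eq {f : E3 → ℝ}
    (hf : ∀ R ∈ Matrix.specialOrthogonalGroup (Fin 3) ℝ, ∀ x, f (InitialData.act R x) = f x)
    (x : E3) : f x = f (axisPt ‖x‖) := by
  by_cases hx : x = 0
  · have h0 : axisPt 0 = 0 := by simp [axisPt_eq_smul]
    rw [hx, norm_zero, h0]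
  · obtain ⟨R, hR, h1, -⟩ := exists_rotation_axisPt hx
    have h2 := hf R hR (axisPt ‖x‖)
    rwa [h1] at h2

/-- The half-turn about the axis fixes its points and reverses transversal components, so the field
is radial on the axis; a rotation carries this to every other point. -/
theorem invariant_vector_eq {V : E3 → Fin 3 → ℝ}
    (hV : ∀ R ∈ Matrix.specialOrthogonalGroup (Fin 3) ℝ, ∀ x,
      V (InitialData.act R x) = R *ᵥ V x) {x : E3} (hx : x ≠ 0) (i : Fin 3) :
    V x i = V (axisPt ‖x‖) 0 / ‖x‖ * x i := by
  obtain ⟨R, hR, h1, h2⟩ := exists_rotation_axisPt hx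
  have h := hV _ halfTurn_mem (axisPt ‖x‖)
  rw [act_halfTurn] at h
  have e1 := congrFun h 1
  have e2 := congrFun h 2
  simp [Matrix.mulVec, dotProduct, Fin.sum_univ_three] at e1 e2
  have z1 : V (axisPt ‖x‖) 1 = 0 := by linarith
  have z2 : V (axisPt ‖x‖) 2 = 0 := by linarith
  have h3 := congrFun (hV R hR (axisPt ‖x‖)) i
  rw [h1] at h3
  simp [Matrix.mulVec, dotProduct, Fin.sum_univ_three, z1, z2] at h3
  rw [h3, h2]
  ring

/-- The half-turn about the axis kills the mixed radial-tangential components. The quarter-turn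
equates the two tangential diagonal ones and reverses the sign of the remaining off-diagonal one,
which by symmetry vanishes. -/
theorem invariant_tensor_axisPt {T : E3 → Matrix (Fin 3) (Fin 3) ℝ}
    (hT : ∀ R ∈ Matrix.specialOrthogonalGroup (Fin 3) ℝ, ∀ x,
      T (InitialData.act R x) = R * T x * Rᵀ) (hs : ∀ x, (T x).IsSymm) (t : ℝ) (i j : Fin 3) :
    T (axisPt t) i j = T (axisPt t) 1 1 * kd i j
      + (T (axisPt t) 0 0 - T (axisPt t) 1 1) * (kd i 0 * kd j 0) := by
  have h := hT _ halfTurn_mem (axisPt t)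
  have g := hT _ quarterTurn_mem (axisPt t)
  rw [act_halfTurn] at h
  rw [act_quarterTurn] at g
  have s01 := (hs (axisPt t)).apply 0 1
  have s02 := (hs (axisPt t)).apply 0 2
  have s12 := (hs (axisPt t)).apply 1 2
  have e1 := congrFun (congrFun h 0) 1
  have e2 := congrFun (congrFun h 0) 2
  have e3 := congrFun (congrFun g 1) 1
  have e4 := congrFun (congrFun g 1) 2
  simp [Matrix.mul_apply, Matrix.vecMul, dotProduct, Fin.sum_univ_three] at e1 e2 e3 e4
  fin_cases i <;> fin_cases j <;> simp [kd] <;> linarith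

theorem invariant_tensor_eq {T : E3 → Matrix (Fin 3) (Fin 3) ℝ}
    (hT : ∀ R ∈ Matrix.specialOrthogonalGroup (Fin 3) ℝ, ∀ x,
      T (InitialData.act R x) = R * T x * Rᵀ) (hs : ∀ x, (T x).IsSymm) {x : E3} (hx : x ≠ 0)
    (i j : Fin 3) :
    T x i j = T (axisPt ‖x‖) 1 1 * kd i j
      + (T (axisPt ‖x‖) 0 0 - T (axisPt ‖x‖) 1 1) / ‖x‖ ^ 2 * (x i * x j) := by
  obtain ⟨R, hR, h1, h2⟩ := exists_rotation_axisPt hx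
  have hn : ‖x‖ ≠ 0 := norm_ne_zero_iff.2 hx
  have h3 := congrFun (congrFun (hT R hR (axisPt ‖x‖)) i) j
  rw [h1] at h3
  rw [h3]
  have ho := congrFun (congrFun ((Matrix.mem_orthogonalGroup_iff _ _).1
    (Matrix.mem_specialOrthogonalGroup_iff.1 hR).1) i) j
  simp only [Matrix.mul_apply, Fin.sum_univ_three, Matrix.transpose_apply,
    Matrix.one_apply] at ho
  obtain ⟨a, ha⟩ : ∃ a, a = T (axisPt ‖x‖) 1 1 := ⟨_, rfl⟩
  obtain ⟨b, hb⟩ : ∃ b, b = T (axisPt ‖x‖) 0 0 := ⟨_, rfl⟩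
  have key := invariant_tensor_axisPt hT hs ‖x‖
  rw [← ha, ← hb] at key ⊢
  simp only [Matrix.mul_apply, Fin.sum_univ_three, Matrix.transpose_apply, key]
  -- The Kronecker symbol is replaced by the entry of R Rᵀ, which leaves a polynomial identity in
  -- the entries of R.
  change _ = _ * (if i = j then (1 : ℝ) else 0) + _
  rw [← ho, h2 i, h2 j]
  simp [kd]
  field_simp
  ring

/-- The tangential profile of an invariant tensor field, as a function of the squared radius. -/
def tangProfile (T : E3 → Matrix (Fin 3) (Fin 3) ℝ) (u : ℝ) : ℝ := T (axisPt √u) 1 1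

/-- The coefficient of `x xᵀ` in an invariant tensor field. -/
def radialProfile (T : E3 → Matrix (Fin 3) (Fin 3) ℝ) (u : ℝ) : ℝ :=
  (T (axisPt √u) 0 0 - T (axisPt √u) 1 1) / u

/-- The coefficient of `x` in an invariant vector field. -/
def vectorProfile (V : E3 → Fin 3 → ℝ) (u : ℝ) : ℝ := V (axisPt √u) 0 / √u

theorem contDiffOn_comp_axisPt_sqrt {f : E3 → ℝ} (hf : ContDiff ℝ ∞ f) :
    ContDiffOn ℝ ∞ (fun u => f (axisPt √u)) (Set.Ioi 0) :=
  (hf.comp contDiff_axisPt).comp_contDiffOn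
    (contDiffOn_id.sqrt fun _ hu => ne_of_gt hu)

theorem rsq_pos_iff {x : E3} : 0 < rsq x ↔ x ≠ 0 := by
  rw [rsq_eq_norm_sq]
  constructor
  · rintro h rfl; simp at h
  · intro h; have := norm_pos_iff.2 h; positivity

theorem sqrt_rsq (x : E3) : √(rsq x) = ‖x‖ := by
  rw [rsq_eq_norm_sq, Real.sqrt_sq (norm_nonneg x)]

/-- The profiles are obtained only for u > 0, since they involve √u and a division by u. What is
needed at the origin is later supplied by continuity along the axis, where the fields are smooth in
t. -/
theorem radialTensor_of_invariant {T : E3 → Matrix (Fin 3) (Fin 3) ℝ}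
    (hc : ∀ a b, ContDiff ℝ ∞ (fun x => T x a b))
    (hT : ∀ R ∈ Matrix.specialOrthogonalGroup (Fin 3) ℝ, ∀ x,
      T (InitialData.act R x) = R * T x * Rᵀ) (hs : ∀ x, (T x).IsSymm) :
    RadialTensor T (Set.Ioi 0) (tangProfile T) (radialProfile T) where
  smooth_κ := contDiffOn_comp_axisPt_sqrt (hc 1 1)
  smooth_l := ((contDiffOn_comp_axisPt_sqrt (hc 0 0)).sub
    (contDiffOn_comp_axisPt_sqrt (hc 1 1))).div contDiffOn_id fun _ hu => ne_of_gt hu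
  eq := fun x hx i j => by
    rw [tangProfile, radialProfile, sqrt_rsq, rsq_eq_norm_sq]
    exact invariant_tensor_eq hT hs (rsq_pos_iff.1 hx) i j

theorem radialVector_of_invariant {V : E3 → Fin 3 → ℝ}
    (hc : ∀ a, ContDiff ℝ ∞ (fun x => V x a))
    (hV : ∀ R ∈ Matrix.specialOrthogonalGroup (Fin 3) ℝ, ∀ x,
      V (InitialData.act R x) = R *ᵥ V x) :
    RadialVector V (Set.Ioi 0) (vectorProfile V) where
  smooth := (contDiffOn_comp_axisPt_sqrt (hc 0)).div
    (contDiffOn_id.sqrt fun _ hu => ne_of_gt hu) fun _ hu => (Real.sqrt_pos.2 hu).ne'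
  eq := fun x hx i => by
    rw [vectorProfile, sqrt_rsq]
    exact invariant_vector_eq hV (rsq_pos_iff.1 hx) i

namespace InitialData

variable {D : InitialData}

theorem isSymm_h (D : InitialData) (x : E3) : (D.h x).IsSymm := by
  ext i j
  simpa using (D.posDef_h x).isHermitian.apply i j

theorem h_diag_pos (D : InitialData) (x : E3) (i : Fin 3) : 0 < D.h x i i :=
  (D.posDef_h x).diag_pos

theorem SphericallySymmetric.radialMetric (S : D.SphericallySymmetric) :
    RadialMetric D.h (Set.Ioi 0) (tangProfile D.h) (radialProfile D.h) :=
  have T := radialTensor_of_invariant D.smooth_h S.h_inv D.isSymm_h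
  { isOpen := isOpen_Ioi
    smooth_A := T.smooth_κ
    smooth_B := T.smooth_l
    pos_A := fun u _ => D.h_diag_pos _ 1
    pos_C := fun u hu => by
      have h0 : u ≠ 0 := ne_of_gt hu
      have h1 := D.h_diag_pos (axisPt √u) 0
      simp only [tangProfile, radialProfile]
      field_simp
      linarith
    eq := T.eq }

theorem SphericallySymmetric.radialTensor (S : D.SphericallySymmetric) :
    RadialTensor D.K (Set.Ioi 0) (tangProfile D.K) (radialProfile D.K) :=
  radialTensor_of_invariant D.smooth_K S.K_inv D.symm_K

theorem SphericallySymmetric.radialVector_E (S : D.SphericallySymmetric) :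
    RadialVector D.E (Set.Ioi 0) (vectorProfile D.E) :=
  radialVector_of_invariant D.smooth_E S.E_inv

theorem SphericallySymmetric.radialVector_B (S : D.SphericallySymmetric) :
    RadialVector D.B (Set.Ioi 0) (vectorProfile D.B) :=
  radialVector_of_invariant D.smooth_B S.B_inv

theorem SphericallySymmetric.radialVector_j (S : D.SphericallySymmetric) :
    RadialVector D.j (Set.Ioi 0) (vectorProfile D.j) :=
  radialVector_of_invariant D.smooth_j S.j_inv

end InitialData

theorem hasDerivAt_comp_sq {f : ℝ → ℝ} {f' t : ℝ} (hf : HasDerivAt f f' (t ^ 2)) :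
    HasDerivAt (fun s => f (s ^ 2)) (f' * (2 * t)) t := by
  have h : HasDerivAt (fun s : ℝ => s ^ 2) (2 * t) t := by simpa using hasDerivAt_pow 2 t
  exact HasDerivAt.comp (h₂ := f) (h := fun s => s ^ 2) t hf h

namespace InitialData

/-! ### Reduction to functions of the distance along an axis -/

/-- The tangential metric coefficient along the axis. -/
def axA (D : InitialData) (t : ℝ) : ℝ := D.h (axisPt t) 1 1

/-- The radial metric coefficient along the axis. -/
def axC (D : InitialData) (t : ℝ) : ℝ := D.h (axisPt t) 0 0

/-- The tangential component of `K` along the axis. -/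
def axK (D : InitialData) (t : ℝ) : ℝ := D.K (axisPt t) 1 1

/-- `(2 t)⁻¹` times the derivative of the squared area radius `t ^ 2 * axA`. -/
def axD (D : InitialData) (t : ℝ) : ℝ := D.axA t + t / 2 * deriv D.axA t

/-- Twice the Misner-Sharp mass of the sphere of coordinate radius `t`. -/
def misnerSharp (D : InitialData) (t : ℝ) : ℝ :=
  t * √(D.axA t) * (1 - D.axD t ^ 2 / (D.axA t * D.axC t) + t ^ 2 * D.axK t ^ 2 / D.axA t)

/-- The flux, divided by `4π`, of a rotation-invariant vector field. -/
def flux (D : InitialData) (V : E3 → Fin 3 → ℝ) (t : ℝ) : ℝ :=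
  t ^ 2 * D.axA t * √(D.axC t) * V (axisPt t) 0

variable {D : InitialData}

theorem axA_pos (D : InitialData) (t : ℝ) : 0 < D.axA t := D.h_diag_pos _ 1

theorem axC_pos (D : InitialData) (t : ℝ) : 0 < D.axC t := D.h_diag_pos _ 0

theorem contDiff_axA (D : InitialData) : ContDiff ℝ ∞ D.axA :=
  (D.smooth_h 1 1).comp contDiff_axisPt

theorem contDiff_axC (D : InitialData) : ContDiff ℝ ∞ D.axC :=
  (D.smooth_h 0 0).comp contDiff_axisPt

theorem contDiff_axK (D : InitialData) : ContDiff ℝ ∞ D.axK :=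
  (D.smooth_K 1 1).comp contDiff_axisPt

theorem continuous_deriv_axA (D : InitialData) : Continuous (deriv D.axA) :=
  D.contDiff_axA.continuous_deriv (by simp)

theorem continuous_axD (D : InitialData) : Continuous D.axD :=
  D.contDiff_axA.continuous.add
    ((continuous_id.div_const 2).mul D.continuous_deriv_axA)

theorem continuous_misnerSharp (D : InitialData) : Continuous D.misnerSharp := by
  have h1 := D.contDiff_axA.continuous
  have h2 := D.contDiff_axC.continuous
  have h3 := D.contDiff_axK.continuous
  have h4 := D.continuous_axD
  refine (continuous_id.mul h1.sqrt).mul ((continuous_const.sub ((h4.pow 2).div (h1.mul h2) ?_)).add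
    (((continuous_id.pow 2).mul (h3.pow 2)).div h1 ?_))
  · exact fun t => (mul_pos (D.axA_pos t) (D.axC_pos t)).ne'
  · exact fun t => (D.axA_pos t).ne'

theorem continuous_flux (D : InitialData) {V : E3 → Fin 3 → ℝ}
    (hV : ∀ a, ContDiff ℝ ∞ (fun x => V x a)) : Continuous (D.flux V) := by
  have h1 := D.contDiff_axA.continuous
  have h2 := D.contDiff_axC.continuous
  have h3 : Continuous fun t => V (axisPt t) 0 := ((hV 0).comp contDiff_axisPt).continuous
  exact (((continuous_id.pow 2).mul h1).mul h2.sqrt).mul h3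

theorem tangProfile_sq (T : E3 → Matrix (Fin 3) (Fin 3) ℝ) {t : ℝ} (ht : 0 < t) :
    tangProfile T (t ^ 2) = T (axisPt t) 1 1 := by
  rw [tangProfile, Real.sqrt_sq ht.le]

theorem radC_sq (D : InitialData) {t : ℝ} (ht : 0 < t) :
    radC (tangProfile D.h) (radialProfile D.h) (t ^ 2) = D.axC t := by
  rw [radC, tangProfile, radialProfile, Real.sqrt_sq ht.le, axC]
  field_simp
  ring

theorem vectorProfile_sq (V : E3 → Fin 3 → ℝ) {t : ℝ} (ht : 0 < t) :
    vectorProfile V (t ^ 2) = V (axisPt t) 0 / t := by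
  rw [vectorProfile, Real.sqrt_sq ht.le]

theorem SphericallySymmetric.deriv_axA (S : D.SphericallySymmetric) {t : ℝ} (ht : 0 < t) :
    deriv D.axA t = 2 * t * deriv (tangProfile D.h) (t ^ 2) := by
  have H := S.radialMetric
  have h1 := (differentiableAt_of_contDiffOn H.isOpen H.smooth_A
    (show t ^ 2 ∈ Set.Ioi (0 : ℝ) from pow_pos ht 2)).hasDerivAt
  have h2 : HasDerivAt (fun s => tangProfile D.h (s ^ 2)) _ t := hasDerivAt_comp_sq h1
  have h3 : D.axA =ᶠ[𝓝 t] fun s => tangProfile D.h (s ^ 2) := by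
    filter_upwards [lt_mem_nhds ht] with s hs
    exact (tangProfile_sq D.h hs).symm
  rw [h3.deriv_eq, h2.deriv]
  ring

theorem SphericallySymmetric.axD_eq (S : D.SphericallySymmetric) {t : ℝ} (ht : 0 < t) :
    D.axD t = tangProfile D.h (t ^ 2) + t ^ 2 * deriv (tangProfile D.h) (t ^ 2) := by
  rw [axD, S.deriv_axA ht, tangProfile_sq D.h ht, axA]
  ring

theorem SphericallySymmetric.theta_mul_theta_eq (S : D.SphericallySymmetric) {x : E3}
    (hx : 0 < ‖x‖) :
    D.thetaPlus x * D.thetaMinus x = 4 / (‖x‖ ^ 2 * D.axA ‖x‖)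
      * (D.axD ‖x‖ ^ 2 / (D.axA ‖x‖ * D.axC ‖x‖) - ‖x‖ ^ 2 * D.axK ‖x‖ ^ 2 / D.axA ‖x‖) := by
  have h0 : 0 < rsq x := by rw [rsq_eq_norm_sq]; positivity
  have hA := (D.axA_pos ‖x‖).ne'
  rw [theta_mul_theta S.radialMetric h0 h0 (S.radialTensor.eq x h0), rsq_eq_norm_sq,
    ← S.axD_eq hx, radC_sq D hx, tangProfile_sq _ hx, tangProfile_sq _ hx]
  simp only [axA, axK] at *
  field_simp

/-- The divergence theorem on a thin spherical shell, in infinitesimal form: A √C is the density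
√(det h) on the axis. -/
theorem SphericallySymmetric.hasDerivAt_flux (S : D.SphericallySymmetric)
    {V : E3 → Fin 3 → ℝ} (W : RadialVector V (Set.Ioi 0) (vectorProfile V)) {t : ℝ} (ht : 0 < t) :
    HasDerivAt (D.flux V) (t ^ 2 * (D.axA t * √(D.axC t)) * divergence D.h V (axisPt t)) t := by
  have H := S.radialMetric
  have hu : t ^ 2 ∈ Set.Ioi (0 : ℝ) := pow_pos ht 2
  have hx : rsq (axisPt t) ∈ Set.Ioi (0 : ℝ) := by rw [rsq_axisPt]; exact hu
  have hA := (differentiableAt_of_contDiffOn H.isOpen H.smooth_A hu).hasDerivAt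
  have hC := (differentiableAt_of_contDiffOn H.isOpen H.contDiffOn_radC hu).hasDerivAt
  have he := (differentiableAt_of_contDiffOn H.isOpen W.smooth hu).hasDerivAt
  have hC0 := H.radC_pos hu
  have hA0 := (H.pos_A _ hu).ne'
  have key : HasDerivAt (fun s => s ^ 3 * tangProfile D.h (s ^ 2)
      * √(radC (tangProfile D.h) (radialProfile D.h) (s ^ 2)) * vectorProfile V (s ^ 2)) _ t :=
    (((hasDerivAt_pow 3 t).mul (hasDerivAt_comp_sq hA)).mul ((hasDerivAt_comp_sq hC).sqrt hC0.ne')).mul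
      (hasDerivAt_comp_sq he)
  have heq : D.flux V =ᶠ[𝓝 t] fun s => s ^ 3 * tangProfile D.h (s ^ 2)
      * √(radC (tangProfile D.h) (radialProfile D.h) (s ^ 2)) * vectorProfile V (s ^ 2) := by
    filter_upwards [lt_mem_nhds ht] with s hs
    rw [tangProfile_sq _ hs, radC_sq D hs, vectorProfile_sq V hs, flux, axA]
    field_simp
  refine (key.congr_of_eventuallyEq heq).congr_deriv ?_
  rw [H.divergence_eq W hx, rsq_axisPt]
  have e1 := tangProfile_sq D.h ht
  have e2 := radC_sq D ht
  simp only [axA, Pi.mul_apply]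
  rw [← e1, ← e2]
  have hs := Real.sqrt_pos.2 hC0
  have hss := Real.sq_sqrt hC0.le
  generalize tangProfile D.h (t ^ 2) = α at *
  generalize √(radC (tangProfile D.h) (radialProfile D.h) (t ^ 2)) = σ at *
  rw [← hss]
  field_simp
  norm_num
  ring

/-- The Hamiltonian constraint weighted by the derivative of the area radius, plus the momentum
constraint weighted by r K_r, is a total derivative; second derivatives of the metric and the radial
eigenvalue of K drop out of the combination. -/
theorem SphericallySymmetric.hasDerivAt_misnerSharp (S : D.SphericallySymmetric) {t : ℝ}
    (ht : 0 < t) :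
    HasDerivAt D.misnerSharp (8 * Real.pi * t * (t * √(D.axA t))
      * (D.μ (axisPt t) * D.axD t + t * D.axC t * D.j (axisPt t) 0 * D.axK t)) t := by
  have H := S.radialMetric
  have T := S.radialTensor
  have hu : t ^ 2 ∈ Set.Ioi (0 : ℝ) := pow_pos ht 2
  have hx : rsq (axisPt t) ∈ Set.Ioi (0 : ℝ) := by rw [rsq_axisPt]; exact hu
  have hA := (differentiableAt_of_contDiffOn H.isOpen H.smooth_A hu).hasDerivAt
  have hA' := (differentiableAt_of_contDiffOn H.isOpen
    (contDiffOn_deriv H.isOpen H.smooth_A) hu).hasDerivAt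
  have hC := (differentiableAt_of_contDiffOn H.isOpen H.contDiffOn_radC hu).hasDerivAt
  have hκ := (differentiableAt_of_contDiffOn H.isOpen T.smooth_κ hu).hasDerivAt
  have hC0 := H.radC_pos hu
  have hA0 := H.pos_A _ hu
  have hf : HasDerivAt (fun u => 1 - (tangProfile D.h u + u * deriv (tangProfile D.h) u) ^ 2
      / (tangProfile D.h u * radC (tangProfile D.h) (radialProfile D.h) u)
      + u * tangProfile D.K u ^ 2 / tangProfile D.h u) _ (t ^ 2) :=
    ((((hA.add ((hasDerivAt_id _).mul hA')).pow 2).div (hA.mul hC)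
      (mul_pos hA0 hC0).ne').const_sub 1).add
      (((hasDerivAt_id _).mul (hκ.pow 2)).div hA hA0.ne')
  have key : HasDerivAt (fun s => s * √(tangProfile D.h (s ^ 2))
      * (1 - (tangProfile D.h (s ^ 2) + s ^ 2 * deriv (tangProfile D.h) (s ^ 2)) ^ 2
      / (tangProfile D.h (s ^ 2) * radC (tangProfile D.h) (radialProfile D.h) (s ^ 2))
      + s ^ 2 * tangProfile D.K (s ^ 2) ^ 2 / tangProfile D.h (s ^ 2))) _ t :=
    ((hasDerivAt_id t).mul ((hasDerivAt_comp_sq hA).sqrt hA0.ne')).mul (hasDerivAt_comp_sq hf)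
  have heq : D.misnerSharp =ᶠ[𝓝 t] fun s => s * √(tangProfile D.h (s ^ 2))
      * (1 - (tangProfile D.h (s ^ 2) + s ^ 2 * deriv (tangProfile D.h) (s ^ 2)) ^ 2
      / (tangProfile D.h (s ^ 2) * radC (tangProfile D.h) (radialProfile D.h) (s ^ 2))
      + s ^ 2 * tangProfile D.K (s ^ 2) ^ 2 / tangProfile D.h (s ^ 2)) := by
    filter_upwards [lt_mem_nhds ht] with s hs
    rw [← S.axD_eq hs, tangProfile_sq _ hs, radC_sq D hs, tangProfile_sq _ hs, misnerSharp, axA,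
      axK]
  refine (key.congr_of_eventuallyEq heq).congr_deriv ?_
  have ham := D.hamiltonian (axisPt t)
  have mom := D.momentum (axisPt t) 0
  have hk : deriv (fun u => tangProfile D.K u / tangProfile D.h u) (t ^ 2) = _ :=
    (hκ.div hA hA0.ne').deriv
  rw [H.scalarCurv_eq hx hx.ne', H.tensorNormSq_eq hx (T.eq _ hx), H.traceWrt_eq hx (T.eq _ hx)]
    at ham
  rw [H.momentum_eq T hx, axisPt_zero_apply] at mom
  rw [rsq_axisPt] at ham mom
  rw [hk] at mom
  -- The constraints are solved for μ and j and substituted, which turns the claim into a rational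
  -- identity in the profiles and their derivatives.
  have hμ := (eq_div_iff (show 16 * Real.pi ≠ 0 by positivity)).2
    ((mul_comm _ _).trans ham.symm)
  have hj := (eq_div_iff (show -8 * Real.pi ≠ 0 by simp [Real.pi_ne_zero])).2
    ((mul_comm _ _).trans mom.symm)
  rw [hμ, hj, S.axD_eq ht, ← radC_sq D ht]
  have e1 : D.axA t = tangProfile D.h (t ^ 2) := (tangProfile_sq D.h ht).symm
  have e3 : D.axK t = tangProfile D.K (t ^ 2) := (tangProfile_sq D.K ht).symm
  rw [e1, e3]
  have hs := Real.sqrt_pos.2 hA0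
  have hss := Real.sq_sqrt hA0.le
  clear heq ham mom hμ hj e1 e3 key hf hk
  simp only [id, Pi.add_apply, Pi.mul_apply, Pi.pow_apply]
  have hpi := Real.pi_ne_zero
  generalize √(tangProfile D.h (t ^ 2)) = σ at *
  generalize deriv (tangProfile D.h) (t ^ 2) = α' at *
  generalize deriv (deriv (tangProfile D.h)) (t ^ 2) = α'' at *
  generalize tangProfile D.h (t ^ 2) = α at *
  generalize deriv (radC (tangProfile D.h) (radialProfile D.h)) (t ^ 2) = γ' at *
  generalize radC (tangProfile D.h) (radialProfile D.h) (t ^ 2) = γ at *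
  generalize deriv (tangProfile D.K) (t ^ 2) = κ' at *
  generalize tangProfile D.K (t ^ 2) = κ at *
  generalize radialProfile D.K (t ^ 2) = l at *
  subst hss
  field_simp
  norm_num
  ring

end InitialData

/-! ### Integrals over spheres and balls: area radius, charge, mass flux. -/

theorem volume_real_unitBall :
    (MeasureTheory.volume : MeasureTheory.Measure E3).real (Metric.ball 0 1) =
      4 * Real.pi / 3 := by
  rw [MeasureTheory.Measure.real, EuclideanSpace.volume_ball_fin_three, ENNReal.ofReal_one, one_pow,
    one_mul, ENNReal.toReal_ofReal (by positivity)]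
  ring

open MeasureTheory in
theorem integral_toSphere_const (c : ℝ) :
    ∫ _w : Metric.sphere (0 : E3) 1, c ∂(volume : Measure E3).toSphere = 4 * Real.pi * c := by
  have h : (volume : Measure E3).toSphere.real Set.univ = 4 * Real.pi := by
    rw [Measure.toSphere_real_apply_univ, volume_real_unitBall]
    simp
    ring
  rw [integral_const, h, smul_eq_mul]

namespace InitialData

variable {D : InitialData}

theorem rsq_smul_sphere (s : ℝ) (w : Metric.sphere (0 : E3) 1) : rsq (s • (w : E3)) = s ^ 2 := by
  rw [rsq_eq_norm_sq, norm_smul]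
  simp

theorem SphericallySymmetric.sphereArea_eq (S : D.SphericallySymmetric) {s : ℝ} (hs : 0 < s) :
    D.sphereArea s = 4 * Real.pi * (s ^ 2 * D.axA s) := by
  have H := S.radialMetric
  rw [sphereArea, ← integral_toSphere_const]
  congr 1
  funext w
  have hx := rsq_smul_sphere s w
  have hu : rsq (s • (w : E3)) ∈ Set.Ioi (0 : ℝ) := by rw [hx]; exact pow_pos hs 2
  have h1 := H.inv_coord_coord hu
  have h2 : ∑ a, ∑ b, (D.h (s • (w : E3)))⁻¹ a b * (w : E3) a * (w : E3) b =
      1 / radC (tangProfile D.h) (radialProfile D.h) (s ^ 2) := by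
    have h3 : ∑ a, ∑ b, (D.h (s • (w : E3)))⁻¹ a b * (s • (w : E3)) a * (s • (w : E3)) b =
        s ^ 2 * ∑ a, ∑ b, (D.h (s • (w : E3)))⁻¹ a b * (w : E3) a * (w : E3) b := by
      simp only [Fin.sum_univ_three, PiLp.smul_apply, smul_eq_mul]
      ring
    rw [h3, hx] at h1
    have : s ^ 2 ≠ 0 := by positivity
    field_simp at h1 ⊢
    linarith
  rw [h2, H.det_eq hu, hx, radC_sq D hs, tangProfile_sq _ hs]
  have hC := D.axC_pos s
  have h4 : D.h (axisPt s) 1 1 ^ 2 * D.axC s * (1 / D.axC s) = D.axA s ^ 2 := by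
    rw [axA]; field_simp
  rw [h4, Real.sqrt_sq (D.axA_pos s).le]

theorem SphericallySymmetric.areaRadius_eq (S : D.SphericallySymmetric) {s : ℝ} (hs : 0 < s) :
    D.areaRadius s = s * √(D.axA s) := by
  rw [areaRadius, S.sphereArea_eq hs, mul_div_cancel_left₀ _ (by positivity),
    Real.sqrt_mul (by positivity), Real.sqrt_sq hs.le]

theorem SphericallySymmetric.axis_sqrt_det (S : D.SphericallySymmetric) {t : ℝ} (ht : 0 < t) :
    √(D.h (axisPt t)).det = D.axA t * √(D.axC t) := by
  have hu : rsq (axisPt t) ∈ Set.Ioi (0 : ℝ) := by rw [rsq_axisPt]; exact pow_pos ht 2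
  rw [S.radialMetric.det_eq hu, rsq_axisPt, radC_sq D ht, tangProfile_sq _ ht,
    Real.sqrt_mul (by positivity), Real.sqrt_sq (D.h_diag_pos _ 1).le, axA]

open MeasureTheory in
/-- Gauss's law: the charge of a centred ball is the flux of `E` through its boundary. -/
theorem SphericallySymmetric.charge_eq_flux (S : D.SphericallySymmetric) {s : ℝ} (hs : 0 ≤ s) :
    D.charge s = D.flux D.E s := by
  set G : ℝ → ℝ := fun y => D.ρ (axisPt y) * √(D.h (axisPt y)).det with hG
  have hdet : ∀ x, D.ρ x * √(D.h x).det = G ‖x‖ := by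
    intro x
    have h1 : (D.h x).det = (D.h (axisPt ‖x‖)).det :=
      invariant_scalar_eq (f := fun x => (D.h x).det) (fun R hR y => by
        rw [S.h_inv R hR y, Matrix.det_mul, Matrix.det_mul, Matrix.det_transpose,
          (Matrix.mem_specialOrthogonalGroup_iff.1 hR).2]
        ring) x
    rw [hG, invariant_scalar_eq S.ρ_inv x, h1]
  have hGc : Continuous G := by
    have h1 : Continuous fun x => (D.h x).det := by
      apply Continuous.matrix_det
      exact continuous_pi fun i => continuous_pi fun j => (D.smooth_h i j).continuous
    exact (D.smooth_ρ.continuous.mul h1.sqrt).comp contDiff_axisPt.continuous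
  have h1 : D.charge s = ∫ x : E3, (Set.Iic s).indicator G ‖x‖ := by
    rw [charge, ← integral_indicator Metric.isClosed_closedBall.measurableSet]
    congr 1
    funext x
    by_cases hx : ‖x‖ ≤ s <;> simp [Set.indicator, hx, hdet]
  have hder : ∀ y ∈ Set.Ioo 0 s, HasDerivAt (D.flux D.E) (4 * Real.pi * (y ^ 2 * G y)) y := by
    intro y hy
    refine (S.hasDerivAt_flux S.radialVector_E hy.1).congr_deriv ?_
    rw [D.gauss_E, hG, ← S.axis_sqrt_det hy.1]
    ring
  have hcont : Continuous fun y => 4 * Real.pi * (y ^ 2 * G y) := by fun_prop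
  have h2 := intervalIntegral.integral_eq_sub_of_hasDerivAt_of_le hs
    (D.continuous_flux D.smooth_E).continuousOn hder (hcont.intervalIntegrable 0 s)
  have h0 : D.flux D.E 0 = 0 := by simp [flux]
  rw [h0, sub_zero, intervalIntegral.integral_const_mul] at h2
  -- Polar coordinates: the integral of a function of the norm is 3 vol(unit ball) = 4π times its
  -- radial integral with weight y ^ 2.
  rw [h1, integral_fun_norm_addHaar, ← h2]
  have h3 : ∫ y in Set.Ioi (0 : ℝ), y ^ (Module.finrank ℝ E3 - 1) • (Set.Iic s).indicator G y =
      ∫ y in (0 : ℝ)..s, y ^ 2 * G y := by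
    rw [intervalIntegral.integral_of_le hs, ← Set.Ioi_inter_Iic,
      ← setIntegral_indicator measurableSet_Iic]
    congr 1
    funext y
    by_cases hy : y ≤ s <;> simp [Set.indicator, hy]
  rw [h3, volume_real_unitBall]
  simp
  ring

/-- By symmetry the mass integrand is constant on the sphere, so its integral is 4π times one value,
expressed through the axis profiles. -/
theorem SphericallySymmetric.massFlux_eq (S : D.SphericallySymmetric) {s : ℝ} (hs : 0 < s) :
    1 / (16 * Real.pi) * ∫ w : Metric.sphere (0 : E3) 1,
      s ^ 2 * ∑ a, ∑ b, (pd b (fun y => D.h y a b) (s • (w : E3))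
        - pd a (fun y => D.h y b b) (s • (w : E3))) * (w : E3) a
      ∂(MeasureTheory.volume : MeasureTheory.Measure E3).toSphere =
    s / 2 * (D.axC s - D.axA s - s * deriv D.axA s) := by
  have H := S.radialMetric
  have key : ∀ w : Metric.sphere (0 : E3) 1,
      s ^ 2 * ∑ a, ∑ b, (pd b (fun y => D.h y a b) (s • (w : E3))
        - pd a (fun y => D.h y b b) (s • (w : E3))) * (w : E3) a =
      2 * s * (D.axC s - D.axA s - s * deriv D.axA s) := by
    intro w
    have hx := rsq_smul_sphere s w
    have hu : rsq (s • (w : E3)) ∈ Set.Ioi (0 : ℝ) := by rw [hx]; exact pow_pos hs 2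
    have h1 : ∑ a, ∑ b, (pd b (fun y => D.h y a b) (s • (w : E3))
        - pd a (fun y => D.h y b b) (s • (w : E3))) * (s • (w : E3)) a =
        s * ∑ a, ∑ b, (pd b (fun y => D.h y a b) (s • (w : E3))
        - pd a (fun y => D.h y b b) (s • (w : E3))) * (w : E3) a := by
      simp only [Fin.sum_univ_three, PiLp.smul_apply, smul_eq_mul]
      ring
    have h2 : ∑ a, ∑ b, (pd b (fun y => D.h y a b) (s • (w : E3))
        - pd a (fun y => D.h y b b) (s • (w : E3))) * (s • (w : E3)) a =
        s ^ 2 * (2 * radialProfile D.h (s ^ 2) - 4 * deriv (tangProfile D.h) (s ^ 2)) := by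
      simp only [Fin.sum_univ_three, H.pd_metric hu]
      rw [hx, ← hx]
      generalize deriv (tangProfile D.h) (rsq (s • (w : E3))) = α'
      generalize deriv (radialProfile D.h) (rsq (s • (w : E3))) = β'
      generalize radialProfile D.h (rsq (s • (w : E3))) = β
      generalize s • (w : E3) = x
      simp [kd, rsq]
      ring
    have h3 := radC_sq D hs
    rw [radC, tangProfile_sq _ hs] at h3
    rw [S.deriv_axA hs, axA, ← h3]
    rw [h1] at h2
    have h4 : ∀ X : ℝ, s ^ 2 * X = s * (s * X) := fun X => by ring
    rw [h4, h2]
    ring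
  simp only [key]
  rw [integral_toSphere_const]
  have := Real.pi_ne_zero
  field_simp
  ring

end InitialData

open Filter Asymptotics

/-! ### Asymptotics along the axis -/

theorem tendsto_axisPt : Tendsto axisPt atTop (Bornology.cobounded E3) := by
  rw [← tendsto_norm_atTop_iff_cobounded]
  simp only [norm_axisPt]
  exact tendsto_abs_atTop_atTop

theorem isBigO_axis {f : E3 → ℝ} {n : ℕ}
    (hf : f =O[Bornology.cobounded E3] fun x => (‖x‖ ^ n)⁻¹) :
    (fun t => t ^ n * f (axisPt t)) =O[atTop] fun _ => (1 : ℝ) := by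
  have h1 : (fun t => f (axisPt t)) =O[atTop] fun t : ℝ => (t ^ n)⁻¹ := by
    refine (hf.comp_tendsto tendsto_axisPt).trans (IsBigO.of_bound 1 ?_)
    filter_upwards [eventually_gt_atTop 0] with t ht
    simp [norm_axisPt]
  have h2 := (isBigO_refl (fun t : ℝ => t ^ n) atTop).mul h1
  refine h2.trans (IsBigO.of_bound 1 ?_)
  filter_upwards [eventually_gt_atTop 0] with t ht
  rw [mul_inv_cancel₀ (pow_pos ht n).ne']
  simp

theorem tendsto_zero_of_mul_isBigO {f : ℝ → ℝ}
    (hf : (fun t => t * f t) =O[atTop] fun _ => (1 : ℝ)) : Tendsto f atTop (𝓝 0) := by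
  have h1 : (fun t : ℝ => t⁻¹) =o[atTop] fun _ => (1 : ℝ) :=
    (isLittleO_one_iff ℝ).2 tendsto_inv_atTop_zero
  have h2 := h1.mul_isBigO hf
  simp only [mul_one] at h2
  refine ((isLittleO_one_iff ℝ).1 h2).congr' ?_
  filter_upwards [eventually_gt_atTop 0] with t ht
  field_simp

namespace InitialData

variable {D : InitialData}

namespace AsymptoticallyFlat

theorem isBigO_axA (F : D.AsymptoticallyFlat) :
    (fun t => t * (D.axA t - 1)) =O[atTop] fun _ => (1 : ℝ) := by
  have h := isBigO_axis (n := 1) (f := fun x => D.h x 1 1 - 1)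
    (by simpa using F.metric 1 1)
  simpa [axA] using h

theorem isBigO_axC (F : D.AsymptoticallyFlat) :
    (fun t => t * (D.axC t - 1)) =O[atTop] fun _ => (1 : ℝ) := by
  have h := isBigO_axis (n := 1) (f := fun x => D.h x 0 0 - 1)
    (by simpa using F.metric 0 0)
  simpa [axC] using h

theorem isBigO_deriv_axA (F : D.AsymptoticallyFlat) :
    (fun t => t ^ 2 * deriv D.axA t) =O[atTop] fun _ => (1 : ℝ) := by
  have h := isBigO_axis (F.metric_deriv 1 1 0)
  have e : ∀ t, deriv D.axA t = pd 0 (fun y => D.h y 1 1) (axisPt t) := fun t =>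
    deriv_comp_axisPt t ((D.smooth_h 1 1).differentiable (by simp) _)
  simpa only [e] using h

theorem isBigO_axK (F : D.AsymptoticallyFlat) :
    (fun t => t ^ 2 * D.axK t) =O[atTop] fun _ => (1 : ℝ) :=
  isBigO_axis (F.extrinsic 1 1)

theorem tendsto_axA (F : D.AsymptoticallyFlat) : Tendsto D.axA atTop (𝓝 1) := by
  simpa using (tendsto_zero_of_mul_isBigO F.isBigO_axA).add_const 1

theorem tendsto_axC (F : D.AsymptoticallyFlat) : Tendsto D.axC atTop (𝓝 1) := by
  simpa using (tendsto_zero_of_mul_isBigO F.isBigO_axC).add_const 1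

theorem tendsto_radius (F : D.AsymptoticallyFlat) :
    Tendsto (fun t => t * √(D.axA t)) atTop atTop := by
  have h : Tendsto (fun t => √(D.axA t)) atTop (𝓝 1) := by
    simpa using F.tendsto_axA.sqrt
  exact tendsto_id.atTop_mul_pos one_pos h

/-- Put X = t (C - A - t A'), which is bounded. Expanding the definition, the difference is (√A / C
- 1) X - t⁻¹ (t² A')² √A / (4AC) + t⁻¹ (t² K)² √A / A. The first coefficient tends to zero and the
other two terms are t⁻¹ times bounded functions. As X is twice the mass flux, the ADM mass is the
limit of the Misner–Sharp mass. -/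
theorem tendsto_misnerSharp_sub (F : D.AsymptoticallyFlat) :
    Tendsto (fun t => D.misnerSharp t - t * (D.axC t - D.axA t - t * deriv D.axA t)) atTop
      (𝓝 0) := by
  have hA := F.tendsto_axA
  have hC := F.tendsto_axC
  have hsA : Tendsto (fun t => √(D.axA t)) atTop (𝓝 1) := by simpa using hA.sqrt
  have h1 : (fun t => √(D.axA t) / D.axC t - 1) =o[atTop] fun _ => (1 : ℝ) := by
    rw [isLittleO_one_iff]
    simpa using (hsA.div hC one_ne_zero).sub_const 1
  have hX := (F.isBigO_axC.sub F.isBigO_axA).sub F.isBigO_deriv_axA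
  have h2 : (fun t => √(D.axA t) / (4 * D.axA t * D.axC t)) =O[atTop] fun _ => (1 : ℝ) :=
    (hsA.div ((hA.const_mul 4).mul hC) (by norm_num)).isBigO_one ℝ
  have h3 : (fun t => √(D.axA t) / D.axA t) =O[atTop] fun _ => (1 : ℝ) :=
    (hsA.div hA one_ne_zero).isBigO_one ℝ
  have hi : (fun t : ℝ => t⁻¹) =o[atTop] fun _ => (1 : ℝ) :=
    (isLittleO_one_iff ℝ).2 tendsto_inv_atTop_zero
  have t1 := h1.mul_isBigO hX
  have t2 := hi.mul_isBigO ((F.isBigO_deriv_axA.mul F.isBigO_deriv_axA).mul h2)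
  have t3 := hi.mul_isBigO ((F.isBigO_axK.mul F.isBigO_axK).mul h3)
  simp only [mul_one] at t1 t2 t3
  have tot := (isLittleO_one_iff ℝ).1 ((t1.sub t2).add t3)
  refine tot.congr' ?_
  filter_upwards [eventually_gt_atTop 0] with t ht
  have hA0 := (D.axA_pos t).ne'
  have hC0 := (D.axC_pos t).ne'
  rw [misnerSharp, axD]
  field_simp
  ring

end AsymptoticallyFlat

theorem SphericallySymmetric.hasMass_iff (S : D.SphericallySymmetric) (F : D.AsymptoticallyFlat)
    (m : ℝ) : D.HasMass m ↔ Tendsto D.misnerSharp atTop (𝓝 (2 * m)) := by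
  have h1 : D.HasMass m ↔
      Tendsto (fun t => t / 2 * (D.axC t - D.axA t - t * deriv D.axA t)) atTop (𝓝 m) := by
    unfold HasMass
    apply tendsto_congr'
    filter_upwards [eventually_gt_atTop 0] with t ht
    exact S.massFlux_eq ht
  rw [h1]
  have h2 := F.tendsto_misnerSharp_sub
  constructor
  · intro h
    have h3 := h2.add (h.const_mul 2)
    rw [zero_add] at h3
    refine h3.congr fun t => ?_
    ring
  · intro h
    have h3 := (h.sub h2).const_mul (1 / 2)
    have e : 1 / 2 * (2 * m - 0) = m := by ring
    rw [e] at h3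
    refine h3.congr fun t => ?_
    ring

/-! ### The exterior of a charged body -/

theorem eq_of_hasDerivAt_zero {f : ℝ → ℝ} {a b : ℝ} (hab : a ≤ b) (hc : ContinuousOn f (Set.Icc a b))
    (hd : ∀ t ∈ Set.Ioo a b, HasDerivAt f 0 t) : f b = f a := by
  have h := intervalIntegral.integral_eq_sub_of_hasDerivAt_of_le hab hc hd
    (by simp)
  simp at h
  linarith

/-- The product of the null expansions is `4 / r² * (1 - 2 m / r)`, with `r` the area radius and
`m` the Misner-Sharp mass. -/
theorem SphericallySymmetric.theta_mul_theta_misnerSharp (S : D.SphericallySymmetric) {x : E3}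
    (hx : 0 < ‖x‖) :
    D.thetaPlus x * D.thetaMinus x = 4 / (‖x‖ * √(D.axA ‖x‖)) ^ 2
      * (1 - D.misnerSharp ‖x‖ / (‖x‖ * √(D.axA ‖x‖))) := by
  have hA := D.axA_pos ‖x‖
  have hs := Real.sqrt_pos.2 hA
  rw [S.theta_mul_theta_eq hx, misnerSharp, mul_pow, Real.sq_sqrt hA.le]
  field_simp
  ring

theorem hasDerivAt_radius (D : InitialData) (t : ℝ) :
    HasDerivAt (fun t => t * √(D.axA t)) (D.axD t / √(D.axA t)) t := by
  have hA := D.axA_pos t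
  have hs := Real.sqrt_pos.2 hA
  have h1 : HasDerivAt D.axA (deriv D.axA t) t :=
    (D.contDiff_axA.differentiable (by simp) t).hasDerivAt
  refine ((hasDerivAt_id t).mul (h1.sqrt hA.ne')).congr_deriv ?_
  have hss := Real.sq_sqrt hA.le
  rw [axD]
  simp only [id]
  field_simp
  rw [hss]
  ring

theorem vecNormSq_axis (S : D.SphericallySymmetric) {V : E3 → Fin 3 → ℝ}
    (W : RadialVector V (Set.Ioi 0) (vectorProfile V)) {t : ℝ} (ht : 0 < t) :
    vecNormSq D.h V (axisPt t) = D.axC t * V (axisPt t) 0 ^ 2 := by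
  have hu : rsq (axisPt t) ∈ Set.Ioi (0 : ℝ) := by rw [rsq_axisPt]; exact pow_pos ht 2
  rw [S.radialMetric.vecNormSq_eq hu (W.eq _ hu), rsq_axisPt, radC_sq D ht, vectorProfile_sq V ht]
  field_simp

/-- The divergence of B vanishes inside the body too, so its flux is constant from the origin on:
there is no magnetic charge. -/
theorem SphericallySymmetric.flux_B_eq_zero (S : D.SphericallySymmetric) {t : ℝ} (ht : 0 ≤ t) :
    D.flux D.B t = 0 := by
  have h := eq_of_hasDerivAt_zero ht (D.continuous_flux D.smooth_B).continuousOn fun y hy =>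
    (S.hasDerivAt_flux S.radialVector_B hy.1).congr_deriv (by rw [D.gauss_B, mul_zero])
  rw [h]
  simp [flux]

namespace ChargedBody

variable {s : ℝ}

theorem flux_E_eq (H : D.ChargedBody s) {t : ℝ} (ht : s ≤ t) : D.flux D.E t = D.charge s := by
  have S := H.spherical
  rw [S.charge_eq_flux H.pos.le]
  refine eq_of_hasDerivAt_zero ht (D.continuous_flux D.smooth_E).continuousOn fun y hy => ?_
  have hy0 : 0 < y := H.pos.trans hy.1
  refine (S.hasDerivAt_flux S.radialVector_E hy0).congr_deriv ?_
  have h1 : axisPt y ∈ (Metric.closedBall (0 : E3) s)ᶜ := by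
    simp [norm_axisPt, abs_of_pos hy0, hy.1]
  rw [D.gauss_E, (H.electrovacuum _ h1).2.2]
  ring

/-- The exterior energy is that of E alone, and the constant flux of E fixes |E|² = Q² / r⁴. -/
theorem density_eq (H : D.ChargedBody s) {t : ℝ} (ht : s < t) :
    D.μ (axisPt t) = D.charge s ^ 2 / (8 * Real.pi * t ^ 4 * D.axA t ^ 2) := by
  have S := H.spherical
  have ht0 : 0 < t := H.pos.trans ht
  have h1 : axisPt t ∈ (Metric.closedBall (0 : E3) s)ᶜ := by
    simp [norm_axisPt, abs_of_pos ht0, ht]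
  have h2 := (H.electrovacuum _ h1).1
  have hA := D.axA_pos t
  have hC := D.axC_pos t
  have hs := Real.sqrt_pos.2 hC
  have hB : D.B (axisPt t) 0 = 0 := by
    have h := S.flux_B_eq_zero ht0.le
    rw [flux] at h
    have h3 : t ^ 2 * D.axA t * √(D.axC t) ≠ 0 := by positivity
    exact (mul_eq_zero.1 h).resolve_left h3
  rw [matterDensity, vecNormSq_axis S S.radialVector_E ht0, vecNormSq_axis S S.radialVector_B ht0,
    hB] at h2
  have hss := Real.sq_sqrt hC.le
  have hpi := Real.pi_ne_zero
  rw [← H.flux_E_eq ht.le, flux, mul_pow, mul_pow, mul_pow, hss]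
  have h4 : D.μ (axisPt t) = 1 / (8 * Real.pi) * (D.axC t * D.E (axisPt t) 0 ^ 2) := by
    linear_combination h2
  rw [h4]
  field_simp

/-- Twice the total mass of the exterior. -/
def exteriorMass (D : InitialData) (s : ℝ) : ℝ :=
  D.misnerSharp s + D.charge s ^ 2 / (s * √(D.axA s))

/-- Outside the body (2m)' = Q² r' / r², which is the derivative of -Q² / r; hence 2m + Q² / r is
constant. -/
theorem misnerSharp_eq (H : D.ChargedBody s) {t : ℝ} (ht : s ≤ t) :
    D.misnerSharp t = exteriorMass D s - D.charge s ^ 2 / (t * √(D.axA t)) := by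
  have S := H.spherical
  rw [eq_sub_iff_add_eq, exteriorMass]
  have hpos : ∀ y, 0 < y → 0 < y * √(D.axA y) := fun y hy =>
    mul_pos hy (Real.sqrt_pos.2 (D.axA_pos y))
  refine eq_of_hasDerivAt_zero
    (f := fun t => D.misnerSharp t + D.charge s ^ 2 / (t * √(D.axA t))) ht ?_ fun y hy => ?_
  · refine D.continuous_misnerSharp.continuousOn.add (continuousOn_const.div ?_ fun y hy =>
      (hpos y (H.pos.trans_le hy.1)).ne')
    exact (continuous_id.mul D.contDiff_axA.continuous.sqrt).continuousOn
  · have hy0 : 0 < y := H.pos.trans hy.1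
    have hy1 : axisPt y ∈ (Metric.closedBall (0 : E3) s)ᶜ := by
      simp [norm_axisPt, abs_of_pos hy0, hy.1]
    have hA := D.axA_pos y
    have hs := Real.sqrt_pos.2 hA
    have hss := Real.sq_sqrt hA.le
    refine ((S.hasDerivAt_misnerSharp hy0).add ((hasDerivAt_const y (D.charge s ^ 2)).div
      (D.hasDerivAt_radius y) (hpos y hy0).ne')).congr_deriv ?_
    rw [H.density_eq hy.1, (H.electrovacuum _ hy1).2.1]
    have hpi := Real.pi_ne_zero
    generalize √(D.axA y) = σ at *
    rw [← hss]
    simp only [Pi.zero_apply]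
    field_simp
    ring

/-- Whether an exterior sphere is trapped is decided by the sign of the Reissner–Nordström quadratic
at its area radius; neither the slice nor K enters otherwise. -/
theorem theta_mul_theta_exterior (H : D.ChargedBody s) {x : E3} (hx : s ≤ ‖x‖) :
    D.thetaPlus x * D.thetaMinus x = 4 / (‖x‖ * √(D.axA ‖x‖)) ^ 4
      * ((‖x‖ * √(D.axA ‖x‖)) ^ 2 - exteriorMass D s * (‖x‖ * √(D.axA ‖x‖))
        + D.charge s ^ 2) := by
  have hx0 : 0 < ‖x‖ := H.pos.trans_le hx
  have hs := Real.sqrt_pos.2 (D.axA_pos ‖x‖)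
  have hr : 0 < ‖x‖ * √(D.axA ‖x‖) := mul_pos hx0 hs
  rw [H.spherical.theta_mul_theta_misnerSharp hx0, H.misnerSharp_eq hx]
  generalize ‖x‖ * √(D.axA ‖x‖) = r at *
  field_simp
  ring

/-- Asymptotic flatness enters both inequalities here: the area radius is continuous and unbounded,
although it need not be monotone. -/
theorem exists_radius_eq (F : D.AsymptoticallyFlat) {t r : ℝ}
    (hr : t * √(D.axA t) < r) : ∃ y, t < y ∧ y * √(D.axA y) = r := by
  obtain ⟨b, hb, hb'⟩ := ((F.tendsto_radius.eventually_gt_atTop r).and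
    (eventually_gt_atTop t)).exists
  have hc : ContinuousOn (fun t => t * √(D.axA t)) (Set.Icc t b) :=
    (continuous_id.mul D.contDiff_axA.continuous.sqrt).continuousOn
  obtain ⟨y, hy, h⟩ := intermediate_value_Ioo hb'.le hc ⟨hr, hb⟩
  exact ⟨y, hy.1, h⟩

theorem hasMass_iff (H : D.ChargedBody s) (F : D.AsymptoticallyFlat) (m : ℝ) :
    D.HasMass m ↔ exteriorMass D s = 2 * m := by
  have h1 : Tendsto D.misnerSharp atTop (𝓝 (exteriorMass D s)) := by
    have h2 : Tendsto (fun t => exteriorMass D s - D.charge s ^ 2 / (t * √(D.axA t))) atTop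
        (𝓝 (exteriorMass D s)) := by
      simpa using tendsto_const_nhds.sub (F.tendsto_radius.const_div_atTop (D.charge s ^ 2))
    refine h2.congr' ?_
    filter_upwards [eventually_ge_atTop s] with t ht
    exact (H.misnerSharp_eq ht).symm
  rw [H.spherical.hasMass_iff F]
  exact ⟨fun h => tendsto_nhds_unique h1 h, fun h => h ▸ h1⟩

/-- The area radius of a horizon is at least the absolute value of the charge, with equality if
the mass equals the absolute value of the charge. -/
theorem charge_le_of_isHorizon (H : D.ChargedBody s) (F : D.AsymptoticallyFlat) {s₁ : ℝ}
    (hs : s ≤ s₁) (hor : D.IsHorizon s₁) :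
    |D.charge s| ≤ D.areaRadius s₁ ∧
      (D.HasMass |D.charge s| → D.areaRadius s₁ = |D.charge s|) := by
  have h0 : 0 < s₁ := H.pos.trans_le hs
  have hq := sq_abs (D.charge s)
  have hq0 := abs_nonneg (D.charge s)
  rw [H.hasMass_iff F, H.spherical.areaRadius_eq h0]
  have hn : ‖axisPt s₁‖ = s₁ := by rw [norm_axisPt, abs_of_pos h0]
  have hpos : ∀ y, 0 < y → 0 < y * √(D.axA y) := fun y hy =>
    mul_pos hy (Real.sqrt_pos.2 (D.axA_pos y))
  have h1 := hor.1 (axisPt s₁) hn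
  rw [H.theta_mul_theta_exterior (by rw [hn]; exact hs), hn] at h1
  have hR := hpos s₁ h0
  have h2 : ∀ r, s₁ * √(D.axA s₁) < r →
      0 ≤ r ^ 2 - exteriorMass D s * r + D.charge s ^ 2 := by
    intro r hr
    obtain ⟨y, hy, rfl⟩ := exists_radius_eq F hr
    have hy0 : 0 < y := h0.trans hy
    have hny : ‖axisPt y‖ = y := by rw [norm_axisPt, abs_of_pos hy0]
    have h3 := hor.2 (axisPt y) (by rw [hny]; exact hy)
    rw [H.theta_mul_theta_exterior (by rw [hny]; exact hs.trans hy.le), hny] at h3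
    exact nonneg_of_mul_nonneg_right h3 (div_pos four_pos (pow_pos (hpos y hy0) 4))
  generalize s₁ * √(D.axA s₁) = R at *
  have h4 : R ^ 2 - exteriorMass D s * R + D.charge s ^ 2 = 0 :=
    (mul_eq_zero.1 h1).resolve_left (by positivity)
  rw [← hq] at h2 h4
  generalize |D.charge s| = q at *
  generalize exteriorMass D s = m at *
  constructor
  · by_contra! hlt
    -- The roots R and q² / R have product q², so R < q puts q strictly between them. The midpoint
    -- of R and q is then a radius beyond the horizon at which the quadratic is negative; `h6` is
    -- its factorization, multiplied by R.
    have h5 := h2 ((R + q) / 2) (by linarith)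
    have h6 : R * (((R + q) / 2) ^ 2 - m * ((R + q) / 2) + q ^ 2) =
        ((R + q) / 2 - R) * (R * ((R + q) / 2) - q ^ 2) := by
      linear_combination ((R + q) / 2) * h4
    have h7 : R * ((R + q) / 2) - q ^ 2 < 0 := by nlinarith
    have h8 : 0 < (R + q) / 2 - R := by linarith
    have h9 := mul_nonneg hR.le h5
    rw [h6] at h9
    nlinarith [mul_pos h8 (neg_pos.2 h7)]
  · intro hm
    rw [hm] at h4
    have h5 : (R - q) ^ 2 = 0 := by linear_combination h4
    linarith [pow_eq_zero_iff two_ne_zero |>.1 h5]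

/-! ### Positivity of the quasi-local mass and the size-charge inequality -/

/-- The quasi-local mass of the boundary of the body is non-negative if the area radius does not
decrease there. -/
theorem misnerSharp_nonneg (H : D.ChargedBody s) (hD : 0 ≤ D.axD s) : 0 ≤ D.misnerSharp s := by
  have S := H.spherical
  by_contra! hneg
  have hm0 : D.misnerSharp 0 = 0 := by simp [misnerSharp]
  have hcomp : IsCompact (Set.Icc 0 s ∩ {t | 0 ≤ D.misnerSharp t}) :=
    isCompact_Icc.inter_right (isClosed_le continuous_const D.continuous_misnerSharp)
  -- The last sphere in the body with non-negative mass; the centre is one such. The mass is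
  -- negative from there up to the boundary.
  obtain ⟨t₀, ⟨⟨ht0, hts⟩, htm⟩, hmax⟩ := hcomp.exists_isGreatest
    ⟨0, ⟨le_refl 0, H.pos.le⟩, hm0.ge⟩
  have hts' : t₀ < s := lt_of_le_of_ne hts fun h => by
    rw [h] at htm; exact absurd htm (not_le.2 hneg)
  have hbelow : ∀ t ∈ Set.Ioc t₀ s, D.misnerSharp t < 0 := fun t ht => by
    by_contra! h
    exact absurd (hmax ⟨⟨ht0.trans ht.1.le, ht.2⟩, h⟩) (not_le.2 ht.1)
  -- Negative mass means r'² > 1 + r² K_r²; in particular r' ≠ 0, so r' keeps the sign it has at the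
  -- boundary.
  have hsq : ∀ t ∈ Set.Ioc t₀ s, D.axC t * (t ^ 2 * D.axK t ^ 2) < D.axD t ^ 2 := fun t ht => by
    have htp : 0 < t := ht0.trans_lt ht.1
    have h1 := hbelow t ht
    have hA := D.axA_pos t
    have hC := D.axC_pos t
    have hr : 0 < t * √(D.axA t) := mul_pos htp (Real.sqrt_pos.2 hA)
    rw [misnerSharp] at h1
    have h2 : 1 - D.axD t ^ 2 / (D.axA t * D.axC t) + t ^ 2 * D.axK t ^ 2 / D.axA t < 0 := by
      by_contra! h
      exact absurd h1 (not_lt.2 (mul_nonneg hr.le h))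
    have h3 : D.axA t * D.axC t + D.axC t * (t ^ 2 * D.axK t ^ 2) - D.axD t ^ 2 < 0 := by
      have h4 := mul_neg_of_pos_of_neg (mul_pos hA hC) h2
      field_simp at h4
      linarith
    nlinarith [mul_pos hA hC]
  have hDne : ∀ t ∈ Set.Ioc t₀ s, D.axD t ≠ 0 := fun t ht h => by
    have h1 := hsq t ht
    rw [h] at h1
    have h2 : 0 ≤ D.axC t * (t ^ 2 * D.axK t ^ 2) := mul_nonneg (D.axC_pos t).le (by positivity)
    norm_num at h1
    linarith
  have hDpos : ∀ t ∈ Set.Ioc t₀ s, 0 < D.axD t := fun t ht => by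
    by_contra! h
    obtain ⟨y, hy, hy0⟩ := intermediate_value_Icc ht.2 D.continuous_axD.continuousOn ⟨h, hD⟩
    exact hDne y ⟨ht.1.trans_le hy.1, hy.2⟩ hy0
  have hmono : MonotoneOn D.misnerSharp (Set.Icc t₀ s) := by
    refine monotoneOn_of_deriv_nonneg (convex_Icc t₀ s) D.continuous_misnerSharp.continuousOn
      ?_ ?_
    · intro t ht
      rw [interior_Icc] at ht
      exact (S.hasDerivAt_misnerSharp (ht0.trans_lt ht.1)).differentiableAt.differentiableWithinAt
    · intro t ht
      rw [interior_Icc] at ht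
      have htp : 0 < t := ht0.trans_lt ht.1
      have ht' : t ∈ Set.Ioc t₀ s := ⟨ht.1, ht.2.le⟩
      rw [(S.hasDerivAt_misnerSharp htp).deriv]
      have hr : 0 < t * √(D.axA t) := mul_pos htp (Real.sqrt_pos.2 (D.axA_pos t))
      refine mul_nonneg (mul_nonneg (by positivity) hr.le) ?_
      have hC := D.axC_pos t
      have hμ := H.dominant (axisPt t) (by simp [norm_axisPt, abs_of_pos htp, ht.2.le])
      rw [vecNormSq_axis S S.radialVector_j htp, Real.sqrt_mul hC.le, Real.sqrt_sq_eq_abs] at hμ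
      have h1 : √(D.axC t) * (t * |D.axK t|) ≤ D.axD t := by
        apply le_of_sq_le_sq _ (hDpos t ht').le
        rw [mul_pow, mul_pow, Real.sq_sqrt hC.le, sq_abs]
        exact (hsq t ht').le
      have h2 := mul_le_mul hμ h1 (by positivity) ((by positivity : 0 ≤ √(D.axC t)
        * |D.j (axisPt t) 0|).trans hμ)
      have h3 : √(D.axC t) * |D.j (axisPt t) 0| * (√(D.axC t) * (t * |D.axK t|)) =
          t * D.axC t * |D.j (axisPt t) 0 * D.axK t| := by
        rw [abs_mul]
        nth_rewrite 3 [← Real.mul_self_sqrt hC.le]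
        ring
      have h4 := neg_abs_le (D.j (axisPt t) 0 * D.axK t)
      have h5 : t * D.axC t * (-|D.j (axisPt t) 0 * D.axK t|) ≤
          t * D.axC t * (D.j (axisPt t) 0 * D.axK t) :=
        mul_le_mul_of_nonneg_left h4 (by positivity)
      rw [h3] at h2
      linarith
  have := hmono ⟨le_refl t₀, hts⟩ ⟨hts, le_refl s⟩ hts
  exact absurd htm (not_le.2 (this.trans_lt hneg))

/-- In asymptotically flat data with untrapped exterior the area radius does not decrease at the
boundary of the body. -/
theorem axD_nonneg (H : D.ChargedBody s) (F : D.AsymptoticallyFlat)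
    (U : D.Untrapped (Metric.closedBall 0 s)ᶜ) : 0 ≤ D.axD s := by
  by_contra! hneg
  -- Where r' = 0 only the term -r² K_r² is left in θ⁺θ⁻, so the sphere is not untrapped.
  have hne : ∀ t, s < t → D.axD t ≠ 0 := by
    intro t ht h0
    have htp : 0 < t := H.pos.trans ht
    have hn : ‖axisPt t‖ = t := by rw [norm_axisPt, abs_of_pos htp]
    have h1 := U (axisPt t) (by simp [hn, ht])
    rw [H.spherical.theta_mul_theta_eq (by rw [hn]; exact htp), hn, h0] at h1
    have hA := D.axA_pos t
    have h2 : 4 / (t ^ 2 * D.axA t) * (0 ^ 2 / (D.axA t * D.axC t)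
        - t ^ 2 * D.axK t ^ 2 / D.axA t) ≤ 0 := by
      have h3 : 0 ≤ 4 / (t ^ 2 * D.axA t) := by positivity
      have h4 : 0 ≤ t ^ 2 * D.axK t ^ 2 / D.axA t := by positivity
      apply mul_nonpos_of_nonneg_of_nonpos h3
      simp
      exact h4
    linarith
  have hDneg : ∀ t, s ≤ t → D.axD t < 0 := by
    intro t ht
    by_contra! h
    obtain ⟨y, hy, hy0⟩ := intermediate_value_Icc ht D.continuous_axD.continuousOn ⟨hneg.le, h⟩
    rcases hy.1.eq_or_lt with rfl | hlt
    · exact hneg.ne hy0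
    · exact hne y hlt hy0
  have hanti : AntitoneOn (fun t => t * √(D.axA t)) (Set.Ici s) := by
    refine antitoneOn_of_deriv_nonpos (convex_Ici s)
      (continuous_id.mul D.contDiff_axA.continuous.sqrt).continuousOn
      (fun t _ => (D.hasDerivAt_radius t).differentiableAt.differentiableWithinAt) ?_
    intro t ht
    rw [interior_Ici] at ht
    rw [(D.hasDerivAt_radius t).deriv]
    exact div_nonpos_of_nonpos_of_nonneg (hDneg t (le_of_lt ht)).le (Real.sqrt_nonneg _)
  obtain ⟨b, hb, hb'⟩ := ((F.tendsto_radius.eventually_gt_atTop (s * √(D.axA s))).and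
    (eventually_gt_atTop s)).exists
  exact absurd (hanti (Set.self_mem_Ici) hb'.le hb'.le) (not_le.2 hb)

/-- The sphere of area radius |Q| is the best test sphere: with m in the proof for 2M, untrappedness
there gives 2M < 2|Q|, while m ≥ 0 at the boundary gives 2M ≥ Q² / R. -/
theorem charge_lt_two_mul_areaRadius (H : D.ChargedBody s) (F : D.AsymptoticallyFlat)
    (U : D.Untrapped (Metric.closedBall 0 s)ᶜ) : |D.charge s| < 2 * D.areaRadius s := by
  have hm := H.misnerSharp_nonneg (H.axD_nonneg F U)
  rw [H.misnerSharp_eq le_rfl] at hm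
  rw [H.spherical.areaRadius_eq H.pos]
  have hR : 0 < s * √(D.axA s) := mul_pos H.pos (Real.sqrt_pos.2 (D.axA_pos s))
  have hq := sq_abs (D.charge s)
  have hq0 := abs_pos.2 H.charge_ne_zero
  by_contra! hle
  obtain ⟨y, hy, hyr⟩ := exists_radius_eq F (show s * √(D.axA s) < |D.charge s| by linarith)
  have hy0 : 0 < y := H.pos.trans hy
  have hn : ‖axisPt y‖ = y := by rw [norm_axisPt, abs_of_pos hy0]
  have h1 := U (axisPt y) (by simp [hn, hy])
  rw [H.theta_mul_theta_exterior (by rw [hn]; exact hy.le), hn, hyr, ← hq] at h1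
  rw [← hq] at hm
  generalize |D.charge s| = q at *
  generalize exteriorMass D s = m at *
  generalize s * √(D.axA s) = R at *
  have h2 : 0 < q ^ 2 - m * q + q ^ 2 := pos_of_mul_pos_right h1 (by positivity)
  have h3 : m < 2 * q := by nlinarith
  have h4 : 2 * q ≤ q ^ 2 / R := by
    rw [le_div_iff₀ hR]; nlinarith
  linarith

end ChargedBody
end InitialData

/-! ### Initial data from radial profiles -/

/-- Smooth profiles of rotation-invariant data with vanishing momentum density and magnetic field:
the metric is `A δ + B x xᵀ`, the extrinsic curvature `κ δ + l x xᵀ` and the electric field `e x`,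
the coefficients being functions of `rsq x`. -/
structure Profiles where
  U : Set ℝ
  A : ℝ → ℝ
  B : ℝ → ℝ
  κ : ℝ → ℝ
  l : ℝ → ℝ
  e : ℝ → ℝ
  isOpen : IsOpen U
  mem_of_nonneg : ∀ u, 0 ≤ u → u ∈ U
  smooth_A : ContDiffOn ℝ ∞ A U
  smooth_B : ContDiffOn ℝ ∞ B U
  smooth_κ : ContDiffOn ℝ ∞ κ U
  smooth_l : ContDiffOn ℝ ∞ l U
  smooth_e : ContDiffOn ℝ ∞ e U
  pos_A : ∀ u ∈ U, 0 < A u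
  pos_C : ∀ u ∈ U, 0 < A u + u * B u
  momentum : ∀ u, 0 < u → -4 * deriv (fun u => κ u / A u) u
    + 2 * (A u + u * deriv A u) / (u * A u) * ((κ u + u * l u) / radC A B u - κ u / A u) = 0

/-- Profiles are functions of |x|² rather than |x|, and |x|² is a polynomial; when `U` is open, it
reaches past 0 and smoothness at the origin is automatic. -/
theorem contDiff_comp_rsq {f : ℝ → ℝ} {U : Set ℝ} (hU : ∀ u, 0 ≤ u → u ∈ U)
    (hf : ContDiffOn ℝ ∞ f U) : ContDiff ℝ ∞ (fun x => f (rsq x)) := by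
  rw [← contDiffOn_univ] at *
  exact hf.comp contDiff_rsq.contDiffOn fun x _ => hU _ (rsq_nonneg x)

theorem contDiff_pd {f : E3 → ℝ} (hf : ContDiff ℝ ∞ f) (k : Fin 3) : ContDiff ℝ ∞ (pd k f) := by
  have h : ContDiff ℝ ∞ (fderiv ℝ f) := hf.fderiv_right (by simp)
  exact h.clm_apply contDiff_const

section Smoothness

variable {h T : E3 → Matrix (Fin 3) (Fin 3) ℝ} {V : E3 → Fin 3 → ℝ}

theorem contDiff_christoffel (hh : ∀ a b, ContDiff ℝ ∞ (fun x => h x a b))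
    (hi : ∀ a b, ContDiff ℝ ∞ (fun x => (h x)⁻¹ a b)) (i j k : Fin 3) :
    ContDiff ℝ ∞ (christoffel h i j k) := by
  have hp := fun a b c => contDiff_pd (hh a b) c
  unfold christoffel
  exact contDiff_const.mul (ContDiff.sum fun l _ =>
    (hi i l).mul (((hp l k j).add (hp l j k)).sub (hp j k l)))

theorem contDiff_scalarCurv (hh : ∀ a b, ContDiff ℝ ∞ (fun x => h x a b))
    (hi : ∀ a b, ContDiff ℝ ∞ (fun x => (h x)⁻¹ a b)) : ContDiff ℝ ∞ (scalarCurv h) := by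
  have hc := contDiff_christoffel hh hi
  unfold scalarCurv ricci
  refine ContDiff.sum fun j _ => ContDiff.sum fun k _ => (hi j k).mul (ContDiff.add ?_ ?_)
  · exact ContDiff.sum fun i _ => (contDiff_pd (hc i j k) i).sub (contDiff_pd (hc i i k) j)
  · exact ContDiff.sum fun i _ => ContDiff.sum fun l _ =>
      ((hc i i l).mul (hc l j k)).sub ((hc i j l).mul (hc l i k))

theorem contDiff_traceWrt (hi : ∀ a b, ContDiff ℝ ∞ (fun x => (h x)⁻¹ a b))
    (hT : ∀ a b, ContDiff ℝ ∞ (fun x => T x a b)) : ContDiff ℝ ∞ (traceWrt h T) :=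
  ContDiff.sum fun i _ => ContDiff.sum fun j _ => (hi i j).mul (hT i j)

theorem contDiff_tensorNormSq (hi : ∀ a b, ContDiff ℝ ∞ (fun x => (h x)⁻¹ a b))
    (hT : ∀ a b, ContDiff ℝ ∞ (fun x => T x a b)) : ContDiff ℝ ∞ (tensorNormSq h T) :=
  ContDiff.sum fun i _ => ContDiff.sum fun j _ => ContDiff.sum fun a _ => ContDiff.sum fun b _ =>
    (((hi i a).mul (hi j b)).mul (hT i j)).mul (hT a b)

theorem contDiff_divergence (hh : ∀ a b, ContDiff ℝ ∞ (fun x => h x a b))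
    (hi : ∀ a b, ContDiff ℝ ∞ (fun x => (h x)⁻¹ a b))
    (hV : ∀ a, ContDiff ℝ ∞ (fun x => V x a)) : ContDiff ℝ ∞ (divergence h V) :=
  ContDiff.sum fun i _ => (contDiff_pd (hV i) i).add
    (ContDiff.sum fun k _ => (contDiff_christoffel hh hi i i k).mul (hV k))

end Smoothness

/-- The matrix field `A δ + B x xᵀ`. -/
def radialMatrix (A B : ℝ → ℝ) (x : E3) : Matrix (Fin 3) (Fin 3) ℝ :=
  Matrix.of fun i j => A (rsq x) * kd i j + B (rsq x) * (x i * x j)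

theorem radialMatrix_isSymm (A B : ℝ → ℝ) (x : E3) : (radialMatrix A B x).IsSymm := by
  ext i j
  simp [radialMatrix, kd, eq_comm, mul_comm]

/-- The form is A |y|² + B (x·y)². It is at least A |y|² if B ≥ 0, and at least (A + |x|² B) |y|² by
Cauchy–Schwarz if B ≤ 0. -/
theorem radialMatrix_posDef {A B : ℝ → ℝ} {x : E3} (hA : 0 < A (rsq x))
    (hC : 0 < A (rsq x) + rsq x * B (rsq x)) : (radialMatrix A B x).PosDef := by
  refine Matrix.PosDef.of_dotProduct_mulVec_pos ?_ fun y hy => ?_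
  · ext i j
    simp [radialMatrix, kd, eq_comm, mul_comm]
  · have hy2 : 0 < y 0 ^ 2 + y 1 ^ 2 + y 2 ^ 2 := by
      by_contra! h
      apply hy
      funext i
      fin_cases i <;> simp <;> nlinarith [sq_nonneg (y 0), sq_nonneg (y 1), sq_nonneg (y 2)]
    have hform : star y ⬝ᵥ (radialMatrix A B x *ᵥ y) = A (rsq x) * (y 0 ^ 2 + y 1 ^ 2 + y 2 ^ 2)
        + B (rsq x) * (x 0 * y 0 + x 1 * y 1 + x 2 * y 2) ^ 2 := by
      simp [radialMatrix, dotProduct, Matrix.mulVec, Fin.sum_univ_three, kd]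
      ring
    rw [hform]
    have hcs : (x 0 * y 0 + x 1 * y 1 + x 2 * y 2) ^ 2 ≤
        rsq x * (y 0 ^ 2 + y 1 ^ 2 + y 2 ^ 2) := by
      unfold rsq
      nlinarith [sq_nonneg (x 0 * y 1 - x 1 * y 0), sq_nonneg (x 0 * y 2 - x 2 * y 0),
        sq_nonneg (x 1 * y 2 - x 2 * y 1)]
    have h1 := mul_pos hA hy2
    have h2 := mul_pos hC hy2
    rcases le_total 0 (B (rsq x)) with hB | hB
    · have := mul_nonneg hB (sq_nonneg (x 0 * y 0 + x 1 * y 1 + x 2 * y 2))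
      linarith
    · have := mul_le_mul_of_nonpos_left hcs hB
      nlinarith

theorem rsq_act {R : Matrix (Fin 3) (Fin 3) ℝ}
    (hR : R ∈ Matrix.specialOrthogonalGroup (Fin 3) ℝ) (x : E3) :
    rsq (InitialData.act R x) = rsq x := by
  have ho := (Matrix.mem_orthogonalGroup_iff' _ _).1 (Matrix.mem_specialOrthogonalGroup_iff.1 hR).1
  have e := fun i j => congrFun (congrFun ho i) j
  simp only [Matrix.mul_apply, Fin.sum_univ_three, Matrix.transpose_apply] at e
  have e00 := e 0 0
  have e11 := e 1 1
  have e22 := e 2 2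
  have e01 := e 0 1
  have e02 := e 0 2
  have e12 := e 1 2
  simp at e00 e11 e22 e01 e02 e12
  simp only [rsq, act_apply]
  linear_combination x 0 ^ 2 * e00 + x 1 ^ 2 * e11 + x 2 ^ 2 * e22 + 2 * x 0 * x 1 * e01
    + 2 * x 0 * x 2 * e02 + 2 * x 1 * x 2 * e12

theorem radialMatrix_act (A B : ℝ → ℝ) {R : Matrix (Fin 3) (Fin 3) ℝ}
    (hR : R ∈ Matrix.specialOrthogonalGroup (Fin 3) ℝ) (x : E3) :
    radialMatrix A B (InitialData.act R x) = R * radialMatrix A B x * Rᵀ := by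
  have ho := (Matrix.mem_orthogonalGroup_iff _ _).1 (Matrix.mem_specialOrthogonalGroup_iff.1 hR).1
  ext i j
  have e := congrFun (congrFun ho i) j
  simp only [Matrix.mul_apply, Fin.sum_univ_three, Matrix.transpose_apply, Matrix.one_apply] at e
  simp only [radialMatrix, Matrix.of_apply, rsq_act hR, act_apply, Matrix.mul_apply,
    Fin.sum_univ_three, Matrix.transpose_apply]
  change _ * (if i = j then (1 : ℝ) else 0) + _ = _
  rw [← e]
  simp [kd]
  ring

namespace Profiles

variable (P : Profiles)

theorem rsq_mem (x : E3) : rsq x ∈ P.U := P.mem_of_nonneg _ (rsq_nonneg x)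

theorem radialMetric : RadialMetric (radialMatrix P.A P.B) P.U P.A P.B where
  isOpen := P.isOpen
  smooth_A := P.smooth_A
  smooth_B := P.smooth_B
  pos_A := P.pos_A
  pos_C := P.pos_C
  eq := fun _ _ _ _ => rfl

theorem radialTensor : RadialTensor (radialMatrix P.κ P.l) P.U P.κ P.l where
  smooth_κ := P.smooth_κ
  smooth_l := P.smooth_l
  eq := fun _ _ _ _ => rfl

/-- The electric field `e x`. -/
def field (x : E3) (i : Fin 3) : ℝ := P.e (rsq x) * x i

theorem radialVector : RadialVector P.field P.U P.e where
  smooth := P.smooth_e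
  eq := fun _ _ _ => rfl

theorem contDiff_radialMatrix {A B : ℝ → ℝ} (hA : ContDiffOn ℝ ∞ A P.U)
    (hB : ContDiffOn ℝ ∞ B P.U) (a b : Fin 3) :
    ContDiff ℝ ∞ (fun x => radialMatrix A B x a b) :=
  ((contDiff_comp_rsq P.mem_of_nonneg hA).mul contDiff_const).add
    ((contDiff_comp_rsq P.mem_of_nonneg hB).mul ((contDiff_coord a).mul (contDiff_coord b)))

theorem contDiff_inv (a b : Fin 3) :
    ContDiff ℝ ∞ (fun x => (radialMatrix P.A P.B x)⁻¹ a b) := by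
  have H := P.radialMetric
  simp only [fun x => H.inv_apply (P.rsq_mem x) a b]
  have h1 := contDiff_comp_rsq P.mem_of_nonneg
    ((contDiffOn_const (c := (1 : ℝ))).div H.smooth_A fun u hu => (H.pos_A u hu).ne')
  have h2 := contDiff_comp_rsq P.mem_of_nonneg
    (H.smooth_B.div H.contDiffOn_radC fun u hu => (H.radC_pos hu).ne')
  exact h1.mul (contDiff_const.sub (h2.mul ((contDiff_coord a).mul (contDiff_coord b))))

theorem contDiff_field (a : Fin 3) : ContDiff ℝ ∞ (fun x => P.field x a) :=
  (contDiff_comp_rsq P.mem_of_nonneg P.smooth_e).mul (contDiff_coord a)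

/-- The initial data with given radial profiles; the energy density and the charge density are
determined by the constraints. -/
def data : InitialData where
  h := radialMatrix P.A P.B
  K := radialMatrix P.κ P.l
  μ := fun x => (scalarCurv (radialMatrix P.A P.B) x
    - tensorNormSq (radialMatrix P.A P.B) (radialMatrix P.κ P.l) x
    + traceWrt (radialMatrix P.A P.B) (radialMatrix P.κ P.l) x ^ 2) / (16 * Real.pi)
  j := fun _ _ => 0
  E := P.field
  B := fun _ _ => 0
  ρ := fun x => divergence (radialMatrix P.A P.B) P.field x / (4 * Real.pi)
  smooth_h := P.contDiff_radialMatrix P.smooth_A P.smooth_B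
  smooth_K := P.contDiff_radialMatrix P.smooth_κ P.smooth_l
  smooth_μ :=
    have hh := P.contDiff_radialMatrix P.smooth_A P.smooth_B
    have hK := P.contDiff_radialMatrix P.smooth_κ P.smooth_l
    (((contDiff_scalarCurv hh P.contDiff_inv).sub (contDiff_tensorNormSq P.contDiff_inv hK)).add
      ((contDiff_traceWrt P.contDiff_inv hK).pow 2)).div_const _
  smooth_j := fun _ => contDiff_const
  smooth_E := P.contDiff_field
  smooth_B := fun _ => contDiff_const
  smooth_ρ := (contDiff_divergence (P.contDiff_radialMatrix P.smooth_A P.smooth_B) P.contDiff_inv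
    P.contDiff_field).div_const _
  posDef_h := fun x => radialMatrix_posDef (P.pos_A _ (P.rsq_mem x)) (P.pos_C _ (P.rsq_mem x))
  symm_K := radialMatrix_isSymm _ _
  momentum := fun x a => by
    rw [P.radialMetric.momentum_eq P.radialTensor (P.rsq_mem x), mul_zero]
    rcases (rsq_nonneg x).eq_or_lt with h0 | h0
    · have hx : x = 0 := by
        by_contra hne
        exact (rsq_pos_iff.2 hne).ne h0
      simp [hx]
    · rw [P.momentum _ h0, zero_mul]
  hamiltonian := fun x => by
    have := Real.pi_ne_zero
    field_simp
  gauss_E := fun x => by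
    have := Real.pi_ne_zero
    field_simp
  gauss_B := fun x => by
    simp [divergence, pd_const]

theorem sphericallySymmetric : P.data.SphericallySymmetric where
  h_inv := fun R hR x => radialMatrix_act P.A P.B hR x
  K_inv := fun R hR x => radialMatrix_act P.κ P.l hR x
  μ_inv := fun R hR x => by
    have H := P.radialMetric
    have e := fun y => P.radialTensor.eq y (P.rsq_mem y)
    -- These closed forms depend on x through `rsq x` only. The version of the scalar curvature that
    -- is valid at the origin is needed.
    simp only [data, H.scalarCurv_eq_ric (P.rsq_mem _), H.tensorNormSq_eq (P.rsq_mem _) (e _),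
      H.traceWrt_eq (P.rsq_mem _) (e _), rsq_act hR]
  j_inv := fun R _ x => by
    ext i
    simp [data, Matrix.mulVec, dotProduct]
  E_inv := fun R hR x => by
    ext i
    simp only [data, field, rsq_act hR, act_apply, Matrix.mulVec, dotProduct, Fin.sum_univ_three]
    ring
  B_inv := fun R _ x => by
    ext i
    simp [data, Matrix.mulVec, dotProduct]
  ρ_inv := fun R hR x => by
    have H := P.radialMetric
    simp only [data, H.divergence_eq P.radialVector (P.rsq_mem _), rsq_act hR]

theorem axA_data (t : ℝ) : P.data.axA t = P.A (t ^ 2) := by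
  simp [InitialData.axA, data, radialMatrix, kd, axisPt_one_apply, rsq_axisPt]

theorem axC_data (t : ℝ) : P.data.axC t = radC P.A P.B (t ^ 2) := by
  simp [InitialData.axC, data, radialMatrix, kd, axisPt_zero_apply, rsq_axisPt, radC]
  ring

theorem axK_data (t : ℝ) : P.data.axK t = P.κ (t ^ 2) := by
  simp [InitialData.axK, data, radialMatrix, kd, axisPt_one_apply, rsq_axisPt]

theorem axD_data (t : ℝ) : P.data.axD t = P.A (t ^ 2) + t ^ 2 * deriv P.A (t ^ 2) := by
  have h1 := (differentiableAt_of_contDiffOn P.isOpen P.smooth_A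
    (P.mem_of_nonneg _ (sq_nonneg t))).hasDerivAt
  have h2 := (hasDerivAt_comp_sq h1).deriv
  rw [InitialData.axD, show P.data.axA = fun s => P.A (s ^ 2) from funext P.axA_data, h2]
  ring

theorem flux_data (t : ℝ) :
    P.data.flux P.data.E t = t ^ 3 * P.A (t ^ 2) * √(radC P.A P.B (t ^ 2)) * P.e (t ^ 2) := by
  rw [InitialData.flux, P.axA_data, P.axC_data]
  simp [data, field, axisPt_zero_apply, rsq_axisPt]
  ring

end Profiles

/-! ### A family of charged bodies -/

/-- A smooth monotone function that vanishes up to `a` and equals one from `b` on. -/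
def cutoff (a b v : ℝ) : ℝ := Real.smoothTransition ((v - a) / (b - a))

theorem contDiff_cutoff (a b : ℝ) : ContDiff ℝ ∞ (cutoff a b) :=
  Real.smoothTransition.contDiff.comp ((contDiff_id.sub contDiff_const).div_const _)

theorem cutoff_eq_zero {a b v : ℝ} (hab : a < b) (hv : v ≤ a) : cutoff a b v = 0 :=
  Real.smoothTransition.zero_of_nonpos
    (div_nonpos_of_nonpos_of_nonneg (by linarith) (by linarith))

theorem cutoff_eq_one {a b v : ℝ} (hab : a < b) (hv : b ≤ v) : cutoff a b v = 1 := by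
  apply Real.smoothTransition.one_of_one_le
  rw [le_div_iff₀ (by linarith)]
  linarith

theorem cutoff_nonneg (a b v : ℝ) : 0 ≤ cutoff a b v := Real.smoothTransition.nonneg _

theorem cutoff_le_one (a b v : ℝ) : cutoff a b v ≤ 1 := Real.smoothTransition.le_one _

theorem cutoff_mono {a b : ℝ} (hab : a < b) : Monotone (cutoff a b) := fun v w h =>
  Real.smoothTransition.monotone (div_le_div_of_nonneg_right (by linarith) (by linarith))

/-- The cutoff vanishes near 0 and so removes the singularity of f there, such as that of a negative
power of the radius. -/
theorem contDiff_cutoff_mul {a b : ℝ} (ha : 0 < a) (hab : a < b) {f : ℝ → ℝ}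
    (hf : ContDiffOn ℝ ∞ f (Set.Ioi 0)) : ContDiff ℝ ∞ (fun v => cutoff a b v * f v) := by
  rw [contDiff_iff_contDiffAt]
  intro v
  rcases lt_or_ge v a with hv | hv
  · refine (contDiffAt_const (c := (0 : ℝ))).congr_of_eventuallyEq ?_
    filter_upwards [gt_mem_nhds hv] with w hw
    rw [cutoff_eq_zero hab (le_of_lt hw), zero_mul]
  · exact (contDiff_cutoff a b).contDiffAt.mul
      (hf.contDiffAt (isOpen_Ioi.mem_nhds (ha.trans_le hv)))

theorem contDiffOn_inv_sqrt_pow (n : ℕ) :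
    ContDiffOn ℝ ∞ (fun v : ℝ => (√v)⁻¹ ^ n) (Set.Ioi 0) :=
  ((contDiffOn_id.sqrt fun _ hv => ne_of_gt hv).inv fun _ hv => (Real.sqrt_pos.2 hv).ne').pow n

/-- Parameters of a charged shell: charge `Q`, mass `M`, squared inner and outer area radii `α`
and `β`. The tangential eigenvalue of `K` is `κ₀` on the spheres with squared area radius below
`lam` and is cut off outside. For `ε = 0` the Cartesian radius is the area radius; for `ε > 0` the
area radii are bounded by `1 / √ε`. -/
structure ShellParams where
  ε : ℝ
  Q : ℝ
  M : ℝ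
  α : ℝ
  β : ℝ
  κ₀ : ℝ
  lam : ℝ
  ε_nonneg : 0 ≤ ε
  Q_ne_zero : Q ≠ 0
  α_pos : 0 < α
  α_lt_β : α < β
  lam_pos : 0 < lam
  -- Makes 2M - Q² / r non-negative from the inner edge on, as needed for its product with the
  -- cutoff to be monotone.
  mass_ge : Q ^ 2 ≤ 2 * M * √α
  -- The condition 1 - 2m / r + r² k² > 0 at the area radii that occur; the left-hand side is 2m /
  -- r. It makes the radial metric coefficient finite and positive.
  regular : ∀ v, α < v → ε * v < 1 →
    cutoff α β v * (2 * M / √v - Q ^ 2 / v) < 1 + v * (κ₀ * (1 - cutoff lam (2 * lam) v)) ^ 2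

namespace ShellParams

variable (p : ShellParams)

/-- The tangential eigenvalue of `K` as a function of the squared area radius. -/
def k (v : ℝ) : ℝ := p.κ₀ * (1 - cutoff p.lam (2 * p.lam) v)

/-- The metric function `2 m / r ^ 3 - k ^ 2` as a function of the squared area radius. -/
def g (v : ℝ) : ℝ :=
  cutoff p.α p.β v * (2 * p.M * (√v)⁻¹ ^ 3 - p.Q ^ 2 * (√v)⁻¹ ^ 4) - p.k v ^ 2

/-- The charge function `q / r ^ 3` as a function of the squared area radius. -/
def chargeDensity (v : ℝ) : ℝ := cutoff p.α p.β v * (p.Q * (√v)⁻¹ ^ 3)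

/-- The squared area radius as a function of the squared Cartesian radius. -/
def areaSq (u : ℝ) : ℝ := u * (1 + p.ε * u)⁻¹

theorem contDiff_k : ContDiff ℝ ∞ p.k :=
  contDiff_const.mul (contDiff_const.sub (contDiff_cutoff _ _))

theorem contDiff_deriv_k : ContDiff ℝ ∞ (deriv p.k) := by
  rw [← contDiffOn_univ]
  exact contDiffOn_deriv isOpen_univ p.contDiff_k.contDiffOn

theorem contDiff_g : ContDiff ℝ ∞ p.g :=
  (contDiff_cutoff_mul p.α_pos p.α_lt_β ((contDiffOn_const.mul (contDiffOn_inv_sqrt_pow 3)).sub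
    (contDiffOn_const.mul (contDiffOn_inv_sqrt_pow 4)))).sub (p.contDiff_k.pow 2)

theorem contDiff_chargeDensity : ContDiff ℝ ∞ p.chargeDensity :=
  contDiff_cutoff_mul p.α_pos p.α_lt_β (contDiffOn_const.mul (contDiffOn_inv_sqrt_pow 3))

theorem mul_g_eq {v : ℝ} (hv : 0 < v) :
    v * p.g v = cutoff p.α p.β v * (2 * p.M / √v - p.Q ^ 2 / v) - v * p.k v ^ 2 := by
  have hs := Real.sqrt_pos.2 hv
  have hss := Real.sq_sqrt hv.le
  rw [g]
  generalize √v = σ at *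
  rw [← hss]
  field_simp

theorem mul_g_lt_one {v : ℝ} (h0 : 0 ≤ v) (h1 : p.ε * v < 1) : v * p.g v < 1 := by
  rcases lt_or_ge p.α v with h | h
  · have := p.regular v h h1
    rw [p.mul_g_eq (p.α_pos.trans h), k]
    linarith
  · rw [g, cutoff_eq_zero p.α_lt_β h]
    nlinarith [mul_nonneg h0 (sq_nonneg (p.k v))]

/-- The domain of the profiles. -/
def dom : Set ℝ := {u | 0 < 1 + p.ε * u} ∩ p.areaSq ⁻¹' {v | v * p.g v < 1}

theorem contDiffOn_scale : ContDiffOn ℝ ∞ (fun u => (1 + p.ε * u)⁻¹) {u | 0 < 1 + p.ε * u} :=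
  (contDiffOn_const.add (contDiffOn_const.mul contDiffOn_id)).inv fun _ hu => ne_of_gt hu

theorem contDiffOn_areaSq : ContDiffOn ℝ ∞ p.areaSq {u | 0 < 1 + p.ε * u} :=
  contDiffOn_id.mul p.contDiffOn_scale

theorem isOpen_dom : IsOpen p.dom := by
  refine p.contDiffOn_areaSq.continuousOn.isOpen_inter_preimage ?_ ?_
  · exact isOpen_lt continuous_const (continuous_const.add (continuous_const.mul continuous_id))
  · exact isOpen_lt (continuous_id.mul p.contDiff_g.continuous) continuous_const

theorem scale_pos {u : ℝ} (hu : 0 ≤ u) : 0 < 1 + p.ε * u := by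
  have := mul_nonneg p.ε_nonneg hu
  linarith

theorem areaSq_nonneg {u : ℝ} (hu : 0 ≤ u) : 0 ≤ p.areaSq u :=
  mul_nonneg hu (inv_nonneg.2 (p.scale_pos hu).le)

theorem ε_mul_areaSq_lt {u : ℝ} (hu : 0 ≤ u) : p.ε * p.areaSq u < 1 := by
  have h := p.scale_pos hu
  rw [areaSq, ← div_eq_mul_inv, mul_div_assoc', div_lt_one h]
  linarith

theorem mem_dom {u : ℝ} (hu : 0 ≤ u) : u ∈ p.dom :=
  ⟨p.scale_pos hu, p.mul_g_lt_one (p.areaSq_nonneg hu) (p.ε_mul_areaSq_lt hu)⟩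

/-- The tangential eigenvalue of the metric. -/
def A (u : ℝ) : ℝ := (1 + p.ε * u)⁻¹

/-- The radial eigenvalue of the metric. -/
def C (u : ℝ) : ℝ := p.A u ^ 3 / (1 - p.areaSq u * p.g (p.areaSq u))

/-- The coefficient of `x xᵀ` in the metric. -/
def B (u : ℝ) : ℝ := p.A u ^ 3 * (p.A u * p.g (p.areaSq u)
  / (1 - p.areaSq u * p.g (p.areaSq u)) - 2 * p.ε - p.ε ^ 2 * u)

theorem A_pos {u : ℝ} (hu : u ∈ p.dom) : 0 < p.A u := inv_pos.2 hu.1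

theorem lapse_pos {u : ℝ} (hu : u ∈ p.dom) : 0 < 1 - p.areaSq u * p.g (p.areaSq u) :=
  sub_pos.2 hu.2

theorem C_pos {u : ℝ} (hu : u ∈ p.dom) : 0 < p.C u :=
  div_pos (pow_pos (p.A_pos hu) 3) (p.lapse_pos hu)

/-- `B` is (C - A) / u with the division carried out, which is why it is smooth at the centre. -/
theorem radC_eq {u : ℝ} (hu : u ∈ p.dom) : radC p.A p.B u = p.C u := by
  have h1 := (p.lapse_pos hu).ne'
  have h2 : 1 + p.ε * u ≠ 0 := ne_of_gt hu.1
  rw [radC, C, B]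
  have h3 : p.areaSq u = u * p.A u := rfl
  have h4 : p.A u * (1 + p.ε * u) = 1 := inv_mul_cancel₀ h2
  generalize p.g (p.areaSq u) = γ at *
  rw [h3] at *
  have h5 : p.A u = p.A u ^ 3 * (1 + p.ε * u) ^ 2 := by
    linear_combination (-p.A u - p.A u ^ 2 * (1 + p.ε * u)) * h4
  generalize p.A u = a at *
  have h6 : a + u * (a ^ 3 * (a * γ / (1 - u * a * γ) - 2 * p.ε - p.ε ^ 2 * u)) =
      a ^ 3 * (1 + p.ε * u) ^ 2 + u * (a ^ 3 * (a * γ / (1 - u * a * γ) - 2 * p.ε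
        - p.ε ^ 2 * u)) := by rw [← h5]
  rw [h6]
  obtain ⟨L, hL⟩ : ∃ L, L = 1 - u * a * γ := ⟨_, rfl⟩
  rw [← hL] at h1 ⊢
  field_simp
  rw [hL]
  ring

theorem hasDerivAt_A {u : ℝ} (hu : u ∈ p.dom) : HasDerivAt p.A (-p.ε * p.A u ^ 2) u := by
  have h2 : 1 + p.ε * u ≠ 0 := ne_of_gt hu.1
  have h : HasDerivAt (fun u => 1 + p.ε * u) p.ε u := by
    simpa using ((hasDerivAt_id u).const_mul p.ε).const_add 1
  refine (h.inv h2).congr_deriv ?_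
  rw [A]
  field_simp

theorem area_deriv {u : ℝ} (hu : u ∈ p.dom) : p.A u + u * deriv p.A u = p.A u ^ 2 := by
  have h2 : 1 + p.ε * u ≠ 0 := ne_of_gt hu.1
  have h4 : p.A u * (1 + p.ε * u) = 1 := inv_mul_cancel₀ h2
  rw [(p.hasDerivAt_A hu).deriv]
  linear_combination (-p.A u) * h4

theorem hasDerivAt_areaSq {u : ℝ} (hu : u ∈ p.dom) : HasDerivAt p.areaSq (p.A u ^ 2) u := by
  refine ((hasDerivAt_id u).mul (p.hasDerivAt_A hu)).congr_deriv ?_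
  have h := p.area_deriv hu
  rw [(p.hasDerivAt_A hu).deriv] at h
  simpa using h

theorem contDiffOn_A : ContDiffOn ℝ ∞ p.A p.dom := p.contDiffOn_scale.mono Set.inter_subset_left

theorem contDiffOn_comp_areaSq {f : ℝ → ℝ} (hf : ContDiff ℝ ∞ f) :
    ContDiffOn ℝ ∞ (fun u => f (p.areaSq u)) p.dom :=
  hf.comp_contDiffOn (p.contDiffOn_areaSq.mono Set.inter_subset_left)

theorem contDiffOn_lapse :
    ContDiffOn ℝ ∞ (fun u => 1 - p.areaSq u * p.g (p.areaSq u)) p.dom :=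
  contDiffOn_const.sub (p.contDiffOn_comp_areaSq (contDiff_id.mul p.contDiff_g))

theorem contDiffOn_C : ContDiffOn ℝ ∞ p.C p.dom :=
  (p.contDiffOn_A.pow 3).div p.contDiffOn_lapse fun _ hu => (p.lapse_pos hu).ne'

theorem contDiffOn_B : ContDiffOn ℝ ∞ p.B p.dom :=
  (p.contDiffOn_A.pow 3).mul (((((p.contDiffOn_A.mul (p.contDiffOn_comp_areaSq p.contDiff_g)).div
    p.contDiffOn_lapse fun _ hu => (p.lapse_pos hu).ne')).sub contDiffOn_const).sub
      (contDiffOn_const.mul contDiffOn_id))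

/-- The radial profiles of the shell. -/
def profiles : Profiles where
  U := p.dom
  A := p.A
  B := p.B
  κ := fun u => p.A u * p.k (p.areaSq u)
  -- Chosen so that the radial eigenvalue of K is k + 2 v k'(v) = d(r k)/dr with v = r², as the
  -- momentum constraint with j = 0 demands.
  l := fun u => p.B u * p.k (p.areaSq u) + 2 * p.A u * p.C u * deriv p.k (p.areaSq u)
  e := fun u => p.chargeDensity (p.areaSq u) * (1 + p.ε * u)
    * √(1 - p.areaSq u * p.g (p.areaSq u))
  isOpen := p.isOpen_dom
  mem_of_nonneg := fun _ hu => p.mem_dom hu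
  smooth_A := p.contDiffOn_A
  smooth_B := p.contDiffOn_B
  smooth_κ := p.contDiffOn_A.mul (p.contDiffOn_comp_areaSq p.contDiff_k)
  smooth_l := (p.contDiffOn_B.mul (p.contDiffOn_comp_areaSq p.contDiff_k)).add
    (((contDiffOn_const.mul p.contDiffOn_A).mul p.contDiffOn_C).mul
      (p.contDiffOn_comp_areaSq p.contDiff_deriv_k))
  smooth_e := ((p.contDiffOn_comp_areaSq p.contDiff_chargeDensity).mul
    (contDiffOn_const.add (contDiffOn_const.mul contDiffOn_id))).mul
      (p.contDiffOn_lapse.sqrt fun _ hu => (p.lapse_pos hu).ne')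
  pos_A := fun _ hu => p.A_pos hu
  pos_C := fun u hu => by
    have h := p.radC_eq hu
    rw [radC] at h
    rw [h]
    exact p.C_pos hu
  momentum := fun u hu0 => by
    have hu := p.mem_dom hu0.le
    have hA := (p.A_pos hu).ne'
    have hC := (p.C_pos hu).ne'
    have h1 : (fun u => p.A u * p.k (p.areaSq u) / p.A u) =ᶠ[𝓝 u] fun u => p.k (p.areaSq u) := by
      filter_upwards [p.isOpen_dom.mem_nhds hu] with y hy
      rw [mul_div_cancel_left₀ _ (p.A_pos hy).ne']
    have h2 : HasDerivAt (fun u => p.k (p.areaSq u)) (deriv p.k (p.areaSq u) * p.A u ^ 2) u :=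
      HasDerivAt.comp (h₂ := p.k) u
        (p.contDiff_k.differentiable (by simp) (p.areaSq u)).hasDerivAt (p.hasDerivAt_areaSq hu)
    have h3 : p.A u * p.k (p.areaSq u) + u * (p.B u * p.k (p.areaSq u)
        + 2 * p.A u * p.C u * deriv p.k (p.areaSq u)) =
        p.C u * (p.k (p.areaSq u) + 2 * u * p.A u * deriv p.k (p.areaSq u)) := by
      rw [← p.radC_eq hu, radC]
      ring
    rw [h1.deriv_eq, h2.deriv, p.area_deriv hu, p.radC_eq hu, h3]
    field_simp
    ring

end ShellParams

/-! ### Mass, charge, energy density and null expansions of the shells. -/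

namespace ShellParams

variable (p : ShellParams)

/-- The initial data set of the shell. -/
def data : InitialData := p.profiles.data

theorem spherical : p.data.SphericallySymmetric := p.profiles.sphericallySymmetric

theorem axA_eq (t : ℝ) : p.data.axA t = p.A (t ^ 2) := p.profiles.axA_data t

theorem axC_eq (t : ℝ) : p.data.axC t = p.C (t ^ 2) :=
  (p.profiles.axC_data t).trans (p.radC_eq (p.mem_dom (sq_nonneg t)))

theorem axK_eq (t : ℝ) : p.data.axK t = p.A (t ^ 2) * p.k (p.areaSq (t ^ 2)) :=
  p.profiles.axK_data t

theorem axD_eq (t : ℝ) : p.data.axD t = p.A (t ^ 2) ^ 2 :=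
  (p.profiles.axD_data t).trans (p.area_deriv (p.mem_dom (sq_nonneg t)))

theorem areaSq_pos {t : ℝ} (ht : 0 < t) : 0 < p.areaSq (t ^ 2) :=
  mul_pos (pow_pos ht 2) (p.A_pos (p.mem_dom (sq_nonneg t)))

theorem radius_eq {t : ℝ} (ht : 0 ≤ t) : t * √(p.data.axA t) = √(p.areaSq (t ^ 2)) := by
  rw [axA_eq, show p.areaSq (t ^ 2) = t ^ 2 * p.A (t ^ 2) from rfl, Real.sqrt_mul (sq_nonneg t),
    Real.sqrt_sq ht]

theorem areaRadius_eq {t : ℝ} (ht : 0 < t) : p.data.areaRadius t = √(p.areaSq (t ^ 2)) := by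
  rw [p.spherical.areaRadius_eq ht, p.radius_eq ht.le]

/-- Twice the Misner-Sharp mass as a function of the squared area radius. -/
def massFn (v : ℝ) : ℝ := cutoff p.α p.β v * (2 * p.M - p.Q ^ 2 / √v)

/-- `C` was chosen so that D² / (AC) = 1 - v g, that is, r'² = 1 - 2m / r + r² k²; in the
Misner–Sharp mass the terms in k then cancel. -/
theorem misnerSharp_eq {t : ℝ} (ht : 0 < t) :
    p.data.misnerSharp t = p.massFn (p.areaSq (t ^ 2)) := by
  have hu := p.mem_dom (sq_nonneg t)
  have hA := p.A_pos hu
  have hL := p.lapse_pos hu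
  have hv := p.areaSq_pos ht
  have hs := Real.sqrt_pos.2 hv
  have hg := p.mul_g_eq hv
  have hss := Real.sq_sqrt hv.le
  rw [InitialData.misnerSharp, p.radius_eq ht.le, axD_eq, axA_eq, axC_eq, axK_eq, C, massFn]
  have h1 : 1 - (p.A (t ^ 2) ^ 2) ^ 2 / (p.A (t ^ 2) * (p.A (t ^ 2) ^ 3
      / (1 - p.areaSq (t ^ 2) * p.g (p.areaSq (t ^ 2)))))
      + t ^ 2 * (p.A (t ^ 2) * p.k (p.areaSq (t ^ 2))) ^ 2 / p.A (t ^ 2) =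
      p.areaSq (t ^ 2) * p.g (p.areaSq (t ^ 2))
        + (t ^ 2 * p.A (t ^ 2)) * p.k (p.areaSq (t ^ 2)) ^ 2 := by
    field_simp
    ring
  rw [h1, show t ^ 2 * p.A (t ^ 2) = p.areaSq (t ^ 2) from rfl, hg]
  generalize √(p.areaSq (t ^ 2)) = σ at *
  rw [← hss]
  field_simp
  ring

theorem flux_eq {t : ℝ} (ht : 0 < t) :
    p.data.flux p.data.E t = p.Q * cutoff p.α p.β (p.areaSq (t ^ 2)) := by
  have hu := p.mem_dom (sq_nonneg t)
  have hA := p.A_pos hu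
  have hL := p.lapse_pos hu
  have hv := p.areaSq_pos ht
  refine (p.profiles.flux_data t).trans ?_
  have hC : radC p.profiles.A p.profiles.B (t ^ 2) = p.C (t ^ 2) := p.radC_eq hu
  have hA' : 1 + p.ε * t ^ 2 = (p.A (t ^ 2))⁻¹ := (inv_inv _).symm
  rw [hC]
  change t ^ 3 * p.A (t ^ 2) * √(p.C (t ^ 2)) * (p.chargeDensity (p.areaSq (t ^ 2))
    * (1 + p.ε * t ^ 2) * √(1 - p.areaSq (t ^ 2) * p.g (p.areaSq (t ^ 2)))) = _
  have h1 : √(p.areaSq (t ^ 2)) = t * √(p.A (t ^ 2)) := by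
    rw [← p.radius_eq ht.le, axA_eq]
  rw [C, chargeDensity, hA', h1]
  generalize cutoff p.α p.β (p.areaSq (t ^ 2)) = c
  generalize 1 - p.areaSq (t ^ 2) * p.g (p.areaSq (t ^ 2)) = L at *
  rw [Real.sqrt_div (by positivity), show p.A (t ^ 2) ^ 3 = p.A (t ^ 2) ^ 2 * p.A (t ^ 2) by ring,
    Real.sqrt_mul (by positivity), Real.sqrt_sq hA.le]
  have hsA := Real.sqrt_pos.2 hA
  have hsL := Real.sqrt_pos.2 hL
  have hss := Real.sq_sqrt hA.le
  generalize √(p.A (t ^ 2)) = σ at *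
  rw [← hss]
  field_simp

theorem areaSq_strictMonoOn : StrictMonoOn p.areaSq (Set.Ici 0) := by
  intro a ha b hb hab
  have h1 := p.scale_pos ha
  have h2 := p.scale_pos hb
  simp only [areaSq, ← div_eq_mul_inv]
  rw [div_lt_div_iff₀ h1 h2]
  nlinarith

theorem areaSq_sq_lt {a b : ℝ} (ha : 0 ≤ a) (hab : a < b) :
    p.areaSq (a ^ 2) < p.areaSq (b ^ 2) :=
  p.areaSq_strictMonoOn (sq_nonneg a) (sq_nonneg b) (by nlinarith)

theorem mass_pos : 0 < p.M := by
  have h1 : 0 < p.Q ^ 2 := by have := p.Q_ne_zero; positivity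
  have h2 := p.mass_ge
  have h3 := Real.sqrt_pos.2 p.α_pos
  by_contra! h
  nlinarith

theorem massFn_bracket_nonneg {v : ℝ} (hv : p.α ≤ v) : 0 ≤ 2 * p.M - p.Q ^ 2 / √v := by
  have h1 := Real.sqrt_pos.2 (p.α_pos.trans_le hv)
  have h2 := Real.sqrt_le_sqrt hv
  have h3 := p.mass_pos
  have h4 := p.mass_ge
  rw [sub_nonneg, div_le_iff₀ h1]
  nlinarith

/-- Zero below the inner edge, and beyond it a product of two non-negative non-decreasing factors.
Monotonicity is what gives the energy condition. -/
theorem massFn_monotone : Monotone p.massFn := by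
  intro v w hvw
  rcases le_total w p.α with hw | hw
  · rw [massFn, massFn, cutoff_eq_zero p.α_lt_β hw, cutoff_eq_zero p.α_lt_β (hvw.trans hw)]
    simp
  · rcases le_total v p.α with hv | hv
    · rw [massFn, cutoff_eq_zero p.α_lt_β hv, zero_mul]
      exact mul_nonneg (cutoff_nonneg _ _ _) (p.massFn_bracket_nonneg hw)
    · refine mul_le_mul (cutoff_mono p.α_lt_β hvw) ?_ (p.massFn_bracket_nonneg hv)
        (cutoff_nonneg _ _ _)
      have h1 := Real.sqrt_pos.2 (p.α_pos.trans_le hv)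
      have h2 := Real.sqrt_le_sqrt hvw
      have := div_le_div_of_nonneg_left (sq_nonneg p.Q) h1 h2
      linarith

theorem hasDerivAt_misnerSharp {t : ℝ} (ht : 0 < t) :
    HasDerivAt p.data.misnerSharp (8 * Real.pi * t * √(p.areaSq (t ^ 2))
      * (p.data.μ (axisPt t) * p.A (t ^ 2) ^ 2)) t := by
  have h := p.spherical.hasDerivAt_misnerSharp ht
  have hj : p.data.j (axisPt t) 0 = 0 := rfl
  rwa [hj, p.radius_eq ht.le, axD_eq, mul_zero, zero_mul, add_zero] at h

theorem density_factor_pos {t : ℝ} (ht : 0 < t) :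
    0 < 8 * Real.pi * t * √(p.areaSq (t ^ 2)) * p.A (t ^ 2) ^ 2 := by
  have h1 := Real.sqrt_pos.2 (p.areaSq_pos ht)
  have h2 := p.A_pos (p.mem_dom (sq_nonneg t))
  positivity

/-- With j = 0 the derivative of the mass is μ times a positive factor, because the area radius
increases with t; a monotone mass therefore forces μ ≥ 0. -/
theorem density_axis_nonneg {t : ℝ} (ht : 0 < t) : 0 ≤ p.data.μ (axisPt t) := by
  have hd := p.hasDerivAt_misnerSharp ht
  have hmono : MonotoneOn p.data.misnerSharp (Set.Ioi 0) := by
    intro a ha b hb hab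
    rw [p.misnerSharp_eq ha, p.misnerSharp_eq hb]
    apply p.massFn_monotone
    exact p.areaSq_strictMonoOn.monotoneOn (sq_nonneg a) (sq_nonneg b)
      (pow_le_pow_left₀ (le_of_lt ha) hab 2)
  have h1 : 0 ≤ derivWithin p.data.misnerSharp (Set.Ioi 0) t := hmono.derivWithin_nonneg
  rw [derivWithin_of_isOpen isOpen_Ioi ht, hd.deriv] at h1
  have h2 := p.density_factor_pos ht
  have h3 : 0 ≤ (8 * Real.pi * t * √(p.areaSq (t ^ 2)) * p.A (t ^ 2) ^ 2)
      * p.data.μ (axisPt t) := by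
    refine h1.trans_eq ?_
    ring
  exact nonneg_of_mul_nonneg_right h3 h2

theorem eq_of_eq_on_Ioo {f : ℝ → ℝ} (hf : Continuous f) {a c : ℝ} (ha : 0 < a)
    (h : ∀ t, 0 < t → t < a → f t = c) : f 0 = c := by
  have h1 : Tendsto f (𝓝[>] 0) (𝓝 (f 0)) := hf.continuousAt.tendsto.mono_left nhdsWithin_le_nhds
  have h2 : Tendsto f (𝓝[>] 0) (𝓝 c) := by
    refine tendsto_const_nhds.congr' ?_
    filter_upwards [Ioo_mem_nhdsGT ha] with t ht
    exact (h t ht.1 ht.2).symm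
  exact tendsto_nhds_unique h1 h2

theorem density_nonneg (x : E3) : 0 ≤ p.data.μ x := by
  rw [invariant_scalar_eq p.spherical.μ_inv x]
  rcases (norm_nonneg x).eq_or_lt with h | h
  · rw [← h]
    have hc : Continuous fun t => p.data.μ (axisPt t) :=
      p.data.smooth_μ.continuous.comp contDiff_axisPt.continuous
    refine ge_of_tendsto (hc.continuousAt.tendsto.mono_left nhdsWithin_le_nhds :
      Tendsto (fun t => p.data.μ (axisPt t)) (𝓝[>] 0) (𝓝 (p.data.μ (axisPt 0)))) ?_
    filter_upwards [self_mem_nhdsWithin] with t ht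
    exact p.density_axis_nonneg ht
  · exact p.density_axis_nonneg h

theorem density_axis_eq {t m : ℝ} (ht : 0 < t) (hm : HasDerivAt p.data.misnerSharp m t) :
    p.data.μ (axisPt t) = m / (8 * Real.pi * t * √(p.areaSq (t ^ 2)) * p.A (t ^ 2) ^ 2) := by
  rw [eq_div_iff (p.density_factor_pos ht).ne', (p.hasDerivAt_misnerSharp ht).unique hm |>.symm]
  ring

theorem charge_density_axis_eq_zero {t : ℝ} (ht : 0 < t)
    (h : HasDerivAt (p.data.flux p.data.E) 0 t) : p.data.ρ (axisPt t) = 0 := by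
  have h1 := (p.spherical.hasDerivAt_flux p.spherical.radialVector_E ht).unique h
  rw [p.data.gauss_E] at h1
  have hA := p.data.axA_pos t
  have hC := Real.sqrt_pos.2 (p.data.axC_pos t)
  have h2 : t ^ 2 * (p.data.axA t * √(p.data.axC t)) ≠ 0 := by positivity
  have h3 := (mul_eq_zero.1 h1).resolve_left h2
  have := Real.pi_pos
  exact (mul_eq_zero.1 h3).resolve_left (by positivity)

theorem interior_axis {a t : ℝ} (ha : p.areaSq (a ^ 2) = p.α) (ht : 0 < t) (hta : t < a) :
    p.data.μ (axisPt t) = 0 ∧ p.data.ρ (axisPt t) = 0 := by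
  have hev : ∀ᶠ y in 𝓝 t, 0 < y ∧ cutoff p.α p.β (p.areaSq (y ^ 2)) = 0 := by
    filter_upwards [Ioo_mem_nhds ht hta] with y hy
    exact ⟨hy.1, cutoff_eq_zero p.α_lt_β (ha ▸ (p.areaSq_sq_lt hy.1.le hy.2).le)⟩
  constructor
  · rw [p.density_axis_eq ht (m := 0), zero_div]
    refine (hasDerivAt_const t (0 : ℝ)).congr_of_eventuallyEq ?_
    filter_upwards [hev] with y hy
    rw [p.misnerSharp_eq hy.1, massFn, hy.2, zero_mul]
  · apply p.charge_density_axis_eq_zero ht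
    refine (hasDerivAt_const t (0 : ℝ)).congr_of_eventuallyEq ?_
    filter_upwards [hev] with y hy
    rw [p.flux_eq hy.1, hy.2, mul_zero]

theorem interior {a : ℝ} (ha0 : 0 < a) (ha : p.areaSq (a ^ 2) = p.α) {x : E3} (hx : ‖x‖ < a) :
    p.data.μ x = 0 ∧ p.data.ρ x = 0 := by
  rw [invariant_scalar_eq p.spherical.μ_inv x, invariant_scalar_eq p.spherical.ρ_inv x]
  rcases (norm_nonneg x).eq_or_lt with h | h
  · rw [← h]
    exact ⟨eq_of_eq_on_Ioo (p.data.smooth_μ.continuous.comp contDiff_axisPt.continuous) ha0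
        fun t h0 h1 => (p.interior_axis ha h0 h1).1,
      eq_of_eq_on_Ioo (p.data.smooth_ρ.continuous.comp contDiff_axisPt.continuous) ha0
        fun t h0 h1 => (p.interior_axis ha h0 h1).2⟩
  · exact p.interior_axis ha h hx

theorem exterior_cutoff {s t : ℝ} (hs : 0 < s) (hβ : p.areaSq (s ^ 2) = p.β) (ht : s ≤ t) :
    cutoff p.α p.β (p.areaSq (t ^ 2)) = 1 := by
  refine cutoff_eq_one p.α_lt_β ?_
  rw [← hβ]
  exact p.areaSq_strictMonoOn.monotoneOn (sq_nonneg s) (sq_nonneg t) (pow_le_pow_left₀ hs.le ht 2)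

theorem exterior_density {s t : ℝ} (hs : 0 < s) (hβ : p.areaSq (s ^ 2) = p.β) (ht : s < t) :
    p.data.μ (axisPt t) = p.Q ^ 2 / (8 * Real.pi * p.areaSq (t ^ 2) ^ 2) := by
  have ht0 : 0 < t := hs.trans ht
  have hA := p.A_pos (p.mem_dom (sq_nonneg t))
  have hsA := Real.sqrt_pos.2 hA
  have hss := Real.sq_sqrt hA.le
  have hpi := Real.pi_ne_zero
  have hd := ((hasDerivAt_const t (p.Q ^ 2)).div (p.data.hasDerivAt_radius t)
    (by rw [axA_eq]; positivity)).const_sub (2 * p.M)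
  have hev : p.data.misnerSharp =ᶠ[𝓝 t] fun y => 2 * p.M - p.Q ^ 2 / (y * √(p.data.axA y)) := by
    filter_upwards [lt_mem_nhds ht] with y hy
    rw [p.misnerSharp_eq (hs.trans hy), massFn, p.exterior_cutoff hs hβ (le_of_lt hy), one_mul,
      p.radius_eq (hs.trans hy).le]
  rw [p.density_axis_eq ht0 (hd.congr_of_eventuallyEq hev), axD_eq, axA_eq, ← p.radius_eq ht0.le,
    axA_eq, show p.areaSq (t ^ 2) = t ^ 2 * p.A (t ^ 2) from rfl]
  generalize √(p.A (t ^ 2)) = σ at *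
  rw [← hss]
  field_simp
  ring

theorem vecNormSq_E_axis {s t : ℝ} (hs : 0 < s) (hβ : p.areaSq (s ^ 2) = p.β) (ht : s ≤ t) :
    vecNormSq p.data.h p.data.E (axisPt t) = p.Q ^ 2 / p.areaSq (t ^ 2) ^ 2 := by
  have ht0 : 0 < t := hs.trans_le ht
  have hf := p.flux_eq ht0
  rw [p.exterior_cutoff hs hβ ht, mul_one, InitialData.flux] at hf
  rw [InitialData.vecNormSq_axis p.spherical p.spherical.radialVector_E ht0, ← hf,
    show p.areaSq (t ^ 2) = t ^ 2 * p.A (t ^ 2) from rfl, ← axA_eq, mul_pow, mul_pow,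
    Real.sq_sqrt (p.data.axC_pos t).le]
  have hA := p.data.axA_pos t
  field_simp

theorem charge_eq {s : ℝ} (hs : 0 < s) (hβ : p.areaSq (s ^ 2) = p.β) : p.data.charge s = p.Q := by
  rw [p.spherical.charge_eq_flux hs.le, p.flux_eq hs, p.exterior_cutoff hs hβ le_rfl, mul_one]

theorem chargedBody {s : ℝ} (hs : 0 < s) (hβ : p.areaSq (s ^ 2) = p.β) :
    p.data.ChargedBody s where
  pos := hs
  spherical := p.spherical
  dominant := fun x _ => by
    have : vecNormSq p.data.h p.data.j x = 0 := by
      simp [vecNormSq, data, Profiles.data]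
    rw [this, Real.sqrt_zero]
    exact p.density_nonneg x
  electrovacuum := fun x hx => by
    have hx' : s < ‖x‖ := by simpa using hx
    have hx0 : 0 < ‖x‖ := hs.trans hx'
    have hne : x ≠ 0 := norm_pos_iff.1 hx0
    have hB : vecNormSq p.data.h p.data.B x = 0 := by
      simp [vecNormSq, data, Profiles.data]
    have hE : vecNormSq p.data.h p.data.E x = vecNormSq p.data.h p.data.E (axisPt ‖x‖) := by
      have H := p.spherical.radialMetric
      have W := p.spherical.radialVector_E
      have h1 : rsq x ∈ Set.Ioi (0 : ℝ) := rsq_pos_iff.2 hne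
      have h2 : rsq (axisPt ‖x‖) = rsq x := by rw [rsq_axisPt, rsq_eq_norm_sq]
      have h3 : rsq (axisPt ‖x‖) ∈ Set.Ioi (0 : ℝ) := h2 ▸ h1
      rw [H.vecNormSq_eq h1 (W.eq _ h1), H.vecNormSq_eq h3 (W.eq _ h3), h2]
    refine ⟨?_, rfl, ?_⟩
    · rw [InitialData.matterDensity, hB, hE, p.vecNormSq_E_axis hs hβ hx'.le,
        invariant_scalar_eq p.spherical.μ_inv x, p.exterior_density hs hβ hx']
      have := p.areaSq_pos hx0
      have := Real.pi_ne_zero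
      field_simp
      ring
    · rw [invariant_scalar_eq p.spherical.ρ_inv x]
      apply p.charge_density_axis_eq_zero hx0
      refine (hasDerivAt_const ‖x‖ p.Q).congr_of_eventuallyEq ?_
      filter_upwards [lt_mem_nhds hx'] with y hy
      rw [p.flux_eq (hs.trans hy), p.exterior_cutoff hs hβ (le_of_lt hy), mul_one]
  charge_ne_zero := by
    rw [p.charge_eq hs hβ]
    exact p.Q_ne_zero

theorem theta_mul_theta {s : ℝ} (hs : 0 < s) (hβ : p.areaSq (s ^ 2) = p.β) {x : E3}
    (hx : s ≤ ‖x‖) :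
    p.data.thetaPlus x * p.data.thetaMinus x = 4 / √(p.areaSq (‖x‖ ^ 2)) ^ 4
      * (√(p.areaSq (‖x‖ ^ 2)) ^ 2 - 2 * p.M * √(p.areaSq (‖x‖ ^ 2)) + p.Q ^ 2) := by
  have hx0 : 0 < ‖x‖ := hs.trans_le hx
  have h1 := Real.sqrt_pos.2 (p.areaSq_pos hx0)
  rw [p.spherical.theta_mul_theta_misnerSharp hx0, p.radius_eq hx0.le, p.misnerSharp_eq hx0, massFn,
    p.exterior_cutoff hs hβ hx]
  generalize √(p.areaSq (‖x‖ ^ 2)) = r at *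
  field_simp
  ring

theorem exteriorMass_eq {s : ℝ} (hs : 0 < s) (hβ : p.areaSq (s ^ 2) = p.β) :
    InitialData.ChargedBody.exteriorMass p.data s = 2 * p.M := by
  rw [InitialData.ChargedBody.exteriorMass, p.charge_eq hs hβ, p.misnerSharp_eq hs, massFn,
    p.exterior_cutoff hs hβ le_rfl, p.radius_eq hs.le]
  ring

end ShellParams

open Bornology

/-! ### Asymptotic flatness of the shells -/

/-- Near infinity, `F u` is `u ^ (-n / 2)` times a smooth function of `u ^ (-1 / 2)`. -/
def DecaysAt (n : ℕ) (F : ℝ → ℝ) : Prop :=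
  ∃ (φ : ℝ → ℝ) (V : Set ℝ), IsOpen V ∧ (0 : ℝ) ∈ V ∧ ContDiffOn ℝ ∞ φ V ∧
    ∀ᶠ u in atTop, F u = (√u)⁻¹ ^ n * φ (√u)⁻¹

theorem tendsto_inv_sqrt : Tendsto (fun u : ℝ => (√u)⁻¹) atTop (𝓝 0) :=
  tendsto_inv_atTop_zero.comp Real.tendsto_sqrt_atTop

theorem DecaysAt.deriv {n : ℕ} {F : ℝ → ℝ} (h : DecaysAt (n + 1) F) :
    DecaysAt (n + 3) (deriv F) := by
  obtain ⟨φ, V, hV, h0, hφ, hF⟩ := h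
  -- For τ = u ^ (-1 / 2) one has dτ/du = -τ³ / 2, so a derivative in u gains two powers of τ.
  -- Starting from n + 1 avoids a natural-number subtraction.
  refine ⟨fun τ => -1 / 2 * ((n + 1) * φ τ + τ * _root_.deriv φ τ), V, hV, h0, ?_, ?_⟩
  · exact contDiffOn_const.mul ((contDiffOn_const.mul hφ).add
      (contDiffOn_id.mul (contDiffOn_deriv hV hφ)))
  · obtain ⟨N, hN⟩ := eventually_atTop.1 hF
    filter_upwards [eventually_gt_atTop N, eventually_gt_atTop 0,
      tendsto_inv_sqrt.eventually (hV.mem_nhds h0)] with u hu hu0 huV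
    have hs := Real.sqrt_pos.2 hu0
    have h1 : HasDerivAt (fun u : ℝ => (√u)⁻¹) (-(1 / (2 * √u)) / √u ^ 2) u :=
      ((Real.hasDerivAt_sqrt hu0.ne').fun_inv hs.ne').congr_deriv rfl
    have h2 := (differentiableAt_of_contDiffOn hV hφ huV).hasDerivAt
    have h3 : HasDerivAt (fun u => (√u)⁻¹ ^ (n + 1) * φ (√u)⁻¹) _ u :=
      (h1.fun_pow (n + 1)).mul (HasDerivAt.comp (h₂ := φ) u h2 h1)
    have h4 : F =ᶠ[𝓝 u] fun u => (√u)⁻¹ ^ (n + 1) * φ (√u)⁻¹ := by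
      filter_upwards [lt_mem_nhds hu] with y hy
      exact hN y (le_of_lt hy)
    rw [h4.deriv_eq, h3.deriv]
    generalize φ (√u)⁻¹ = a
    generalize _root_.deriv φ (√u)⁻¹ = b
    have h5 : -(1 / (2 * √u)) / √u ^ 2 = -1 / 2 * (√u)⁻¹ ^ 3 := by field_simp
    rw [h5]
    generalize (√u)⁻¹ = τ
    push_cast
    ring

theorem DecaysAt.isBigO {n : ℕ} {F : ℝ → ℝ} (h : DecaysAt n F) :
    (fun x : E3 => F (rsq x)) =O[cobounded E3] fun x => (‖x‖ ^ n)⁻¹ := by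
  obtain ⟨φ, V, hV, h0, hφ, hF⟩ := h
  have hrsq : Tendsto rsq (cobounded E3) atTop := by
    simp only [funext rsq_eq_norm_sq]
    exact (tendsto_pow_atTop two_ne_zero).comp tendsto_norm_cobounded_atTop
  have hb : (fun x : E3 => φ (√(rsq x))⁻¹) =O[cobounded E3] fun _ => (1 : ℝ) :=
    (((hφ.continuousOn.continuousAt (hV.mem_nhds h0)).tendsto.comp tendsto_inv_sqrt).comp
      hrsq).isBigO_one ℝ
  have hn := (isBigO_refl (fun x : E3 => (‖x‖ ^ n)⁻¹) (cobounded E3)).mul hb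
  simp only [mul_one] at hn
  refine hn.congr' ?_ EventuallyEq.rfl
  filter_upwards [hrsq.eventually hF] with x hx
  rw [hx, sqrt_rsq, inv_pow]

theorem isBigO_coord (a : Fin 3) : (fun x : E3 => x a) =O[cobounded E3] fun x => ‖x‖ ^ 1 := by
  refine IsBigO.of_bound 1 (Eventually.of_forall fun x => ?_)
  simpa using PiLp.norm_apply_le x a

theorem isBigO_mul_pow {f g : E3 → ℝ} {n m k : ℕ} (hf : f =O[cobounded E3] fun x => (‖x‖ ^ n)⁻¹)
    (hg : g =O[cobounded E3] fun x => ‖x‖ ^ m) (hn : n = m + k) :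
    (fun x => f x * g x) =O[cobounded E3] fun x => (‖x‖ ^ k)⁻¹ := by
  refine (hf.mul hg).congr' EventuallyEq.rfl ?_
  filter_upwards [tendsto_norm_cobounded_atTop.eventually (eventually_gt_atTop 0)] with x hx
  rw [hn, pow_add]
  field_simp

theorem isBigO_pow_mul {f g : E3 → ℝ} {n m : ℕ} (hf : f =O[cobounded E3] fun x => ‖x‖ ^ n)
    (hg : g =O[cobounded E3] fun x => ‖x‖ ^ m) :
    (fun x => f x * g x) =O[cobounded E3] fun x => ‖x‖ ^ (n + m) := by
  simpa only [pow_add] using hf.mul hg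

/-- The deviation from δ is B x xᵀ of order |x|⁻³ |x|². A derivative either removes a coordinate
factor or replaces B by 2 x_k B', gaining one power of |x|⁻¹ in both cases. -/
theorem RadialMetric.isBigO_metric {h : E3 → Matrix (Fin 3) (Fin 3) ℝ} {U : Set ℝ} {A B : ℝ → ℝ}
    (H : RadialMetric h U A B) (hU : ∀ u, 0 ≤ u → u ∈ U) (hA : ∀ u ∈ U, A u = 1)
    (hB : DecaysAt 3 B) :
    (∀ a b, (fun x => h x a b - (1 : Matrix (Fin 3) (Fin 3) ℝ) a b)
      =O[cobounded E3] (fun x => ‖x‖⁻¹)) ∧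
    (∀ a b k, (fun x => pd k (fun y => h y a b) x) =O[cobounded E3] (fun x => (‖x‖ ^ 2)⁻¹)) ∧
    (∀ a b k l, (fun x => pd l (pd k (fun y => h y a b)) x)
      =O[cobounded E3] (fun x => (‖x‖ ^ 3)⁻¹)) := by
  have hmem : ∀ x : E3, rsq x ∈ U := fun x => hU _ (rsq_nonneg x)
  have hA' : ∀ u ∈ U, deriv A u = 0 := fun u hu => by
    have : A =ᶠ[𝓝 u] fun _ => 1 := by
      filter_upwards [H.isOpen.mem_nhds hu] with y hy
      exact hA y hy
    rw [this.deriv_eq, deriv_const]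
  have b0 := hB.isBigO
  have b1 := hB.deriv.isBigO
  have b2 := hB.deriv.deriv.isBigO
  have c1 := isBigO_coord
  have c2 := fun a b => isBigO_pow_mul (c1 a) (c1 b)
  have c3 := fun a b c => isBigO_pow_mul (c1 a) (c2 b c)
  have c4 := fun a b c d => isBigO_pow_mul (c1 a) (c3 b c d)
  have e1 : ∀ a b k, pd k (fun y => h y a b) = fun x =>
      2 * (deriv B (rsq x) * (x k * (x a * x b)))
      + (kd a k * (B (rsq x) * x b) + kd b k * (B (rsq x) * x a)) := by
    intro a b k
    funext x
    rw [H.pd_metric (hmem x), hA' _ (hmem x)]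
    ring
  refine ⟨fun a b => ?_, fun a b k => ?_, fun a b k l => ?_⟩
  · have := isBigO_mul_pow (k := 1) b0 (c2 a b) rfl
    simp only [pow_one] at this
    refine this.congr_left fun x => ?_
    rw [H.eq x (hmem x), hA _ (hmem x), Matrix.one_apply]
    simp [kd]
  · rw [e1]
    exact ((isBigO_mul_pow b1 (c3 k a b) rfl).const_mul_left 2).add
      (((isBigO_mul_pow b0 (c1 b) rfl).const_mul_left _).add
        ((isBigO_mul_pow b0 (c1 a) rfl).const_mul_left _))
  · have hdB := contDiffOn_deriv H.isOpen H.smooth_B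
    have e2 : ∀ x, pd l (pd k (fun y => h y a b)) x =
        4 * (deriv (deriv B) (rsq x) * (x l * (x k * (x a * x b))))
        + 2 * (kd k l * (deriv B (rsq x) * (x a * x b))
          + (kd a l * (deriv B (rsq x) * (x k * x b)) + kd b l * (deriv B (rsq x) * (x k * x a))))
        + (2 * kd a k * (deriv B (rsq x) * (x l * x b))
          + 2 * kd b k * (deriv B (rsq x) * (x l * x a)))
        + (kd a k * kd b l + kd b k * kd a l) * B (rsq x) := by
      intro x
      have d0 := differentiableAt_of_contDiffOn H.isOpen H.smooth_B (hmem x)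
      have d1 := differentiableAt_of_contDiffOn H.isOpen hdB (hmem x)
      have d0' := differentiableAt_comp_rsq d0
      have d1' := differentiableAt_comp_rsq d1
      rw [e1, pd_add l (by fun_prop) (by fun_prop), pd_mul l (by fun_prop) (by fun_prop),
        pd_mul l d1' (by fun_prop), pd_mul l (by fun_prop) (by fun_prop),
        pd_mul l (by fun_prop) (by fun_prop),
        pd_add l (by fun_prop) (by fun_prop), pd_mul l (by fun_prop) (by fun_prop),
        pd_mul l d0' (by fun_prop), pd_mul l (by fun_prop) (by fun_prop),
        pd_mul l d0' (by fun_prop), pd_comp_rsq l d0, pd_comp_rsq l d1]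
      simp only [pd_const, pd_coord]
      ring
    simp only [e2]
    refine (((?_ : IsBigO _ _ _).add ?_).add ?_).add ?_
    · exact (isBigO_mul_pow b2 (c4 l k a b) rfl).const_mul_left 4
    · exact (((isBigO_mul_pow b1 (c2 a b) rfl).const_mul_left _).add
        (((isBigO_mul_pow b1 (c2 k b) rfl).const_mul_left _).add
          ((isBigO_mul_pow b1 (c2 k a) rfl).const_mul_left _))).const_mul_left 2
    · exact ((isBigO_mul_pow b1 (c2 l b) rfl).const_mul_left _).add
        ((isBigO_mul_pow b1 (c2 l a) rfl).const_mul_left _)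
    · exact b0.const_mul_left _

namespace ShellParams

variable (p : ShellParams)

theorem decaysAt_B (h : p.ε = 0) : DecaysAt 3 p.B := by
  -- For ε = 0 and large u, τ is 1 / r and B = g / (1 - u g) with g = τ³ (2M - Q² τ). Near τ = 0 the
  -- denominator is positive.
  refine ⟨fun τ => (2 * p.M - p.Q ^ 2 * τ) / (1 - 2 * p.M * τ + p.Q ^ 2 * τ ^ 2),
    {τ | 0 < 1 - 2 * p.M * τ + p.Q ^ 2 * τ ^ 2}, ?_, by simp, ?_, ?_⟩
  · exact isOpen_lt continuous_const (by fun_prop)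
  · refine ContDiffOn.div (by fun_prop) (by fun_prop) fun τ hτ => ne_of_gt hτ
  · filter_upwards [eventually_ge_atTop p.β, eventually_ge_atTop (2 * p.lam)] with u h1 h2
    have hu : 0 < u := (p.α_pos.trans p.α_lt_β).trans_le h1
    have hk : p.k u = 0 := by
      rw [k, cutoff_eq_one (by linarith [p.lam_pos]) h2, sub_self, mul_zero]
    have hv : p.areaSq u = u := by simp [areaSq, h]
    have hL := p.lapse_pos (p.mem_dom hu.le)
    have hg : p.g u = 2 * p.M * (√u)⁻¹ ^ 3 - p.Q ^ 2 * (√u)⁻¹ ^ 4 := by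
      rw [g, hk, cutoff_eq_one p.α_lt_β h1]
      ring
    have hA : p.A u = 1 := by simp [A, h]
    rw [B, hA, hv, h, hg]
    rw [hv, hg] at hL
    have hs := Real.sqrt_pos.2 hu
    have hss : u = ((√u)⁻¹)⁻¹ ^ 2 := by rw [inv_inv, Real.sq_sqrt hu.le]
    have hτ : 0 < (√u)⁻¹ := inv_pos.2 hs
    generalize (√u)⁻¹ = τ at *
    have h3 : u * (2 * p.M * τ ^ 3 - p.Q ^ 2 * τ ^ 4) = 2 * p.M * τ - p.Q ^ 2 * τ ^ 2 := by
      rw [hss]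
      field_simp
    rw [h3] at *
    have h4 : 1 - 2 * p.M * τ + p.Q ^ 2 * τ ^ 2 = 1 - (2 * p.M * τ - p.Q ^ 2 * τ ^ 2) := by ring
    rw [h4]
    field_simp
    ring

theorem K_eq_zero (h : p.ε = 0) {x : E3} (hx : 2 * p.lam < rsq x) : p.data.K x = 0 := by
  have hz : ∀ v, 2 * p.lam < v → p.k v = 0 := fun v hv => by
    rw [k, cutoff_eq_one (by linarith [p.lam_pos]) hv.le, sub_self, mul_zero]
  have hd : deriv p.k (rsq x) = 0 := by
    have : p.k =ᶠ[𝓝 (rsq x)] fun _ => 0 := by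
      filter_upwards [lt_mem_nhds hx] with v hv
      exact hz v hv
    rw [this.deriv_eq, deriv_const]
  have hv : p.areaSq (rsq x) = rsq x := by simp [areaSq, h]
  ext i j
  simp [data, Profiles.data, profiles, radialMatrix, hv, hz _ hx, hd]

theorem asymptoticallyFlat (h : p.ε = 0) : p.data.AsymptoticallyFlat := by
  have H := p.profiles.radialMetric.isBigO_metric p.profiles.mem_of_nonneg
    (fun u _ => show p.A u = 1 by simp [A, h]) (p.decaysAt_B h)
  have hK : ∀ᶠ x in cobounded E3, 2 * p.lam < rsq x := by
    simp only [rsq_eq_norm_sq]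
    exact ((tendsto_pow_atTop two_ne_zero).comp tendsto_norm_cobounded_atTop).eventually
      (eventually_gt_atTop _)
  refine ⟨H.1, H.2.1, H.2.2, fun a b => ?_, fun a b k => ?_⟩
  · refine EventuallyEq.trans_isBigO ?_ (isBigO_zero _ _)
    filter_upwards [hK] with x hx
    rw [p.K_eq_zero h hx]
    rfl
  · refine EventuallyEq.trans_isBigO ?_ (isBigO_zero _ _)
    filter_upwards [hK] with x hx
    have : (fun y => p.data.K y a b) =ᶠ[𝓝 x] fun _ => 0 := by
      filter_upwards [eventually_rsq_mem (isOpen_Ioi (a := 2 * p.lam)) hx] with y hy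
      rw [p.K_eq_zero h hy]
      rfl
    rw [pd_congr k this, pd_const]

theorem not_asymptoticallyFlat (h : 0 < p.ε) : ¬ p.data.AsymptoticallyFlat := by
  intro F
  obtain ⟨t, ht, ht0⟩ := ((F.tendsto_radius.eventually_gt_atTop (√(1 / p.ε))).and
    (eventually_gt_atTop 0)).exists
  rw [p.radius_eq ht0.le] at ht
  refine absurd (Real.sqrt_le_sqrt ?_) (not_le.2 ht)
  rw [le_div_iff₀ h, mul_comm]
  exact (p.ε_mul_areaSq_lt (sq_nonneg t)).le

end ShellParams

/-! ### Examples -/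

/-- A factor c in [0, 1] cannot raise 2m / r above the larger of 0 and its uncut value, so
regularity need only be checked for the full Reissner–Nordström function. -/
theorem shell_regular {c M Q v b : ℝ} (hc0 : 0 ≤ c) (hc1 : c ≤ 1) (hv : 0 < v)
    (hb : 0 ≤ b) (h : 0 < v - 2 * M * √v + Q ^ 2 + v * b) :
    c * (2 * M / √v - Q ^ 2 / v) < 1 + b := by
  have hs := Real.sqrt_pos.2 hv
  have hss := Real.sq_sqrt hv.le
  rcases le_total (2 * M / √v - Q ^ 2 / v) 0 with h0 | h0
  · nlinarith [mul_nonneg hc0 (neg_nonneg.2 h0)]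
  · have h1 : c * (2 * M / √v - Q ^ 2 / v) ≤ 2 * M / √v - Q ^ 2 / v := by nlinarith
    refine h1.trans_lt ?_
    generalize √v = r at *
    subst hss
    have h2 : 1 + b - (2 * M / r - Q ^ 2 / r ^ 2) =
        (r ^ 2 - 2 * M * r + Q ^ 2 + r ^ 2 * b) / r ^ 2 := by
      field_simp
      ring
    have h3 := div_pos h hv
    rw [← h2] at h3
    linarith

namespace ShellParams

theorem areaSq_of_ε_eq_zero {p : ShellParams} (h : p.ε = 0) (u : ℝ) : p.areaSq u = u := by
  simp [areaSq, h]

theorem areaRadius_of_ε_eq_zero {p : ShellParams} (h : p.ε = 0) {t : ℝ} (ht : 0 < t) :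
    p.data.areaRadius t = t := by
  rw [p.areaRadius_eq ht, areaSq_of_ε_eq_zero h, Real.sqrt_sq ht.le]

theorem theta_mul_theta_of_ε_eq_zero {p : ShellParams} (h : p.ε = 0) {s : ℝ} (hs : 0 < s)
    (hβ : s ^ 2 = p.β) {x : E3} (hx : s ≤ ‖x‖) :
    p.data.thetaPlus x * p.data.thetaMinus x =
      4 / ‖x‖ ^ 4 * (‖x‖ ^ 2 - 2 * p.M * ‖x‖ + p.Q ^ 2) := by
  rw [p.theta_mul_theta hs ((areaSq_of_ε_eq_zero h _).trans hβ) hx, areaSq_of_ε_eq_zero h,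
    Real.sqrt_sq (norm_nonneg x)]

theorem hasMass {p : ShellParams} (h : p.ε = 0) {s : ℝ} (hs : 0 < s) (hβ : s ^ 2 = p.β) :
    p.data.HasMass p.M := by
  have hβ' := (areaSq_of_ε_eq_zero h _).trans hβ
  exact ((p.chargedBody hs hβ').hasMass_iff (p.asymptoticallyFlat h) p.M).2
    (p.exteriorMass_eq hs hβ')

/-- A time-symmetric shell of charge `q`, with inner area radius `(1 + η) q / 2` and outer area
radius `(1 + η) ^ 2 q / 2`. -/
def thin (q η : ℝ) (hq : 0 < q) (hη : 0 < η) : ShellParams where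
  ε := 0
  Q := q
  -- Less than the charge, so the quadratic has no roots and no sphere outside is trapped; and just
  -- large enough for the bracket 2M - Q² / r to vanish at the inner edge.
  M := q / (1 + η)
  α := (q / 2 * (1 + η)) ^ 2
  β := (q / 2 * (1 + η) ^ 2) ^ 2
  κ₀ := 0
  lam := 1
  ε_nonneg := le_rfl
  Q_ne_zero := hq.ne'
  α_pos := by positivity
  α_lt_β := by
    apply pow_lt_pow_left₀ _ (by positivity) two_ne_zero
    have : 0 < q / 2 * (1 + η) * η := by positivity
    nlinarith
  lam_pos := one_pos
  mass_ge := by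
    rw [Real.sqrt_sq (by positivity)]
    apply le_of_eq
    field_simp
  regular := fun v hv _ => by
    have hv0 : 0 < v := lt_trans (by positivity) hv
    have hs := Real.sqrt_pos.2 hv0
    have hss := Real.sq_sqrt hv0.le
    refine shell_regular (cutoff_nonneg _ _ _) (cutoff_le_one _ _ _) hv0 (by positivity) ?_
    have hM : q / (1 + η) < q := div_lt_self hq (by linarith)
    have h1 : 0 < (q - q / (1 + η)) * √v := mul_pos (by linarith) hs
    nlinarith [sq_nonneg (√v - q)]

/-- A shell of charge `Q` and mass `|Q|`, of area radius `3 |Q| / 4`, whose slice is continued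
through the extreme horizon. -/
def extreme (Q : ℝ) (hQ : Q ≠ 0) : ShellParams where
  ε := 0
  Q := Q
  M := |Q|
  α := (|Q| / 2) ^ 2
  β := (3 * |Q| / 4) ^ 2
  -- At r = |Q| the function 1 - 2m / r vanishes, so a time-symmetric slice would be singular there;
  -- k must be non-zero up to and including this sphere, hence also `lam`.
  κ₀ := 1
  lam := Q ^ 2
  ε_nonneg := le_rfl
  Q_ne_zero := hQ
  α_pos := by positivity
  α_lt_β := by
    have := abs_pos.2 hQ
    apply pow_lt_pow_left₀ _ (by positivity) two_ne_zero
    linarith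
  lam_pos := by positivity
  mass_ge := by
    rw [Real.sqrt_sq (by positivity), ← sq_abs]
    apply le_of_eq
    ring
  regular := fun v hv _ => by
    have hq := abs_pos.2 hQ
    have hv0 : 0 < v := lt_trans (by positivity) hv
    have hs := Real.sqrt_pos.2 hv0
    have hss := Real.sq_sqrt hv0.le
    refine shell_regular (cutoff_nonneg _ _ _) (cutoff_le_one _ _ _) hv0 (by positivity) ?_
    have h1 : v - 2 * |Q| * √v + Q ^ 2 = (√v - |Q|) ^ 2 := by
      rw [← sq_abs Q]
      linear_combination -hss
    rw [h1]
    by_cases h2 : v ≤ Q ^ 2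
    · rw [cutoff_eq_zero (by nlinarith [sq_abs Q]) h2]
      positivity
    · have h3 : √v - |Q| ≠ 0 := by
        intro h
        apply h2
        rw [← hss, show √v = |Q| by linarith, sq_abs]
      positivity

/-- A shell of charge one, mass `5 / 4` and area radius `9 / 20`; in the exterior
`1 - 2 m / r = (r - 1 / 2) (r - 2) / r ^ 2`. -/
def trapped : ShellParams where
  ε := 0
  Q := 1
  M := 5 / 4
  α := (2 / 5) ^ 2
  β := (9 / 20) ^ 2
  -- In the trapped range r² - 5r/2 + 1 ≥ -9/16, while r⁴ k² = 16 r⁴ ≥ 1 as soon as r ≥ 1/2. The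
  -- cut-off of k starts at r = 2, the outer root.
  κ₀ := 4
  lam := 4
  ε_nonneg := le_rfl
  Q_ne_zero := one_ne_zero
  α_pos := by norm_num
  α_lt_β := by norm_num
  lam_pos := by norm_num
  mass_ge := by
    rw [Real.sqrt_sq (by norm_num)]
    norm_num
  regular := fun v hv _ => by
    have hv0 : 0 < v := lt_trans (by positivity) hv
    have hs := Real.sqrt_pos.2 hv0
    have hss := Real.sq_sqrt hv0.le
    refine shell_regular (cutoff_nonneg _ _ _) (cutoff_le_one _ _ _) hv0 (by positivity) ?_
    by_cases h2 : v ≤ 4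
    · rw [cutoff_eq_zero (by norm_num) h2]
      generalize √v = r at *
      subst hss
      rcases le_total r (1 / 2) with h | h
      · have : 0 < r ^ 2 * (r ^ 2 * (4 * (1 - 0)) ^ 2) := by positivity
        nlinarith
      · nlinarith [sq_nonneg (r - 5 / 4), sq_nonneg (r ^ 2 - 1 / 4), pow_pos hs 3, pow_pos hs 4,
          mul_nonneg (sub_nonneg.2 h) (sub_nonneg.2 h)]
    · have h3 : 2 < √v := by
        rw [Real.lt_sqrt (by norm_num)]
        linarith
      have h4 : 0 ≤ v * (v * (4 * (1 - cutoff 4 (2 * 4) v)) ^ 2) := by positivity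
      have h5 : 0 < (√v - 1 / 2) * (√v - 2) := mul_pos (by linarith) (by linarith)
      have h6 : v - 2 * (5 / 4) * √v + 1 ^ 2 = (√v - 1 / 2) * (√v - 2) := by
        linear_combination -hss
      have h7 := add_pos_of_pos_of_nonneg h5 h4
      rw [← h6] at h7
      exact h7

/-- The shell of `trapped`, time-symmetric and in coordinates that cover only the spheres of area
radius less than `1 / 2`. -/
def bounded : ShellParams where
  -- Bounds the area radius by 1/2, the inner root, so the slice never reaches the trapped spheres.
  ε := 4
  Q := 1
  M := 5 / 4
  α := (2 / 5) ^ 2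
  β := (9 / 20) ^ 2
  κ₀ := 0
  lam := 1
  ε_nonneg := by norm_num
  Q_ne_zero := one_ne_zero
  α_pos := by norm_num
  α_lt_β := by norm_num
  lam_pos := one_pos
  mass_ge := by
    rw [Real.sqrt_sq (by norm_num)]
    norm_num
  regular := fun v hv h4 => by
    have hv0 : 0 < v := lt_trans (by positivity) hv
    have hs := Real.sqrt_pos.2 hv0
    have hss := Real.sq_sqrt hv0.le
    refine shell_regular (cutoff_nonneg _ _ _) (cutoff_le_one _ _ _) hv0 (by positivity) ?_
    have h5 : √v < 1 / 2 := by
      rw [Real.sqrt_lt' (by norm_num)]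
      linarith
    nlinarith

end ShellParams

open ShellParams

/-- Extreme data of any charge `Q ≠ 0`, with a horizon of area radius `|Q|` outside the body. -/
theorem exists_extreme (Q : ℝ) (hQ : Q ≠ 0) : ∃ (D : InitialData) (s s₁ : ℝ),
    D.ChargedBody s ∧ D.AsymptoticallyFlat ∧ D.charge s = Q ∧ D.HasMass |Q| ∧
    s < s₁ ∧ D.IsHorizon s₁ ∧ D.Untrapped (Metric.closedBall 0 s₁)ᶜ ∧
    D.areaRadius s₁ = |Q| := by
  have hq := abs_pos.2 hQ
  have hs : 0 < 3 * |Q| / 4 := by positivity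
  have hlt : 3 * |Q| / 4 < |Q| := by linarith
  have h0 : (extreme Q hQ).ε = 0 := rfl
  have hβ : (extreme Q hQ).areaSq ((3 * |Q| / 4) ^ 2) = (extreme Q hQ).β :=
    areaSq_of_ε_eq_zero h0 _
  have hθ : ∀ x : E3, |Q| ≤ ‖x‖ → (extreme Q hQ).data.thetaPlus x
      * (extreme Q hQ).data.thetaMinus x = 4 / ‖x‖ ^ 4 * (‖x‖ - |Q|) ^ 2 := by
    intro x hx
    rw [theta_mul_theta_of_ε_eq_zero h0 hs rfl (hlt.le.trans hx)]
    change 4 / ‖x‖ ^ 4 * (‖x‖ ^ 2 - 2 * |Q| * ‖x‖ + Q ^ 2) = _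
    rw [← sq_abs Q]
    ring
  refine ⟨(extreme Q hQ).data, 3 * |Q| / 4, |Q|, (extreme Q hQ).chargedBody hs hβ,
    (extreme Q hQ).asymptoticallyFlat h0, (extreme Q hQ).charge_eq hs hβ,
    hasMass h0 hs rfl, hlt, ⟨fun x hx => ?_, fun x hx => ?_⟩, fun x hx => ?_,
    areaRadius_of_ε_eq_zero h0 hq⟩
  · rw [hθ x hx.ge, hx]
    ring
  · rw [hθ x hx.le]
    positivity
  · have hx' : |Q| < ‖x‖ := by simpa using hx
    rw [hθ x hx'.le]
    have h1 : 0 < ‖x‖ := hq.trans hx'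
    have h2 : 0 < ‖x‖ - |Q| := by linarith
    positivity

/-- The size-charge inequality is sharp for thin shells. -/
theorem exists_thin_shells : ∃ (D : ℕ → InitialData) (s t m : ℕ → ℝ),
    (∀ n, (D n).ChargedBody (s n) ∧ (D n).AsymptoticallyFlat ∧
      (D n).Untrapped (Metric.closedBall 0 (s n))ᶜ ∧ (D n).HasMass (m n)) ∧
    (∀ n, (∀ x, (D n).K x = 0) ∧ 0 < t n ∧ t n < s n ∧
      ∀ x : E3, ‖x‖ < t n → (D n).μ x = 0 ∧ (D n).ρ x = 0) ∧
    Tendsto (fun n => (D n).areaRadius (t n) / (D n).areaRadius (s n)) atTop (𝓝 1) ∧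
    Tendsto (fun n => |(D n).charge (s n)| / (2 * (D n).areaRadius (s n))) atTop (𝓝 1) ∧
    Tendsto (fun n => (D n).areaRadius (s n)) atTop (𝓝 0) ∧
    Tendsto (fun n => (D n).charge (s n)) atTop (𝓝 0) ∧
    Tendsto m atTop (𝓝 0) := by
  set q : ℕ → ℝ := fun n => 1 / ((n : ℝ) + 1) with hqdef
  have hq : ∀ n, 0 < q n := fun n => Nat.one_div_pos_of_nat
  have hlim : Tendsto q atTop (𝓝 0) := tendsto_one_div_add_atTop_nhds_zero_nat
  have hlim1 : Tendsto (fun n => 1 + q n) atTop (𝓝 1) := by simpa using hlim.const_add 1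
  -- One null sequence serves both as charge and as thickness parameter, so the size-charge ratio (1
  -- + q n)⁻² tends to 1 while all scales shrink.
  set p : ℕ → ShellParams := fun n => thin (q n) (q n) (hq n) (hq n) with hp
  set s : ℕ → ℝ := fun n => q n / 2 * (1 + q n) ^ 2 with hsdef
  set t : ℕ → ℝ := fun n => q n / 2 * (1 + q n) with htdef
  have hs : ∀ n, 0 < s n := fun n => by have := hq n; simp only [hsdef]; positivity
  have ht : ∀ n, 0 < t n := fun n => by have := hq n; simp only [htdef]; positivity
  have hst : ∀ n, s n = t n * (1 + q n) := fun n => by simp only [hsdef, htdef]; ring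
  have h0 : ∀ n, (p n).ε = 0 := fun n => rfl
  have hβ : ∀ n, (p n).areaSq (s n ^ 2) = (p n).β := fun n => areaSq_of_ε_eq_zero (h0 n) _
  have hα : ∀ n, (p n).areaSq (t n ^ 2) = (p n).α := fun n => areaSq_of_ε_eq_zero (h0 n) _
  have hRs : ∀ n, (p n).data.areaRadius (s n) = s n := fun n =>
    areaRadius_of_ε_eq_zero (h0 n) (hs n)
  have hRt : ∀ n, (p n).data.areaRadius (t n) = t n := fun n =>
    areaRadius_of_ε_eq_zero (h0 n) (ht n)
  have hch : ∀ n, (p n).data.charge (s n) = q n := fun n => (p n).charge_eq (hs n) (hβ n)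
  refine ⟨fun n => (p n).data, s, t, fun n => q n / (1 + q n), fun n => ⟨(p n).chargedBody (hs n)
    (hβ n), (p n).asymptoticallyFlat (h0 n), fun x hx => ?_, hasMass (h0 n) (hs n) rfl⟩,
    fun n => ⟨fun x => ?_, ht n, ?_, fun x hx => (p n).interior (ht n) (hα n) hx⟩, ?_, ?_, ?_, ?_,
    ?_⟩
  · have hx' : s n < ‖x‖ := by simpa using hx
    have hx0 : 0 < ‖x‖ := (hs n).trans hx'
    rw [theta_mul_theta_of_ε_eq_zero (h0 n) (hs n) rfl hx'.le]
    have hM : q n / (1 + q n) < q n := div_lt_self (hq n) (by linarith [hq n])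
    have h1 : 0 < (q n - q n / (1 + q n)) * ‖x‖ := mul_pos (by linarith) hx0
    change 0 < 4 / ‖x‖ ^ 4 * (‖x‖ ^ 2 - 2 * (q n / (1 + q n)) * ‖x‖ + q n ^ 2)
    refine mul_pos (by positivity) ?_
    nlinarith [sq_nonneg (‖x‖ - q n)]
  · have hk : (p n).k = fun _ => 0 := by
      funext v
      exact zero_mul _
    ext i j
    simp [ShellParams.data, Profiles.data, profiles, radialMatrix, hk]
  · have := mul_pos (ht n) (hq n)
    rw [hst]
    linarith
  · simp only [hRs, hRt]
    have h1 : ∀ n, t n / s n = (1 + q n)⁻¹ := fun n => by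
      have := (ht n).ne'
      have := hq n
      rw [hst]
      field_simp
    simp only [h1]
    simpa using hlim1.inv₀ one_ne_zero
  · simp only [hRs, hch]
    have h1 : ∀ n, |q n| / (2 * s n) = ((1 + q n) ^ 2)⁻¹ := fun n => by
      have := hq n
      rw [abs_of_pos this]
      simp only [hsdef]
      field_simp
    simp only [h1]
    simpa using (hlim1.pow 2).inv₀ (by norm_num)
  · simp only [hRs]
    simp only [hsdef]
    simpa using (hlim.div_const 2).mul (hlim1.pow 2)
  · simp only [hch]
    exact hlim
  · have h1 := hlim.div hlim1 one_ne_zero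
    rw [zero_div] at h1
    exact h1

/-- Without asymptotic flatness the size-charge inequality fails. -/
theorem exists_not_asymptoticallyFlat : ∃ (D : InitialData) (s : ℝ), D.ChargedBody s ∧
    ¬ D.AsymptoticallyFlat ∧ D.Untrapped (Metric.closedBall 0 s)ᶜ ∧
    2 * D.areaRadius s < |D.charge s| := by
  -- The solution of s² / (1 + 4 s²) = (9/20)², the coordinate radius of the sphere of area radius
  -- 9/20.
  have hs : 0 < √(81 / 76 : ℝ) := Real.sqrt_pos.2 (by norm_num)
  have hss : √(81 / 76 : ℝ) ^ 2 = 81 / 76 := Real.sq_sqrt (by norm_num)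
  have hε : bounded.ε = 4 := rfl
  have hβe : bounded.β = (9 / 20) ^ 2 := rfl
  have hβ : bounded.areaSq (√(81 / 76 : ℝ) ^ 2) = bounded.β := by
    rw [hss, areaSq, hε, hβe]
    norm_num
  refine ⟨bounded.data, √(81 / 76), bounded.chargedBody hs hβ,
    bounded.not_asymptoticallyFlat (by rw [hε]; norm_num), fun x hx => ?_, ?_⟩
  · have hx' : √(81 / 76 : ℝ) < ‖x‖ := by simpa using hx
    have hv := bounded.areaSq_pos (hs.trans hx')
    have hlt := bounded.ε_mul_areaSq_lt (sq_nonneg ‖x‖)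
    rw [hε] at hlt
    rw [bounded.theta_mul_theta hs hβ hx'.le]
    have h1 := Real.sqrt_pos.2 hv
    have h2 : √(bounded.areaSq (‖x‖ ^ 2)) < 1 / 2 := by
      rw [Real.sqrt_lt' (by norm_num)]
      linarith
    generalize √(bounded.areaSq (‖x‖ ^ 2)) = r at *
    change 0 < 4 / r ^ 4 * (r ^ 2 - 2 * (5 / 4) * r + 1 ^ 2)
    refine mul_pos (by positivity) ?_
    nlinarith
  · rw [bounded.charge_eq hs hβ, bounded.areaRadius_eq hs, hβ, hβe, Real.sqrt_sq (by norm_num)]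
    change 2 * (9 / 20 : ℝ) < |(1 : ℝ)|
    norm_num

/-- Behind a non-degenerate horizon a body may violate the size-charge inequality. -/
theorem exists_behind_horizon : ∃ (D : InitialData) (s s₁ : ℝ), D.ChargedBody s ∧
    D.AsymptoticallyFlat ∧ s < s₁ ∧ D.IsHorizon s₁ ∧ D.Untrapped (Metric.closedBall 0 s₁)ᶜ ∧
    (∃ a, s < a ∧ a < s₁ ∧ D.Trapped {x | a < ‖x‖ ∧ ‖x‖ < s₁}) ∧
    2 * D.areaRadius s < |D.charge s| := by
  have hs : (0 : ℝ) < 9 / 20 := by norm_num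
  have h0 : trapped.ε = 0 := rfl
  have hβ : trapped.areaSq ((9 / 20) ^ 2) = trapped.β := areaSq_of_ε_eq_zero h0 _
  have hθ : ∀ x : E3, 9 / 20 < ‖x‖ → trapped.data.thetaPlus x * trapped.data.thetaMinus x =
      4 / ‖x‖ ^ 4 * ((‖x‖ - 1 / 2) * (‖x‖ - 2)) := by
    intro x hx
    rw [theta_mul_theta_of_ε_eq_zero h0 hs rfl hx.le]
    change 4 / ‖x‖ ^ 4 * (‖x‖ ^ 2 - 2 * (5 / 4) * ‖x‖ + 1 ^ 2) = _
    ring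
  have hpos : ∀ x : E3, 2 < ‖x‖ → 0 < trapped.data.thetaPlus x * trapped.data.thetaMinus x := by
    intro x hx
    rw [hθ x (by linarith)]
    have h1 : 0 < ‖x‖ := by linarith
    exact mul_pos (by positivity) (mul_pos (by linarith) (by linarith))
  refine ⟨trapped.data, 9 / 20, 2, trapped.chargedBody hs hβ, trapped.asymptoticallyFlat h0,
    by norm_num, ⟨fun x hx => ?_, fun x hx => (hpos x hx).le⟩, fun x hx => hpos x (by simpa using hx),
    -- The trapped region lies between the two roots of the quadratic; the inner one, 1/2, is
    -- outside the body.
    ⟨1 / 2, by norm_num, by norm_num, fun x hx => ?_⟩, ?_⟩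
  · rw [hθ x (by rw [hx]; norm_num), hx]
    ring
  · obtain ⟨h1, h2⟩ := hx
    rw [hθ x (by linarith)]
    have h3 : 0 < ‖x‖ := by linarith
    exact mul_neg_of_pos_of_neg (by positivity)
      (mul_neg_of_pos_of_neg (by linarith) (by linarith))
  · rw [trapped.charge_eq hs hβ, areaRadius_of_ε_eq_zero h0 hs]
    change 2 * (9 / 20 : ℝ) < |(1 : ℝ)|
    norm_num

end

theorem theorem1 :
    -- (i)
    (∀ (D : InitialData) (s : ℝ), D.ChargedBody s → D.AsymptoticallyFlat →
      D.Untrapped (Metric.closedBall 0 s)ᶜ →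
      |D.charge s| < 2 * D.areaRadius s) ∧
    -- (ii) inequality; equality whenever the exterior is extreme (mass equal to `|Q|`)
    (∀ (D : InitialData) (s s₁ : ℝ), D.ChargedBody s → D.AsymptoticallyFlat →
      s ≤ s₁ → D.IsHorizon s₁ →
      |D.charge s| ≤ D.areaRadius s₁ ∧
        (D.HasMass |D.charge s| → D.areaRadius s₁ = |D.charge s|)) ∧
    -- (ii) extreme data with a horizon exist, for every charge
    (∀ Q : ℝ, Q ≠ 0 → ∃ (D : InitialData) (s s₁ : ℝ),
      D.ChargedBody s ∧ D.AsymptoticallyFlat ∧ D.charge s = Q ∧ D.HasMass |Q| ∧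
      s < s₁ ∧ D.IsHorizon s₁ ∧ D.Untrapped (Metric.closedBall 0 s₁)ᶜ ∧
      D.areaRadius s₁ = |Q|) ∧
    -- (a)
    (∃ (D : ℕ → InitialData) (s t m : ℕ → ℝ),
      (∀ n, (D n).ChargedBody (s n) ∧ (D n).AsymptoticallyFlat ∧
        (D n).Untrapped (Metric.closedBall 0 (s n))ᶜ ∧ (D n).HasMass (m n)) ∧
      -- the bodies are time-symmetric charged shells, empty inside, of vanishing relative thickness
      (∀ n, (∀ x, (D n).K x = 0) ∧ 0 < t n ∧ t n < s n ∧
        ∀ x : E3, ‖x‖ < t n → (D n).μ x = 0 ∧ (D n).ρ x = 0) ∧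
      Filter.Tendsto (fun n => (D n).areaRadius (t n) / (D n).areaRadius (s n))
        Filter.atTop (𝓝 1) ∧
      Filter.Tendsto (fun n => |(D n).charge (s n)| / (2 * (D n).areaRadius (s n)))
        Filter.atTop (𝓝 1) ∧
      Filter.Tendsto (fun n => (D n).areaRadius (s n)) Filter.atTop (𝓝 0) ∧
      Filter.Tendsto (fun n => (D n).charge (s n)) Filter.atTop (𝓝 0) ∧
      Filter.Tendsto m Filter.atTop (𝓝 0)) ∧
    -- (b)
    (∃ (D : InitialData) (s : ℝ), D.ChargedBody s ∧ ¬ D.AsymptoticallyFlat ∧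
      D.Untrapped (Metric.closedBall 0 s)ᶜ ∧
      2 * D.areaRadius s < |D.charge s|) ∧
    -- (c)
    (∃ (D : InitialData) (s s₁ : ℝ), D.ChargedBody s ∧ D.AsymptoticallyFlat ∧
      s < s₁ ∧ D.IsHorizon s₁ ∧ D.Untrapped (Metric.closedBall 0 s₁)ᶜ ∧
      (∃ a, s < a ∧ a < s₁ ∧ D.Trapped {x | a < ‖x‖ ∧ ‖x‖ < s₁}) ∧
      2 * D.areaRadius s < |D.charge s|) := by
  refine ⟨fun D s H F U => H.charge_lt_two_mul_areaRadius F U,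
    fun D s s₁ H F hs hor => H.charge_le_of_isHorizon F hs hor, exists_extreme,
    exists_thin_shells, exists_not_asymptoticallyFlat, exists_behind_horizon⟩
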